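/- Let $k$ be a field and let $U,V$ be Hopf algebras over $k$ with bijective antipodes $S_U,S_V$ and comultiplications written $m\mapsto m_1\otimes m_2$, $x\mapsto x_1\otimes x_2$. Let $\langle\,,\rangle:U\otimes V\to k$ be a pairing, i.e. $\langle mn,x\rangle=\langle m,x_1\rangle\langle n,x_2\rangle$, $\langle m,xy\rangle=\langle m_1,x\rangle\langle m_2,y\rangle$, $\langle 1,x\rangle=\varepsilon(x)$, $\langle m,1\rangle=\varepsilon(m)$. Let $U^{\rm cop}$ be $U$ with the opposite comultiplication and antipode $S_U^{-1}$ (Sweedler subscripts below always refer to $U$, not $U^{\rm cop}$, unless said otherwise). The generalized quantum double $D=D(U^{\rm cop},V)$ is the space $U\otimes V$ with unit $1\otimes 1$, counit $\varepsilon\otimes\varepsilon$ and $$(m\otimes x)(n\otimes y)=\langle n_3,x_1\rangle\langle S_U^{-1}(n_1),x_3\rangle\, mn_2\otimes x_2y,\qquad \Delta(m\otimes x)=(m_2\otimes x_1)\otimes(m_1\otimes x_2),$$ $$S(m\otimes x)=\langle m_1,x_3\rangle\langle m_3,S_V^{-1}(x_1)\rangle\, S_U^{-1}(m_2)\otimes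 S_V(x_2).$$ Let $\gamma:V\to U^{\rm cop}$ be a bialgebra map such that for all $y\in V$, $m\in U$ $$\gamma(y)m=\langle S_U^{-1}(m_1),y_3\rangle\langle m_3,y_1\rangle\, m_2\gamma(y_2).$$ Put $i:U^{\rm cop}\to D$, $i(m)=m\otimes 1$; $\pi:D\to U^{\rm cop}$, $\pi(m\otimes x)=m\gamma(x)$; $B=\{a\in D\mid a_1\otimes\pi(a_2)=a\otimes 1\}$; and $\Pi(a)=a_1\,i(S_U^{-1}(\pi(a_2)))$ for $a\in D$. Then: (1) $D$ and $U^{\rm cop}$ are Hopf algebras, and $i,\pi$ are Hopf algebra maps with $\pi i=\mathrm{id}$. (2) The map $\theta(y)=S_U(\gamma(y_2))\otimes y_1=\gamma(S_V^{-1}(y_2))\otimes y_1$ is a bijection from $V$ onto $B$, and $B$ is the image of $\Pi$. (3) Let $\underline V$ be the space $V$ with the left action and left coaction of $U^{\rm cop}$ $$m\rhd y=\langle m_1,S_V^{-1}(y_1)\rangle\, y_2\,\langle m_2,S_V^{-2}(y_3)\rangle=\langle m,S_V^{-1}(S_V^{-1}(y_3)y_1)\rangle\, y_2,\qquad \lambda(y)=\gamma(S_V^{-1}(y_3)y_1)\otimes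 y_2,$$ the unit and the counit of $V$, and $$x\cdot y=\langle\gamma(y_2),S_V(x_1)x_3\rangle\, x_2y_1,\qquad \underline\Delta(x)=\langle\gamma(S_V(x_4)x_6),S_V^{-1}(x_3)x_1\rangle\, x_2\otimes x_5,$$ $$\underline S(x)=\langle\gamma(x_4),x_1S_V(x_3)\rangle\, S_V(x_2).$$ Under $\theta$ these maps are the ones that $B$ carries as the coinvariants of the projection $\pi$: the action $m\rhd b=i(m_{(1)})\,b\,i(S_U^{-1}(m_{(2)}))$ with $m_{(1)}\otimes m_{(2)}=m_2\otimes m_1$ the comultiplication of $U^{\rm cop}$, the coaction $b\mapsto\pi(b_1)\otimes b_2$, the multiplication, unit and counit of $D$, the comultiplication $\Pi(a)\mapsto\Pi(a_1)\otimes\Pi(a_2)$ ($a\in D$), and the antipode $b\mapsto i(\pi(b_1))S_D(b_2)$. (4) $\underline V$ is a Hopf algebra in the braided monoidal category ${}^{U^{\rm cop}}_{U^{\rm cop}}\mathcal{YD}$ of left Yetter–Drinfeld modules over $U^{\rm cop}$ (with braiding $m\otimes n\mapsto m_{-1}\cdot n\otimes m_0$). (5) The Radford biproduct $\underline V\times U^{\rm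 cop}$ (the space $\underline V\otimes U$ with smash product multiplication, smash coproduct comultiplication and antipode $y\times m\mapsto(1\times S_U^{-1}(y_{-1}m))(\underline S(y_0)\times 1)$) is a Hopf algebra, and $y\times m\mapsto\theta(y)\,i(m)$ is an isomorphism of Hopf algebras $\underline V\times U^{\rm cop}\to D(U^{\rm cop},V)$. -/

import Mathlib

open scoped TensorProduct

noncomputable section

namespace DoubleBiproduct

/-! ### Sweedler notation -/

section Sweedler

variable {k C C' W : Type*} [CommSemiring k] [AddCommMonoid C] [Module k C] [Coalgebra k C]
  [AddCommMonoid C'] [Module k C'] [Coalgebra k C'] [AddCommMonoid W] [Module k W]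

/-- Sweedler notation: `sweedler n f x = ∑ f (x₁, …, xₙ₊₁)`, where `x₁ ⊗ ⋯ ⊗ xₙ₊₁` is the
`n`-fold iterated comultiplication of `x`. The Sweedler component `x_j` is the argument of `f`
with index `j - 1`. -/
def sweedler : (n : ℕ) →
    MultilinearMap k (fun _ : Fin (n + 1) => C) W →ₗ[k] C →ₗ[k] W
  | 0 => LinearMap.mk₂ k (fun f x => f (fun _ => x))
      (fun _ _ _ => rfl) (fun _ _ _ => rfl)
      (fun f x y => by
        have h := f.map_update_add (fun _ => 0) 0 x y
        have e : ∀ z : C, Function.update (fun _ : Fin (0 + 1) => (0 : C)) 0 z = fun _ => z :=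
          fun z => by ext i; fin_cases i; simp
        simpa only [e] using h)
      (fun c f x => by
        have h := f.map_update_smul (fun _ => 0) 0 c x
        have e : ∀ z : C, Function.update (fun _ : Fin (0 + 1) => (0 : C)) 0 z = fun _ => z :=
          fun z => by ext i; fin_cases i; simp
        simpa only [e] using h)
  | n + 1 =>
    { toFun := fun f =>
        TensorProduct.lift (sweedler n ∘ₗ f.curryLeft) ∘ₗ (Coalgebra.comul (R := k) (A := C))
      map_add' := fun f g => by
        rw [← LinearMap.add_comp]
        congr 1
        ext a b
        simp [show (f + g).curryLeft a = f.curryLeft a + g.curryLeft a from rfl]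
      map_smul' := fun c f => by
        rw [RingHom.id_apply, ← LinearMap.smul_comp]
        congr 1
        ext a b
        simp [show (c • f).curryLeft a = c • f.curryLeft a from rfl] }

/-- Sweedler notation in two variables: `sweedler₂ n m f x y = ∑ f (x₁, …, xₙ₊₁) (y₁, …, yₘ₊₁)`. -/
def sweedler₂ (n m : ℕ)
    (f : MultilinearMap k (fun _ : Fin (n + 1) => C)
      (MultilinearMap k (fun _ : Fin (m + 1) => C') W)) :
    C →ₗ[k] C' →ₗ[k] W :=
  sweedler m ∘ₗ sweedler n f

end Sweedler

/-! ### Hopf algebras, Yetter-Drinfeld modules and Radford biproducts -/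

section General

variable {k A B H M N P Q X Y Z W : Type*} [CommSemiring k]
  [AddCommMonoid A] [Module k A] [AddCommMonoid B] [Module k B] [AddCommMonoid H] [Module k H]
  [AddCommMonoid M] [Module k M] [AddCommMonoid N] [Module k N] [AddCommMonoid P] [Module k P]
  [AddCommMonoid Q] [Module k Q] [AddCommMonoid X] [Module k X] [AddCommMonoid Y] [Module k Y]
  [AddCommMonoid Z] [Module k Z] [AddCommMonoid W] [Module k W]

/-- `s` applied to the two middle factors. -/
def middle (s : X ⊗[k] Y →ₗ[k] Z ⊗[k] W) :
    (P ⊗[k] X) ⊗[k] (Y ⊗[k] Q) →ₗ[k] (P ⊗[k] Z) ⊗[k] (W ⊗[k] Q) :=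
  (TensorProduct.assoc k P Z (W ⊗[k] Q)).symm.toLinearMap ∘ₗ
    LinearMap.lTensor P ((TensorProduct.assoc k Z W Q).toLinearMap ∘ₗ s.rTensor Q ∘ₗ
      (TensorProduct.assoc k X Y Q).symm.toLinearMap) ∘ₗ
    (TensorProduct.assoc k P X (Y ⊗[k] Q)).toLinearMap

/-- The structure maps of a Hopf algebra (in a category of vector spaces with extra structure)
on the space `A`, without axioms. -/
structure HopfData (k A : Type*) [CommSemiring k] [AddCommMonoid A] [Module k A] where
  /-- multiplication -/
  mul : A ⊗[k] A →ₗ[k] A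
  /-- unit element -/
  one : A
  /-- comultiplication -/
  comul : A →ₗ[k] A ⊗[k] A
  /-- counit -/
  counit : A →ₗ[k] k
  /-- antipode -/
  antipode : A →ₗ[k] A

/-- The Hopf algebra axioms, where the tensor square of `A` is made into an algebra by means of
the map `c : A ⊗ A → A ⊗ A`:
`(a ⊗ b)(a' ⊗ b') = a c(b ⊗ a') b'`. -/
structure HopfData.HopfAxioms (D : HopfData k A) (c : A ⊗[k] A →ₗ[k] A ⊗[k] A) : Prop where
  mul_assoc : ∀ x y z, D.mul (D.mul (x ⊗ₜ y) ⊗ₜ z) = D.mul (x ⊗ₜ D.mul (y ⊗ₜ z))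
  one_mul : ∀ x, D.mul (D.one ⊗ₜ x) = x
  mul_one : ∀ x, D.mul (x ⊗ₜ D.one) = x
  coassoc : ∀ x, TensorProduct.assoc k A A A (D.comul.rTensor A (D.comul x)) =
    D.comul.lTensor A (D.comul x)
  counit_left : ∀ x, D.counit.rTensor A (D.comul x) = 1 ⊗ₜ x
  counit_right : ∀ x, D.counit.lTensor A (D.comul x) = x ⊗ₜ 1
  comul_mul : ∀ x y, D.comul (D.mul (x ⊗ₜ y)) =
    TensorProduct.map D.mul D.mul (middle c (D.comul x ⊗ₜ D.comul y))
  comul_one : D.comul D.one = D.one ⊗ₜ D.one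
  counit_mul : ∀ x y, D.counit (D.mul (x ⊗ₜ y)) = D.counit x * D.counit y
  counit_one : D.counit D.one = 1
  antipode_left : ∀ x, D.mul (D.antipode.rTensor A (D.comul x)) = D.counit x • D.one
  antipode_right : ∀ x, D.mul (D.antipode.lTensor A (D.comul x)) = D.counit x • D.one

/-- An (ordinary) Hopf algebra over `k`. -/
def HopfData.IsHopfAlgebra (D : HopfData k A) : Prop :=
  D.HopfAxioms (TensorProduct.comm k A A).toLinearMap

/-- `f` is a morphism of bialgebras. -/
structure IsBialgebraHom (D : HopfData k A) (E : HopfData k B) (f : A →ₗ[k] B) : Prop where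
  map_mul : ∀ x y, f (D.mul (x ⊗ₜ y)) = E.mul (f x ⊗ₜ f y)
  map_one : f D.one = E.one
  map_comul : ∀ x, E.comul (f x) = TensorProduct.map f f (D.comul x)
  map_counit : ∀ x, E.counit (f x) = D.counit x

/-- `f` is a morphism of Hopf algebras. -/
structure IsHopfAlgebraHom (D : HopfData k A) (E : HopfData k B) (f : A →ₗ[k] B) : Prop
    extends IsBialgebraHom D E f where
  map_antipode : ∀ x, f (D.antipode x) = E.antipode (f x)

/-- A left action and a left coaction of `H` on `M`, without axioms. -/
structure YDData (k H M : Type*) [CommSemiring k] [AddCommMonoid H] [Module k H]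
    [AddCommMonoid M] [Module k M] where
  /-- the left action -/
  act : H ⊗[k] M →ₗ[k] M
  /-- the left coaction -/
  coact : M →ₗ[k] H ⊗[k] M

/-- Left Yetter-Drinfeld modules over `K`. The last axiom reads
`κ₁ m₋₁ ⊗ κ₂ · m₀ = (κ₁ · m)₋₁ κ₂ ⊗ (κ₁ · m)₀`. -/
structure YDData.IsYetterDrinfeld (E : YDData k H M) (K : HopfData k H) : Prop where
  one_act : ∀ m, E.act (K.one ⊗ₜ m) = m
  mul_act : ∀ g h m, E.act (K.mul (g ⊗ₜ h) ⊗ₜ m) = E.act (g ⊗ₜ E.act (h ⊗ₜ m))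
  counit_coact : ∀ m, K.counit.rTensor M (E.coact m) = 1 ⊗ₜ m
  comul_coact : ∀ m, TensorProduct.assoc k H H M (K.comul.rTensor M (E.coact m)) =
    E.coact.lTensor H (E.coact m)
  compat : ∀ κ m,
    TensorProduct.map K.mul E.act
        (TensorProduct.tensorTensorTensorComm k H H H M (K.comul κ ⊗ₜ E.coact m)) =
      K.mul.rTensor M (TensorProduct.rightComm k H M H
        ((E.coact ∘ₗ E.act ∘ₗ (TensorProduct.mk k H M).flip m).rTensor H (K.comul κ)))

/-- The tensor product of Yetter-Drinfeld modules: `κ · (m ⊗ n) = κ₁ · m ⊗ κ₂ · n` and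
`m ⊗ n ↦ m₋₁ n₋₁ ⊗ (m₀ ⊗ n₀)`. -/
def YDData.tensor (K : HopfData k H) (E : YDData k H M) (F : YDData k H N) :
    YDData k H (M ⊗[k] N) where
  act := TensorProduct.map E.act F.act ∘ₗ
    (TensorProduct.tensorTensorTensorComm k H H M N).toLinearMap ∘ₗ K.comul.rTensor (M ⊗[k] N)
  coact := K.mul.rTensor (M ⊗[k] N) ∘ₗ
    (TensorProduct.tensorTensorTensorComm k H M H N).toLinearMap ∘ₗ
    TensorProduct.map E.coact F.coact

/-- The unit object of the category of Yetter-Drinfeld modules. -/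
def YDData.unit (K : HopfData k H) : YDData k H k where
  act := (TensorProduct.lid k k).toLinearMap ∘ₗ K.counit.rTensor k
  coact := TensorProduct.mk k H k K.one

/-- Morphisms of Yetter-Drinfeld modules. -/
structure IsYDHom (E : YDData k H M) (F : YDData k H N) (f : M →ₗ[k] N) : Prop where
  map_act : ∀ h m, f (E.act (h ⊗ₜ m)) = F.act (h ⊗ₜ f m)
  map_coact : ∀ m, F.coact (f m) = f.lTensor H (E.coact m)

/-- The braiding `m ⊗ n ↦ m₋₁ · n ⊗ m₀`. -/
def YDData.braiding (E : YDData k H M) (F : YDData k H N) : M ⊗[k] N →ₗ[k] N ⊗[k] M :=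
  F.act.rTensor M ∘ₗ (TensorProduct.rightComm k H M N).toLinearMap ∘ₗ E.coact.rTensor N

/-- `R`, together with the action and coaction `E`, is a Hopf algebra in the braided monoidal
category of left Yetter-Drinfeld modules over `K`. -/
structure IsHopfAlgebraInYD (K : HopfData k H) (E : YDData k H B) (R : HopfData k B) : Prop where
  isYetterDrinfeld : E.IsYetterDrinfeld K
  mul_hom : IsYDHom (E.tensor K E) E R.mul
  one_hom : IsYDHom (YDData.unit K) E (LinearMap.toSpanSingleton k B R.one)
  comul_hom : IsYDHom E (E.tensor K E) R.comul
  counit_hom : IsYDHom E (YDData.unit K) R.counit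
  antipode_hom : IsYDHom E E R.antipode
  hopfAxioms : R.HopfAxioms (E.braiding E)

/-- The map `h ⊗ b ↦ h₁ · b ⊗ h₂`. -/
def smashSwap (K : HopfData k H) (E : YDData k H B) : H ⊗[k] B →ₗ[k] B ⊗[k] H :=
  E.act.rTensor H ∘ₗ (TensorProduct.rightComm k H H B).toLinearMap ∘ₗ K.comul.rTensor B

/-- The map `b ⊗ h ↦ b₋₁ h ⊗ b₀`. -/
def cosmashSwap (K : HopfData k H) (E : YDData k H B) : B ⊗[k] H →ₗ[k] H ⊗[k] B :=
  K.mul.rTensor B ∘ₗ (TensorProduct.rightComm k H B H).toLinearMap ∘ₗ E.coact.rTensor H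

/-- The multiplication `(b × h)(b' × h') = b (h₁ · b') × h₂ h'` of the Radford biproduct. -/
def biproductMul (K : HopfData k H) (E : YDData k H B) (R : HopfData k B) :
    (B ⊗[k] H) ⊗[k] (B ⊗[k] H) →ₗ[k] B ⊗[k] H :=
  TensorProduct.map R.mul K.mul ∘ₗ middle (smashSwap K E)

/-- The Radford biproduct `R × K` on the space `B ⊗ H`: smash product algebra, smash coproduct
coalgebra `Δ(b × h) = (b₁ × b₂₍₋₁₎ h₁) ⊗ (b₂₍₀₎ × h₂)`, and antipode
`S(b × h) = (1 × S(b₋₁ h))(S(b₀) × 1)`. -/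
def biproduct (K : HopfData k H) (E : YDData k H B) (R : HopfData k B) :
    HopfData k (B ⊗[k] H) where
  mul := biproductMul K E R
  one := R.one ⊗ₜ K.one
  comul := middle (cosmashSwap K E) ∘ₗ TensorProduct.map R.comul K.comul
  counit := LinearMap.mul' k k ∘ₗ TensorProduct.map R.counit K.counit
  antipode := biproductMul K E R ∘ₗ
    TensorProduct.map (TensorProduct.mk k B H R.one ∘ₗ K.antipode)
      ((TensorProduct.mk k B H).flip K.one ∘ₗ R.antipode) ∘ₗ cosmashSwap K E

/-! For a Hopf algebra `D` with a projection, i.e. Hopf algebra maps `i : K → D`, `π : D → K`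
with `π ∘ i = id`. -/

/-- The coinvariants `{a | a₁ ⊗ π(a₂) = a ⊗ 1}`. -/
def coinvariants (D : HopfData k A) (K : HopfData k H) (π : A →ₗ[k] H) : Submodule k A where
  carrier := {a | π.lTensor A (D.comul a) = a ⊗ₜ K.one}
  zero_mem' := by simp
  add_mem' := fun {a b} (ha : _ = _) (hb : _ = _) => by
    simp [ha, hb, TensorProduct.add_tmul]
  smul_mem' := fun c a (ha : _ = _) => by
    simp [ha, TensorProduct.smul_tmul']

/-- The map `Π(a) = a₁ i(S(π(a₂)))`. -/
def coinvariantProj (D : HopfData k A) (K : HopfData k H) (i : H →ₗ[k] A) (π : A →ₗ[k] H) :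
    A →ₗ[k] A :=
  D.mul ∘ₗ (i ∘ₗ K.antipode ∘ₗ π).lTensor A ∘ₗ D.comul

/-- The left adjoint action `h ▹ a = i(h₁) a i(S(h₂))`. -/
def adjointAction (D : HopfData k A) (K : HopfData k H) (i : H →ₗ[k] A) :
    H ⊗[k] A →ₗ[k] A :=
  D.mul ∘ₗ TensorProduct.map (D.mul ∘ₗ i.rTensor A) (i ∘ₗ K.antipode) ∘ₗ
    (TensorProduct.rightComm k H H A).toLinearMap ∘ₗ K.comul.rTensor A

end General

/-! ### The generalized quantum double of `U^cop` and `V` -/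

section Double

variable {k U V : Type*} [Field k] [Ring U] [HopfAlgebra k U] [Ring V] [HopfAlgebra k V]

/-- The structure maps of a Hopf algebra. -/
def hopfData (k U : Type*) [Field k] [Ring U] [HopfAlgebra k U] : HopfData k U where
  mul := LinearMap.mul' k U
  one := 1
  comul := Coalgebra.comul
  counit := Coalgebra.counit
  antipode := HopfAlgebra.antipode k

/-- The inverse of a bijective antipode. -/
def antipodeInv (hU : Function.Bijective (HopfAlgebra.antipode k : U →ₗ[k] U)) : U →ₗ[k] U :=
  (LinearEquiv.ofBijective (HopfAlgebra.antipode k : U →ₗ[k] U) hU).symm.toLinearMap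

/-- The Hopf algebra `U^cop`: opposite comultiplication, antipode `S⁻¹`. -/
def copData (hU : Function.Bijective (HopfAlgebra.antipode k : U →ₗ[k] U)) : HopfData k U where
  mul := LinearMap.mul' k U
  one := 1
  comul := (TensorProduct.comm k U U).toLinearMap ∘ₗ Coalgebra.comul
  counit := Coalgebra.counit
  antipode := antipodeInv hU

/-- A pairing of the bialgebras `U` and `V`. -/
structure IsPairing (p : U →ₗ[k] V →ₗ[k] k) : Prop where
  mul_left : ∀ m n x, p (m * n) x =
    LinearMap.mul' k k (TensorProduct.map (p m) (p n) (Coalgebra.comul (R := k) x))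
  mul_right : ∀ m x y, p m (x * y) =
    LinearMap.mul' k k (TensorProduct.map (p.flip x) (p.flip y) (Coalgebra.comul (R := k) m))
  one_left : ∀ x, p 1 x = Coalgebra.counit (R := k) x
  one_right : ∀ m, p m 1 = Coalgebra.counit (R := k) m

variable (p : U →ₗ[k] V →ₗ[k] k) (γ : V →ₗ[k] U)
  (hU : Function.Bijective (HopfAlgebra.antipode k : U →ₗ[k] U))
  (hV : Function.Bijective (HopfAlgebra.antipode k : V →ₗ[k] V))

/-- The map `x ⊗ n ↦ ⟨n₃, x₁⟩ ⟨S⁻¹(n₁), x₃⟩ n₂ ⊗ x₂`. -/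
def exchange : V ⊗[k] U →ₗ[k] U ⊗[k] V :=
  TensorProduct.lift <| sweedler₂ 2 2 <|
    MultilinearMap.mk' (fun x =>
      MultilinearMap.mk' (fun n =>
        (p (n 2) (x 0) * p (antipodeInv hU (n 0)) (x 2)) • (n 1 ⊗ₜ[k] x 1))
        (by
          intro v i a b
          fin_cases i <;>
            simp [add_mul, mul_add, add_smul, TensorProduct.add_tmul])
        (by
          intro v i c a
          fin_cases i <;>
            simp [← TensorProduct.smul_tmul', smul_smul, mul_left_comm, mul_comm]))
      (by
        intro v i a b
        ext n
        fin_cases i <;>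
          simp [add_mul, mul_add, add_smul, TensorProduct.tmul_add])
      (by
        intro v i c a
        ext n
        fin_cases i <;>
          simp [smul_smul, mul_left_comm, mul_comm])

/-- The generalized quantum double `D(U^cop, V)` on `U ⊗ V`: tensor product coalgebra of `U^cop`
and `V`, multiplication
`(m ⊗ x)(n ⊗ y) = ⟨n₃, x₁⟩ ⟨S⁻¹(n₁), x₃⟩ m n₂ ⊗ x₂ y`, and antipode
`S(m ⊗ x) = ⟨m₁, x₃⟩ ⟨m₃, S⁻¹(x₁)⟩ S⁻¹(m₂) ⊗ S(x₂)`. -/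
def double : HopfData k (U ⊗[k] V) where
  mul := TensorProduct.map (LinearMap.mul' k U) (LinearMap.mul' k V) ∘ₗ middle (exchange p hU)
  one := 1 ⊗ₜ 1
  comul := middle (TensorProduct.comm k U V).toLinearMap ∘ₗ
    TensorProduct.map (copData hU).comul (hopfData k V).comul
  counit := LinearMap.mul' k k ∘ₗ TensorProduct.map Coalgebra.counit Coalgebra.counit
  antipode := TensorProduct.lift <| sweedler₂ 2 2 <|
    MultilinearMap.mk' (fun m =>
      MultilinearMap.mk' (fun x =>
        (p (m 0) (x 2) * p (m 2) (antipodeInv hV (x 0))) •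
          (antipodeInv hU (m 1) ⊗ₜ[k] HopfAlgebra.antipode k (x 1)))
        (by
          intro v i a b
          fin_cases i <;>
            simp [add_mul, mul_add, add_smul, TensorProduct.tmul_add])
        (by
          intro v i c a
          fin_cases i <;>
            simp [smul_smul, mul_assoc, mul_left_comm, mul_comm]))
      (by
        intro v i a b
        ext n
        fin_cases i <;>
          simp [add_mul, mul_add, add_smul, TensorProduct.add_tmul])
      (by
        intro v i c a
        ext n
        fin_cases i <;>
          simp [← TensorProduct.smul_tmul', smul_smul, mul_assoc, mul_left_comm, mul_comm])

/-- The inclusion `i(m) = m ⊗ 1`. -/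
def doubleIncl : U →ₗ[k] U ⊗[k] V := (TensorProduct.mk k U V).flip 1

/-- The projection `π(m ⊗ x) = m γ(x)`. -/
def doubleProj : U ⊗[k] V →ₗ[k] U := LinearMap.mul' k U ∘ₗ γ.lTensor U

/-- `γ : V → U^cop` is a bialgebra map with
`γ(y) m = ⟨S⁻¹(m₁), y₃⟩ ⟨m₃, y₁⟩ m₂ γ(y₂)`. -/
structure IsProjectionDatum : Prop where
  isBialgebraHom : IsBialgebraHom (hopfData k V) (copData hU) γ
  exchange_eq : ∀ y m, γ y * m = LinearMap.mul' k U (γ.lTensor U (exchange p hU (y ⊗ₜ m)))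

/-- `θ(y) = S(γ(y₂)) ⊗ y₁`. -/
def theta : V →ₗ[k] U ⊗[k] V :=
  sweedler 1 <| MultilinearMap.mk'
    (fun y => HopfAlgebra.antipode k (γ (y 1)) ⊗ₜ[k] y 0)
    (by
      intro v i a b
      fin_cases i <;> simp [TensorProduct.add_tmul, TensorProduct.tmul_add])
    (by
      intro v i c a
      fin_cases i <;> simp [TensorProduct.smul_tmul'])

/-- The map `y ↦ γ(S⁻¹(y₂)) ⊗ y₁`. -/
def theta' : V →ₗ[k] U ⊗[k] V :=
  sweedler 1 <| MultilinearMap.mk'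
    (fun y => γ (antipodeInv hV (y 1)) ⊗ₜ[k] y 0)
    (by
      intro v i a b
      fin_cases i <;> simp [TensorProduct.add_tmul, TensorProduct.tmul_add])
    (by
      intro v i c a
      fin_cases i <;> simp [TensorProduct.smul_tmul'])

/-- The map `m ⊗ y ↦ ⟨m₁, S⁻¹(y₁)⟩ ⟨m₂, S⁻²(y₃)⟩ y₂`. -/
def action' : U ⊗[k] V →ₗ[k] V :=
  TensorProduct.lift <| sweedler₂ 1 2 <|
    MultilinearMap.mk' (fun m =>
      MultilinearMap.mk' (fun y =>
        (p (m 0) (antipodeInv hV (y 0)) *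
          p (m 1) (antipodeInv hV (antipodeInv hV (y 2)))) • y 1)
        (by
          intro v i a b
          fin_cases i <;> simp [add_mul, mul_add, add_smul])
        (by
          intro v i c a
          fin_cases i <;> simp [smul_smul, mul_left_comm, mul_comm]))
      (by
        intro v i a b
        ext n
        fin_cases i <;> simp [add_mul, mul_add, add_smul])
      (by
        intro v i c a
        ext n
        fin_cases i <;> simp [smul_smul, mul_assoc, mul_left_comm])

/-- The action and coaction of `U^cop` on `V`:
`m ▹ y = ⟨m, S⁻¹(S⁻¹(y₃) y₁)⟩ y₂` and `y ↦ γ(S⁻¹(y₃) y₁) ⊗ y₂`. -/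
def underlineYD : YDData k U V where
  act := TensorProduct.lift <| LinearMap.flip <| sweedler 2 <| MultilinearMap.mk'
    (fun y => (p.flip (antipodeInv hV (antipodeInv hV (y 2) * y 0))).smulRight (y 1))
    (by
      intro v i a b
      ext m
      fin_cases i <;> simp [add_mul, mul_add, add_smul])
    (by
      intro v i c a
      ext m
      fin_cases i <;> simp [smul_smul, mul_comm])
  coact := sweedler 2 <| MultilinearMap.mk'
    (fun y => γ (antipodeInv hV (y 2) * y 0) ⊗ₜ[k] y 1)
    (by
      intro v i a b
      fin_cases i <;>
        simp [add_mul, mul_add, TensorProduct.add_tmul, TensorProduct.tmul_add])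
    (by
      intro v i c a
      fin_cases i <;> simp [TensorProduct.smul_tmul'])

/-- The braided Hopf algebra structure on `V`, with the unit and counit of `V` and
`x · y = ⟨γ(y₂), S(x₁) x₃⟩ x₂ y₁`,
`Δ(x) = ⟨γ(S(x₄) x₆), S⁻¹(x₃) x₁⟩ x₂ ⊗ x₅`,
`S(x) = ⟨γ(x₄), x₁ S(x₃)⟩ S(x₂)`. -/
def underlineHopf : HopfData k V where
  mul := TensorProduct.lift <| sweedler₂ 2 1 <|
    MultilinearMap.mk' (fun x =>
      MultilinearMap.mk' (fun y =>
        p (γ (y 1)) (HopfAlgebra.antipode k (x 0) * x 2) • (x 1 * y 0))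
        (by
          intro v i a b
          fin_cases i <;> simp [add_smul, mul_add])
        (by
          intro v i c a
          fin_cases i <;> simp [smul_smul, mul_comm]))
      (by
        intro v i a b
        ext n
        fin_cases i <;> simp [add_mul, mul_add, add_smul])
      (by
        intro v i c a
        ext n
        fin_cases i <;> simp [smul_smul, mul_comm])
  one := 1
  comul := sweedler 5 <| MultilinearMap.mk'
    (fun x => p (γ (HopfAlgebra.antipode k (x 3) * x 5)) (antipodeInv hV (x 2) * x 0) •
      (x 1 ⊗ₜ[k] x 4))
    (by
      intro v i a b
      fin_cases i <;>
        simp [add_mul, mul_add, add_smul, TensorProduct.add_tmul, TensorProduct.tmul_add])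
    (by
      intro v i c a
      fin_cases i <;>
        simp [← TensorProduct.smul_tmul', smul_smul, mul_comm])
  counit := Coalgebra.counit
  antipode := sweedler 3 <| MultilinearMap.mk'
    (fun x => p (γ (x 3)) (x 0 * HopfAlgebra.antipode k (x 2)) • HopfAlgebra.antipode k (x 1))
    (by
      intro v i a b
      fin_cases i <;> simp [add_mul, mul_add, add_smul])
    (by
      intro v i c a
      fin_cases i <;> simp [smul_smul, mul_comm])

/-- The map `χ(y × m) = θ(y) i(m)`. -/
def chi : V ⊗[k] U →ₗ[k] U ⊗[k] V :=
  (double p hU hV).mul ∘ₗ TensorProduct.map (theta γ) doubleIncl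

end Double

end DoubleBiproduct

end

/-! The result is Radford's theorem on Hopf algebras with a projection, applied to the double `D →
U^cop`, together with an explicit identification of the coinvariants with `V`.

The product of `D` is determined by the rule `exchange` that moves `x ∈ V` past `n ∈ U`. Because the
pairing turns products on one side into comultiplications on the other, this rule is compatible with
the products of `V` and of `U` (`exchange_mul_left`, `exchange_mul_right`), which is what
associativity needs. It also respects the comultiplications (`double_comul_exchange`), since the two
pairings that meet in the middle cancel. The antipode is `S(x) S⁻¹(m)`, multiplied in `D`
(`double_antipode_tmul`). The relation imposed on `γ` says exactly that `m ⊗ x ↦ m γ(x)` respects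
the exchange rule, so `π` is multiplicative.

For a general projection `π : A → H` split by `i`, one has `a = Π(a₁) i(π(a₂))`, while `Π(a i(x)) =
ε(x) Π(a)`. The coinvariants are therefore also a quotient of `A`, with `a` representing `Π(a)`. On
representatives the structure is simple: `x` acts by left multiplication by `i(x)`, the
comultiplication is `a ↦ a₁ ⊗ a₂`, and the coaction is `a ↦ π(a₁) S(π(a₃)) ⊗ a₂`. Every braided
axiom becomes a Hopf identity in `A` after an adjacent pair cancels, and `θ(b) i(h)` is inverted by
`a ↦ ρ(a₁) ⊗ π(a₂)`.

For the double, `e = ε ⊗ id` is a linear retraction of `θ`, and `θ ∘ e` is the identity on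
coinvariants. Each operation on `V` is thus `e` of the corresponding operation of `D` on `θ`-images,
and `e(x n) = ⟨n, S⁻¹(x₃) x₁⟩ x₂` (`doubleRetract_exchange`) produces the stated formulas
(`underline_isRetractModel`).

Sweedler calculus is carried out with comatrices: any element of a coalgebra over a field is a
combination of matrix coefficients `c i j` with `Δ(c i j) = ∑ c i a ⊗ c a j`, so linear identities
need only be checked on these (`ext_comatrix`). Iterated comultiplications become finite sums over
index chains, the antipode becomes the inverse matrix, and cancellations become Kronecker deltas. -/

namespace DoubleBiproduct

/-! ### Permuting nested sums -/

section Sums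

variable {α β γ δ ε M : Type*} [Fintype α] [Fintype β] [Fintype γ] [Fintype δ] [Fintype ε]
  [AddCommMonoid M]

theorem sum_rotate₃ (f : α → β → γ → M) :
    ∑ a, ∑ b, ∑ c, f a b c = ∑ b, ∑ c, ∑ a, f a b c := by
  rw [Finset.sum_comm]
  exact Finset.sum_congr rfl fun _ _ => Finset.sum_comm

theorem sum_rotate₄ (f : α → β → γ → δ → M) :
    ∑ a, ∑ b, ∑ c, ∑ d, f a b c d = ∑ b, ∑ c, ∑ d, ∑ a, f a b c d := by
  rw [Finset.sum_comm]
  exact Finset.sum_congr rfl fun _ _ => sum_rotate₃ _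

theorem sum_rotate₅ (f : α → β → γ → δ → ε → M) :
    ∑ a, ∑ b, ∑ c, ∑ d, ∑ e, f a b c d e = ∑ b, ∑ c, ∑ d, ∑ e, ∑ a, f a b c d e := by
  rw [Finset.sum_comm]
  exact Finset.sum_congr rfl fun _ _ => sum_rotate₄ _

theorem sum_reverse₄ (f : α → β → γ → δ → M) :
    ∑ a, ∑ b, ∑ c, ∑ d, f a b c d = ∑ d, ∑ c, ∑ b, ∑ a, f a b c d := by
  simp only [← Fintype.sum_prod_type']
  exact Fintype.sum_equiv ⟨fun ⟨l₁, l₂, l₃, l₄⟩ => ⟨l₄, l₃, l₂, l₁⟩,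
    fun ⟨l₄, l₃, l₂, l₁⟩ => ⟨l₁, l₂, l₃, l₄⟩, fun _ => rfl, fun _ => rfl⟩ _ _ fun _ => rfl

theorem sum_perm₄ (f : α → β → γ → δ → M) :
    ∑ a, ∑ b, ∑ c, ∑ d, f a b c d = ∑ d, ∑ b, ∑ a, ∑ c, f a b c d := by
  simp only [← Fintype.sum_prod_type']
  exact Fintype.sum_equiv ⟨fun ⟨l₁, l₂, l₃, l₄⟩ => ⟨l₄, l₂, l₁, l₃⟩,
    fun ⟨l₄, l₂, l₁, l₃⟩ => ⟨l₁, l₂, l₃, l₄⟩, fun _ => rfl, fun _ => rfl⟩ _ _ fun _ => rfl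

theorem sum_perm₅ (f : α → β → γ → δ → ε → M) :
    ∑ a, ∑ b, ∑ c, ∑ d, ∑ e, f a b c d e = ∑ e, ∑ d, ∑ c, ∑ a, ∑ b, f a b c d e := by
  simp only [← Fintype.sum_prod_type']
  exact Fintype.sum_equiv ⟨fun ⟨a, b, c, d, e⟩ => ⟨e, d, c, a, b⟩,
    fun ⟨e, d, c, a, b⟩ => ⟨a, b, c, d, e⟩, fun _ => rfl, fun _ => rfl⟩ _ _ fun _ => rfl

end Sums

/-! ### Comatrices -/

section Comatrix

/-- A tensor over a field is a sum of pure tensors with biorthogonal families on both sides. -/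
theorem exists_biorthogonal_decomposition {k M N : Type*} [Field k] [AddCommGroup M] [Module k M]
    [AddCommGroup N] [Module k N] (t : M ⊗[k] N) :
    ∃ (n : ℕ) (u : Fin n → M) (w : Fin n → N) (g : Fin n → M →ₗ[k] k) (f : Fin n → N →ₗ[k] k),
      t = ∑ i, u i ⊗ₜ w i ∧ (∀ i j, g i (u j) = if i = j then 1 else 0) ∧
      (∀ i j, f j (w i) = if i = j then 1 else 0) := by
  classical
  obtain ⟨s, hs⟩ := TensorProduct.exists_finset t
  -- The range of `φ` is the smallest subspace of `N` that `t` needs on the right. A basis `w` of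
  -- it, its coordinates extended to `N`, and the slices `u` of `t` along these coordinates give a
  -- decomposition of minimal length.
  let φ : (M →ₗ[k] k) →ₗ[k] N :=
    { toFun := fun f => TensorProduct.lid k N (f.rTensor N t)
      map_add' := fun f g => by simp [LinearMap.rTensor_add]
      map_smul' := fun c f => by simp [LinearMap.rTensor_smul] }
  have φ_apply (f : M →ₗ[k] k) : φ f = TensorProduct.lid k N (f.rTensor N t) := rfl
  have hle : LinearMap.range φ ≤ Submodule.span k ((s.image Prod.snd : Finset N) : Set N) := by
    rintro _ ⟨f, rfl⟩
    rw [φ_apply, hs]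
    simp only [map_sum, LinearMap.rTensor_tmul, TensorProduct.lid_tmul]
    exact Submodule.sum_mem _ fun i hi => Submodule.smul_mem _ _ <|
      Submodule.subset_span (by simpa using ⟨i.1, hi⟩)
  have : FiniteDimensional k (LinearMap.range φ) := Submodule.finiteDimensional_of_le hle
  let w := Module.finBasis k (LinearMap.range φ)
  obtain ⟨q, hq⟩ := LinearMap.exists_leftInverse_of_injective (LinearMap.range φ).subtype
    (by simp)
  have hq' (y : LinearMap.range φ) : q y = y := LinearMap.congr_fun hq y
  -- Each `w i` is a slice `φ (g i)`, and `h (u j) = f j (φ h)` for every functional `h`. Hence `g i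
  -- (u j) = f j (w i)`: the biorthogonality on the left follows from the one on the right.
  choose g hg using fun i => (w i).2
  let f (j) : N →ₗ[k] k := w.coord j ∘ₗ q
  let u (j) : M := TensorProduct.rid k M ((f j).lTensor M t)
  have hfu (j) (h : M →ₗ[k] k) : h (u j) = f j (φ h) := by
    simp only [u, φ_apply, hs, map_sum, LinearMap.lTensor_tmul, LinearMap.rTensor_tmul,
      TensorProduct.rid_tmul, TensorProduct.lid_tmul, map_smul, smul_eq_mul, mul_comm]
  have hw (i j) : f j (w i) = if i = j then 1 else 0 := by
    simp [f, hq', Finsupp.single_apply]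
  refine ⟨_, u, fun i => w i, g, f, ?_, fun i j => ?_, hw⟩
  · let b := Module.Free.chooseBasis k M
    apply (TensorProduct.equivFinsuppOfBasisLeft (N := N) b).injective
    ext a
    rw [TensorProduct.equivFinsuppOfBasisLeft_apply, TensorProduct.equivFinsuppOfBasisLeft_apply]
    simp only [map_sum, LinearMap.rTensor_tmul, TensorProduct.lid_tmul, hfu]
    rw [← φ_apply]
    have := congr_arg Subtype.val (w.sum_repr ⟨φ (b.coord a), ⟨_, rfl⟩⟩)
    simp only [Submodule.coe_sum, Submodule.coe_smul] at this
    have hq'' := hq' ⟨φ (b.coord a), ⟨_, rfl⟩⟩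
    simp only [f, LinearMap.comp_apply, Module.Basis.coord_apply] at hq'' ⊢
    rw [hq'', this]
  · rw [hfu, hg, hw]

variable {k C W : Type*} [Field k] [AddCommGroup C] [Module k C] [Coalgebra k C]
  [AddCommGroup W] [Module k W]

/-- A square matrix of elements of a coalgebra which comultiplies like the matrix coefficients of
a comodule. Iterated comultiplications of its entries are sums over index chains. -/
structure IsComatrix (k : Type*) {C : Type*} [Field k] [AddCommGroup C] [Module k C]
    [Coalgebra k C] {ι : Type} [Fintype ι] [DecidableEq ι] (c : ι → ι → C) : Prop where
  comul : ∀ i j, Coalgebra.comul (R := k) (c i j) = ∑ a, c i a ⊗ₜ[k] c a j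
  counit : ∀ i j, Coalgebra.counit (R := k) (c i j) = if i = j then 1 else 0

/-- The fundamental theorem of coalgebras in matrix form. In a biorthogonal decomposition `Δ(x) = ∑
u i ⊗ w i`, coassociativity makes the `u i` and the `w i` span comodules with the same coefficients
`c`. Two applications of the counit then recover `x` with weights `ε(u i) ε(w j)`. -/
theorem exists_comatrix (x : C) : ∃ (n : ℕ) (c : Fin n → Fin n → C) (r s : Fin n → k),
    IsComatrix k c ∧ x = ∑ i, ∑ j, (r i * s j) • c i j := by
  obtain ⟨n, u, w, g, f, ht, hg, hf⟩ :=
    exists_biorthogonal_decomposition (Coalgebra.comul (R := k) x)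
  let c (i j : Fin n) : C := TensorProduct.rid k C ((f j).lTensor C (Coalgebra.comul (w i)))
  have hco : ∑ i, TensorProduct.assoc k C C C (Coalgebra.comul (R := k) (u i) ⊗ₜ[k] w i) =
      ∑ i, u i ⊗ₜ[k] Coalgebra.comul (R := k) (w i) := by
    simpa [ht] using Coalgebra.coassoc_apply (R := k) x
  -- Coassociativity of `x`, with `f j` applied to the last factor; for `hw` it is `g i` that is
  -- applied to the first factor.
  have hu (j) : Coalgebra.comul (R := k) (u j) = ∑ i, u i ⊗ₜ[k] c i j := by
    have := congr_arg (LinearMap.lTensor C ((TensorProduct.rid k C).toLinearMap ∘ₗ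
      (f j).lTensor C)) hco
    have e (z : C) (s : C ⊗[k] C) : LinearMap.lTensor C ((TensorProduct.rid k C).toLinearMap ∘ₗ
      (f j).lTensor C) (TensorProduct.assoc k C C C (s ⊗ₜ[k] z)) = f j z • s := by
      induction s with
      | zero => simp
      | add a b ha hb => rw [TensorProduct.add_tmul, map_add, map_add, ha, hb, smul_add]
      | tmul a b => simp
    simpa [e, hf, c] using this
  have hw (i) : Coalgebra.comul (R := k) (w i) = ∑ j, c i j ⊗ₜ[k] w j := by
    have := congr_arg (fun t => TensorProduct.lid k _ ((g i).rTensor (C ⊗[k] C) t)) hco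
    simpa [hu, hg, TensorProduct.sum_tmul, Finset.sum_ite_eq, ite_smul] using this.symm
  have hc : IsComatrix k c := by
    constructor
    · intro i j
      have := congr_arg (LinearMap.lTensor C ((TensorProduct.rid k C).toLinearMap ∘ₗ
        (f j).lTensor C)) (Coalgebra.coassoc_apply (R := k) (w i))
      have e (z : C) (s : C ⊗[k] C) : LinearMap.lTensor C ((TensorProduct.rid k C).toLinearMap ∘ₗ
        (f j).lTensor C) (TensorProduct.assoc k C C C (s ⊗ₜ[k] z)) = f j z • s := by
        induction s with
        | zero => simp
        | add a b ha hb => rw [TensorProduct.add_tmul, map_add, map_add, ha, hb, smul_add]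
        | tmul a b => simp
      rw [hw] at this
      simpa [e, hf, c] using this
    · intro i j
      have h1 : f j (TensorProduct.lid k C
        (Coalgebra.counit.rTensor C (Coalgebra.comul (R := k) (w i)))) = f j (w i) := by simp
      rw [hf, hw] at h1
      simpa [hf] using h1
  refine ⟨n, c, fun i => Coalgebra.counit (R := k) (u i), fun j => Coalgebra.counit (R := k) (w j),
    hc, ?_⟩
  have h1 := congr_arg (TensorProduct.rid k C) (Coalgebra.lTensor_counit_comul (R := k) x)
  have h2 (j) := congr_arg (TensorProduct.lid k C) (Coalgebra.rTensor_counit_comul (R := k) (u j))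
  simp only [ht, hu, map_sum, LinearMap.rTensor_tmul, LinearMap.lTensor_tmul,
    TensorProduct.rid_tmul, TensorProduct.lid_tmul, one_smul] at h1 h2
  rw [← h1, Finset.sum_comm]
  refine Finset.sum_congr rfl fun j _ => ?_
  rw [← h2, Finset.smul_sum]
  refine Finset.sum_congr rfl fun i _ => ?_
  rw [smul_smul, mul_comm]

/-- Linear maps on a coalgebra agree if they agree on the entries of comatrices. -/
theorem ext_comatrix {F G : C →ₗ[k] W}
    (h : ∀ (n : ℕ) (c : Fin n → Fin n → C), IsComatrix k c → ∀ i j, F (c i j) = G (c i j)) :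
    F = G := by
  ext x
  obtain ⟨n, c, r, s, hc, rfl⟩ := exists_comatrix (k := k) x
  simp only [map_sum, map_smul, h n c hc]

/-- Bilinear maps on coalgebras agree if they agree on the entries of comatrices. -/
theorem ext_comatrix₂ {C' : Type*} [AddCommGroup C'] [Module k C'] [Coalgebra k C']
    {F G : C →ₗ[k] C' →ₗ[k] W}
    (h : ∀ (n : ℕ) (c : Fin n → Fin n → C), IsComatrix k c →
      ∀ (m : ℕ) (d : Fin m → Fin m → C'), IsComatrix k d →
      ∀ i j a b, F (c i j) (d a b) = G (c i j) (d a b)) :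
    F = G :=
  ext_comatrix fun n c hc i j => ext_comatrix fun m d hd a b => h n c hc m d hd i j a b

variable {ι κ : Type} [Fintype ι] [DecidableEq ι] [Fintype κ] [DecidableEq κ]

theorem sweedler_zero (f : MultilinearMap k (fun _ : Fin (0 + 1) => C) W) (x : C) :
    sweedler 0 f x = f (fun _ => x) := rfl

theorem IsComatrix.sweedler_succ {c : ι → ι → C} (hc : IsComatrix k c) (n : ℕ)
    (f : MultilinearMap k (fun _ : Fin (n + 1 + 1) => C) W) (i j : ι) :
    sweedler (n + 1) f (c i j) = ∑ a, sweedler n (f.curryLeft (c i a)) (c a j) := by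
  change TensorProduct.lift (sweedler n ∘ₗ f.curryLeft) (Coalgebra.comul (R := k) (c i j)) = _
  simp only [hc.comul, map_sum, TensorProduct.lift.tmul, LinearMap.comp_apply]

theorem IsComatrix.map {c : ι → ι → C} (hc : IsComatrix k c) {C' : Type*} [AddCommGroup C']
    [Module k C'] [Coalgebra k C'] (f : C →ₗ[k] C')
    (hf : ∀ x, Coalgebra.comul (R := k) (f x) =
      TensorProduct.map f f (Coalgebra.comul (R := k) x))
    (hf' : ∀ x, Coalgebra.counit (R := k) (f x) = Coalgebra.counit (R := k) x) :
    IsComatrix k (fun i j => f (c i j)) where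
  comul i j := by simp [hf, hc.comul]
  counit i j := by simp [hf', hc.counit]

/-- The Kronecker product, that is, the coefficients of a tensor product of comodules. It allows any
formula proved for comatrices to be applied to a product of two elements. -/
theorem IsComatrix.mul {A : Type*} [Ring A] [Bialgebra k A] {c : ι → ι → A} {d : κ → κ → A}
    (hc : IsComatrix k c) (hd : IsComatrix k d) :
    IsComatrix k (fun i j : ι × κ => c i.1 j.1 * d i.2 j.2) where
  comul i j := by
    simp [hc.comul, hd.comul, Finset.sum_mul_sum, Fintype.sum_prod_type]
  counit i j := by
    simp [hc.counit, hd.counit, Prod.ext_iff, ite_and]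
    split_ifs <;> rfl

section Hopf

variable {A : Type*} [Ring A] [HopfAlgebra k A] {c : ι → ι → A}

/-- The antipode axioms say that the entrywise antipode of a comatrix is its inverse matrix over
`A`. Antipode identities can then be proved by uniqueness of inverses. -/
theorem IsComatrix.sum_antipode_mul (hc : IsComatrix k c) (i j : ι) :
    ∑ a, HopfAlgebra.antipode k (c i a) * c a j = if i = j then 1 else 0 := by
  have := HopfAlgebra.mul_antipode_rTensor_comul_apply (R := k) (c i j)
  simpa [hc.comul, hc.counit] using this

theorem IsComatrix.sum_mul_antipode (hc : IsComatrix k c) (i j : ι) :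
    ∑ a, c i a * HopfAlgebra.antipode k (c a j) = if i = j then 1 else 0 := by
  have := HopfAlgebra.mul_antipode_lTensor_comul_apply (R := k) (c i j)
  simpa [hc.comul, hc.counit] using this

theorem IsComatrix.sum_antipode_mul_assoc (hc : IsComatrix k c) (i j : ι) (z : A) :
    ∑ a, HopfAlgebra.antipode k (c i a) * (c a j * z) = if i = j then z else 0 := by
  simp only [← mul_assoc, ← Finset.sum_mul, hc.sum_antipode_mul, ite_mul, one_mul, zero_mul]

theorem IsComatrix.comul_antipode (hc : IsComatrix k c) (i j : ι) :
    Coalgebra.comul (R := k) (HopfAlgebra.antipode k (c i j)) =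
      ∑ a, HopfAlgebra.antipode k (c a j) ⊗ₜ[k] HopfAlgebra.antipode k (c i a) := by
  -- `Δ` is multiplicative, so `Δ(S(c))` is a left inverse of the matrix `Δ(c)`; the claimed value
  -- is a right inverse.
  let M : Matrix ι ι (A ⊗[k] A) := .of fun i j => Coalgebra.comul (R := k) (c i j)
  let L : Matrix ι ι (A ⊗[k] A) := .of fun i j =>
    Coalgebra.comul (R := k) (HopfAlgebra.antipode k (c i j))
  let N : Matrix ι ι (A ⊗[k] A) := .of fun i j =>
    ∑ a, HopfAlgebra.antipode k (c a j) ⊗ₜ[k] HopfAlgebra.antipode k (c i a)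
  have hL : L * M = 1 := by
    ext i j
    simp only [L, M, Matrix.mul_apply, Matrix.of_apply, ← Bialgebra.comul_mul, ← map_sum,
      hc.sum_antipode_mul, Matrix.one_apply]
    split_ifs <;> simp
  have hN : M * N = 1 := by
    ext i j
    simp only [N, M, Matrix.mul_apply, Matrix.of_apply, hc.comul, Finset.sum_mul_sum,
      Algebra.TensorProduct.tmul_mul_tmul, Matrix.one_apply]
    have (b : ι) : ∑ x, ∑ a, (c i b * HopfAlgebra.antipode k (c a j)) ⊗ₜ[k]
        (c b x * HopfAlgebra.antipode k (c x a)) =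
        (c i b * HopfAlgebra.antipode k (c b j)) ⊗ₜ[k] 1 := by
      rw [Finset.sum_comm]
      simp [← TensorProduct.tmul_sum, hc.sum_mul_antipode, TensorProduct.tmul_ite]
    rw [Finset.sum_comm]
    simp only [this, ← TensorProduct.sum_tmul, hc.sum_mul_antipode]
    split_ifs <;> simp [Algebra.TensorProduct.one_def]
  have h : L = N := left_inv_eq_right_inv hL hN
  exact congr_fun₂ h i j

end Hopf

end Comatrix

/-! ### Hopf algebras with a projection -/

section Projection

variable {k A H : Type*} [Field k] [Ring A] [HopfAlgebra k A] [Ring H] [HopfAlgebra k H]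

open HopfAlgebra (antipode)

/-- Hopf algebra maps `i : H → A` and `π : A → H` with `π ∘ i = id`. -/
structure IsHopfProjection (i : H →ₗ[k] A) (π : A →ₗ[k] H) : Prop where
  incl_mul : ∀ x y, i (x * y) = i x * i y
  incl_one : i 1 = 1
  incl_comul : ∀ x, Coalgebra.comul (R := k) (i x) =
    TensorProduct.map i i (Coalgebra.comul (R := k) x)
  incl_counit : ∀ x, Coalgebra.counit (R := k) (i x) = Coalgebra.counit (R := k) x
  incl_antipode : ∀ x, antipode k (i x) = i (antipode k x)
  proj_mul : ∀ x y, π (x * y) = π x * π y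
  proj_one : π 1 = 1
  proj_comul : ∀ x, Coalgebra.comul (R := k) (π x) =
    TensorProduct.map π π (Coalgebra.comul (R := k) x)
  proj_counit : ∀ x, Coalgebra.counit (R := k) (π x) = Coalgebra.counit (R := k) x
  proj_antipode : ∀ x, π (antipode k x) = antipode k (π x)
  proj_incl : ∀ x, π (i x) = x

/-- The projection `Π(a) = a₁ i(S(π(a₂)))` onto the coinvariants. -/
def coinvProj (i : H →ₗ[k] A) (π : A →ₗ[k] H) : A →ₗ[k] A :=
  coinvariantProj (hopfData k A) (hopfData k H) i π

/-- The map `a ↦ i(π(a₁)) S(a₂)`. -/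
def coinvAntipode (i : H →ₗ[k] A) (π : A →ₗ[k] H) : A →ₗ[k] A :=
  LinearMap.mul' k A ∘ₗ TensorProduct.map (i ∘ₗ π) (antipode k) ∘ₗ Coalgebra.comul

variable {ι κ : Type} [Fintype ι] [DecidableEq ι] [Fintype κ] [DecidableEq κ]
  {i : H →ₗ[k] A} {π : A →ₗ[k] H} {c : ι → ι → A} {d : κ → κ → H}

theorem IsComatrix.coinvProj (hc : IsComatrix k c) (p q : ι) :
    coinvProj i π (c p q) = ∑ a, c p a * i (antipode k (π (c a q))) := by
  simp [DoubleBiproduct.coinvProj, coinvariantProj, hopfData, hc.comul]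

theorem IsComatrix.coinvAntipode (hc : IsComatrix k c) (p q : ι) :
    coinvAntipode i π (c p q) = ∑ a, i (π (c p a)) * antipode k (c a q) := by
  simp [DoubleBiproduct.coinvAntipode, hc.comul]

theorem IsComatrix.adjointAction (hd : IsComatrix k d) (p q : κ) (a : A) :
    adjointAction (hopfData k A) (hopfData k H) i (d p q ⊗ₜ a) =
      ∑ r, i (d p r) * a * i (antipode k (d r q)) := by
  simp [DoubleBiproduct.adjointAction, hopfData, hd.comul, TensorProduct.sum_tmul]

namespace IsHopfProjection

theorem comatrix_incl (h : IsHopfProjection i π) (hd : IsComatrix k d) : IsComatrix k (fun p q => i (d p q)) :=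
  hd.map i h.incl_comul h.incl_counit

theorem comatrix_proj (h : IsHopfProjection i π) (hc : IsComatrix k c) : IsComatrix k (fun p q => π (c p q)) :=
  hc.map π h.proj_comul h.proj_counit

theorem sum_incl_antipode_mul (h : IsHopfProjection i π) (hd : IsComatrix k d) (p q : κ) :
    ∑ a, i (antipode k (d p a)) * i (d a q) = if p = q then 1 else 0 := by
  simp only [← h.incl_mul, ← map_sum, hd.sum_antipode_mul]
  split_ifs <;> simp [h.incl_one]

theorem sum_incl_mul_antipode (h : IsHopfProjection i π) (hd : IsComatrix k d) (p q : κ) :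
    ∑ a, i (d p a) * i (antipode k (d a q)) = if p = q then 1 else 0 := by
  simp only [← h.incl_mul, ← map_sum, hd.sum_mul_antipode]
  split_ifs <;> simp [h.incl_one]

/-- The factorization `Π(a₁) i(π(a₂)) = a`, behind both the surjectivity of the biproduct map and
the braided bialgebra axiom. -/
theorem sum_coinvProj_mul (h : IsHopfProjection i π) (hc : IsComatrix k c) (p q : ι) :
    ∑ a, coinvProj i π (c p a) * i (π (c a q)) = c p q := by
  simp only [hc.coinvProj, Finset.sum_mul]
  rw [Finset.sum_comm]
  simp [mul_assoc, ← Finset.mul_sum, h.sum_incl_antipode_mul (h.comatrix_proj hc)]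

/-- `π(a i(x)) = π(a) x` and `S` reverses products, so `i(x₁) i(S(x₂))` meet inside `Π` and cancel.
This is what makes the coinvariants a quotient of `A` as well as a subspace. -/
theorem coinvProj_mul_incl (h : IsHopfProjection i π) (a : A) (x : H) :
    coinvProj i π (a * i x) = Coalgebra.counit (R := k) x • coinvProj i π a := by
  suffices ((LinearMap.mul k A).compl₂ i).compr₂ (coinvProj i π) =
      (LinearMap.lsmul k A).flip.compl₁₂ (coinvProj i π) Coalgebra.counit from
    LinearMap.congr_fun₂ this a x
  refine ext_comatrix₂ fun n c hc m d hd p q r s => ?_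
  have := (hc.mul (h.comatrix_incl hd)).coinvProj (i := i) (π := π) (p, r) (q, s)
  simp only [Fintype.sum_prod_type, h.proj_mul, h.proj_incl,
    HopfAlgebra.antipode_mul_antidistrib, h.incl_mul] at this
  simp only [LinearMap.compr₂_apply, LinearMap.compl₂_apply, LinearMap.mul_apply', this,
    LinearMap.compl₁₂_apply, LinearMap.flip_apply, LinearMap.lsmul_apply, hc.coinvProj, hd.counit]
  have e (a : Fin n) : ∑ y, c p a * i (d r y) * (i (antipode k (d y s)) *
      i (antipode k (π (c a q)))) =
      if r = s then c p a * i (antipode k (π (c a q))) else 0 := by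
    simp only [← mul_assoc, ← Finset.sum_mul]
    simp only [mul_assoc (c p a), ← Finset.mul_sum, h.sum_incl_mul_antipode hd]
    split_ifs <;> simp
  simp only [e]
  split_ifs <;> simp

theorem coinvProj_incl_mul (h : IsHopfProjection i π) (x : H) (a : A) :
    coinvProj i π (i x * a) =
      adjointAction (hopfData k A) (hopfData k H) i (x ⊗ₜ coinvProj i π a) := by
  suffices ((LinearMap.mul k A).comp i).compr₂ (coinvProj i π) =
      ((TensorProduct.mk k H A).compl₂ (coinvProj i π)).compr₂
        (adjointAction (hopfData k A) (hopfData k H) i) from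
    LinearMap.congr_fun₂ this x a
  refine ext_comatrix₂ fun n d hd m c hc r s p q => ?_
  have := ((h.comatrix_incl hd).mul hc).coinvProj (i := i) (π := π) (r, p) (s, q)
  simp only [Fintype.sum_prod_type, h.proj_mul, h.proj_incl,
    HopfAlgebra.antipode_mul_antidistrib, h.incl_mul] at this
  simp only [LinearMap.compr₂_apply, LinearMap.compl₂_apply, LinearMap.comp_apply,
    LinearMap.mul_apply', this, TensorProduct.mk_apply, hc.coinvProj, hd.adjointAction,
    Finset.mul_sum, Finset.sum_mul, mul_assoc]

/-- In Sweedler form, `Δ(Π(a)) = a₁ i(S(π(a₃))) ⊗ Π(a₂)`. The right factor is again in the image of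
`Π`, which makes the coinvariants a left coideal. -/
theorem comul_coinvProj (h : IsHopfProjection i π) (hc : IsComatrix k c) (p q : ι) :
    Coalgebra.comul (R := k) (coinvProj i π (c p q)) =
      ∑ a, ∑ b, (c p a * i (antipode k (π (c b q)))) ⊗ₜ[k] coinvProj i π (c a b) := by
  simp only [hc.coinvProj, map_sum, Bialgebra.comul_mul, hc.comul, h.incl_comul,
    (h.comatrix_proj hc).comul_antipode, TensorProduct.map_tmul, Finset.sum_mul_sum,
    Algebra.TensorProduct.tmul_mul_tmul, TensorProduct.tmul_sum]
  rw [Finset.sum_comm]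
  refine Finset.sum_congr rfl fun a _ => ?_
  rw [Finset.sum_comm]

theorem proj_coinvProj (h : IsHopfProjection i π) (hc : IsComatrix k c) (p q : ι) :
    π (coinvProj i π (c p q)) = if p = q then 1 else 0 := by
  simp only [hc.coinvProj, map_sum, h.proj_mul, h.proj_incl,
    (h.comatrix_proj hc).sum_mul_antipode]

/-- By `comul_coinvProj`, applying `π` to the second factor produces `π(Π(a₂)) = ε(a₂)`, and what
remains is `Π(a) ⊗ 1`. -/
theorem coinvProj_mem (h : IsHopfProjection i π) (a : A) :
    coinvProj i π a ∈ coinvariants (hopfData k A) (hopfData k H) π := by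
  suffices π.lTensor A ∘ₗ Coalgebra.comul ∘ₗ coinvProj i π =
      (TensorProduct.mk k A H).flip 1 ∘ₗ coinvProj i π from LinearMap.congr_fun this a
  refine ext_comatrix fun n c hc p q => ?_
  simp only [LinearMap.comp_apply, h.comul_coinvProj hc, map_sum, LinearMap.lTensor_tmul,
    h.proj_coinvProj hc, TensorProduct.tmul_ite]
  simp [hc.coinvProj]

theorem coinvProj_of_mem (h : IsHopfProjection i π) {a : A}
    (ha : a ∈ coinvariants (hopfData k A) (hopfData k H) π) : coinvProj i π a = a := by
  have ha' : π.lTensor A (Coalgebra.comul (R := k) a) = a ⊗ₜ 1 := ha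
  -- `Π(a)` depends on `a` only through `a₁ ⊗ π(a₂)`, which is `a ⊗ 1` for a coinvariant.
  have : coinvProj i π a = LinearMap.mul' k A ((i ∘ₗ antipode k).lTensor A
      (π.lTensor A (Coalgebra.comul (R := k) a))) := by
    rw [← LinearMap.comp_apply (LinearMap.lTensor _ _), ← LinearMap.lTensor_comp]
    rfl
  rw [this, ha']
  simp [h.incl_one]

theorem counit_coinvProj (h : IsHopfProjection i π) (a : A) :
    Coalgebra.counit (R := k) (coinvProj i π a) = Coalgebra.counit (R := k) a := by
  suffices Coalgebra.counit (R := k) ∘ₗ coinvProj i π = Coalgebra.counit from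
    LinearMap.congr_fun this a
  refine ext_comatrix fun n c hc p q => ?_
  simp [hc.coinvProj, hc.counit, h.incl_counit, h.proj_counit]

theorem _root_.DoubleBiproduct.IsComatrix.sum_coinvAntipode_mul (hc : IsComatrix k c) (p q : ι) :
    ∑ a, coinvAntipode i π (c p a) * c a q = i (π (c p q)) := by
  simp only [hc.coinvAntipode, Finset.sum_mul]
  rw [Finset.sum_comm]
  simp [mul_assoc, ← Finset.mul_sum, hc.sum_antipode_mul]

/-- The braided antipode axiom, seen in `A`: `Π(a₁) i(π(a₂)) S(a₃) = a₁ S(a₂) = ε(a)`. -/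
theorem sum_coinvProj_mul_coinvAntipode (h : IsHopfProjection i π) (hc : IsComatrix k c)
    (p q : ι) :
    ∑ a, coinvProj i π (c p a) * coinvAntipode i π (c a q) = if p = q then 1 else 0 := by
  simp only [hc.coinvAntipode, Finset.mul_sum, ← mul_assoc]
  rw [Finset.sum_comm]
  simp only [← Finset.sum_mul, h.sum_coinvProj_mul hc, hc.sum_mul_antipode]

theorem sum_incl_antipode_mul_coinvAntipode (h : IsHopfProjection i π) (hc : IsComatrix k c)
    (p q : ι) :
    ∑ a, i (antipode k (π (c p a))) * coinvAntipode i π (c a q) = antipode k (c p q) := by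
  simp only [hc.coinvAntipode, Finset.mul_sum, ← mul_assoc]
  rw [Finset.sum_comm]
  simp [← Finset.sum_mul, h.sum_incl_antipode_mul (h.comatrix_proj hc)]

theorem coinvAntipode_mul_incl (h : IsHopfProjection i π) (a : A) (x : H) :
    coinvAntipode i π (a * i x) = Coalgebra.counit (R := k) x • coinvAntipode i π a := by
  suffices ((LinearMap.mul k A).compl₂ i).compr₂ (coinvAntipode i π) =
      (LinearMap.lsmul k A).flip.compl₁₂ (coinvAntipode i π) Coalgebra.counit from
    LinearMap.congr_fun₂ this a x
  refine ext_comatrix₂ fun n c hc m d hd p q r s => ?_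
  have := (hc.mul (h.comatrix_incl hd)).coinvAntipode (i := i) (π := π) (p, r) (q, s)
  simp only [Fintype.sum_prod_type, h.proj_mul, h.proj_incl, h.incl_antipode,
    HopfAlgebra.antipode_mul_antidistrib, h.incl_mul] at this
  simp only [LinearMap.compr₂_apply, LinearMap.compl₂_apply, LinearMap.mul_apply', this,
    LinearMap.compl₁₂_apply, LinearMap.flip_apply, LinearMap.lsmul_apply, hc.coinvAntipode,
    hd.counit]
  have e (a : Fin n) : ∑ y, i (π (c p a)) * i (d r y) * (i (antipode k (d y s)) *
      antipode k (c a q)) =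
      if r = s then i (π (c p a)) * antipode k (c a q) else 0 := by
    simp only [← mul_assoc, ← Finset.sum_mul]
    simp only [mul_assoc (i (π (c p a))), ← Finset.mul_sum, h.sum_incl_mul_antipode hd]
    split_ifs <;> simp
  simp only [e]
  split_ifs <;> simp

theorem coinvAntipode_incl_mul (h : IsHopfProjection i π) (x : H) (a : A) :
    coinvAntipode i π (i x * a) =
      adjointAction (hopfData k A) (hopfData k H) i (x ⊗ₜ coinvAntipode i π a) := by
  suffices ((LinearMap.mul k A).comp i).compr₂ (coinvAntipode i π) =
      ((TensorProduct.mk k H A).compl₂ (coinvAntipode i π)).compr₂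
        (adjointAction (hopfData k A) (hopfData k H) i) from
    LinearMap.congr_fun₂ this x a
  refine ext_comatrix₂ fun n d hd m c hc r s p q => ?_
  have := ((h.comatrix_incl hd).mul hc).coinvAntipode (i := i) (π := π) (r, p) (s, q)
  simp only [Fintype.sum_prod_type, h.proj_mul, h.proj_incl, h.incl_antipode,
    HopfAlgebra.antipode_mul_antidistrib, h.incl_mul] at this
  simp only [LinearMap.compr₂_apply, LinearMap.compl₂_apply, LinearMap.comp_apply,
    LinearMap.mul_apply', this, TensorProduct.mk_apply, hc.coinvAntipode, hd.adjointAction,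
    Finset.mul_sum, Finset.sum_mul, mul_assoc]

/-- Like `Π`, this map absorbs right factors from `i(H)` into the counit. It may therefore be
evaluated on any representative `a` of `Π(a)`. -/
theorem coinvAntipode_coinvProj (h : IsHopfProjection i π) (a : A) :
    coinvAntipode i π (coinvProj i π a) = coinvAntipode i π a := by
  suffices coinvAntipode i π ∘ₗ coinvProj i π = coinvAntipode i π from
    LinearMap.congr_fun this a
  refine ext_comatrix fun n c hc p q => ?_
  simp [hc.coinvProj, h.coinvAntipode_mul_incl, h.proj_counit, hc.counit]

theorem comul_coinvAntipode (h : IsHopfProjection i π) (hc : IsComatrix k c) (p q : ι) :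
    Coalgebra.comul (R := k) (coinvAntipode i π (c p q)) =
      ∑ a, ∑ b, (i (π (c p a)) * antipode k (c b q)) ⊗ₜ[k] coinvAntipode i π (c a b) := by
  simp only [hc.coinvAntipode, map_sum, Bialgebra.comul_mul, h.incl_comul,
    (h.comatrix_proj hc).comul, hc.comul_antipode, TensorProduct.map_tmul, Finset.sum_mul_sum,
    Algebra.TensorProduct.tmul_mul_tmul, TensorProduct.tmul_sum]
  rw [Finset.sum_comm]
  refine Finset.sum_congr rfl fun a _ => ?_
  rw [Finset.sum_comm]

theorem coinvAntipode_mem (h : IsHopfProjection i π) (a : A) :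
    coinvAntipode i π a ∈ coinvariants (hopfData k A) (hopfData k H) π := by
  suffices π.lTensor A ∘ₗ Coalgebra.comul ∘ₗ coinvAntipode i π =
      (TensorProduct.mk k A H).flip 1 ∘ₗ coinvAntipode i π from LinearMap.congr_fun this a
  refine ext_comatrix fun n c hc p q => ?_
  have e (a b) : π (coinvAntipode i π (c a b)) = if a = b then 1 else 0 := by
    simp only [hc.coinvAntipode, map_sum, h.proj_mul, h.proj_incl, h.proj_antipode,
      (h.comatrix_proj hc).sum_mul_antipode]
  simp only [LinearMap.comp_apply, h.comul_coinvAntipode hc, map_sum, LinearMap.lTensor_tmul, e,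
    TensorProduct.tmul_ite]
  simp [hc.coinvAntipode]

/-- The coinvariants form a left coideal subalgebra, and `Π` is linear over it. -/
theorem coinvProj_mul_of_mem (h : IsHopfProjection i π) {a : A}
    (ha : a ∈ coinvariants (hopfData k A) (hopfData k H) π) (b : A) :
    coinvProj i π (a * b) = a * coinvProj i π b := by
  have ha' : π.lTensor A (Coalgebra.comul (R := k) a) = a ⊗ₜ 1 := ha
  have e (s t : A ⊗[k] A) : π.lTensor A (s * t) = π.lTensor A s * π.lTensor A t := by
    induction s with
    | zero => simp
    | add x y hx hy => simp only [add_mul, map_add, hx, hy]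
    | tmul x y =>
      induction t with
      | zero => simp
      | add x y hx hy => simp only [mul_add, map_add, hx, hy]
      | tmul z w => simp [h.proj_mul]
  -- Both `x ↦ x₁ ⊗ π(x₂)` and the passage to `Π` are visible here: for coinvariant `a` the first
  -- map sends `a b` to `(a ⊗ 1)(b₁ ⊗ π(b₂))`, and the left factor `a` comes out.
  have key (x : A) : coinvProj i π x = LinearMap.mul' k A ((i ∘ₗ antipode k).lTensor A
      (π.lTensor A (Coalgebra.comul (R := k) x))) := by
    rw [← LinearMap.comp_apply (LinearMap.lTensor _ _), ← LinearMap.lTensor_comp]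
    rfl
  rw [key, key, Bialgebra.comul_mul, e, ha']
  generalize π.lTensor A (Coalgebra.comul (R := k) b) = t
  induction t with
  | zero => simp
  | add x y hx hy => simp only [mul_add, map_add, hx, hy]
  | tmul x y => simp [mul_assoc]

end IsHopfProjection

end Projection

theorem middle_tmul {k P Q X Y Z W : Type*} [CommSemiring k]
    [AddCommMonoid P] [Module k P] [AddCommMonoid Q] [Module k Q] [AddCommMonoid X] [Module k X]
    [AddCommMonoid Y] [Module k Y] [AddCommMonoid Z] [Module k Z] [AddCommMonoid W] [Module k W]
    (s : X ⊗[k] Y →ₗ[k] Z ⊗[k] W) (p : P) (x : X) (y : Y) (q : Q) :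
    middle s ((p ⊗ₜ x) ⊗ₜ (y ⊗ₜ q)) = (TensorProduct.assoc k P Z (W ⊗[k] Q)).symm
      (p ⊗ₜ TensorProduct.assoc k Z W Q (s (x ⊗ₜ y) ⊗ₜ q)) := rfl

/-! ### The coinvariants as a braided Hopf algebra -/

section Model

variable {k A H B : Type*} [Field k] [Ring A] [HopfAlgebra k A] [Ring H] [HopfAlgebra k H]
  [AddCommGroup B] [Module k B]

open HopfAlgebra (antipode)

/-- `B`, with the structure maps `E` and `R`, is a copy of the coinvariants of a Hopf algebra with
projection, embedded by `θ`; the map `ρ` is the projection onto the coinvariants. -/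
structure IsCoinvariantModel (i : H →ₗ[k] A) (π : A →ₗ[k] H) (θ : B →ₗ[k] A) (ρ : A →ₗ[k] B)
    (E : YDData k H B) (R : HopfData k B) : Prop extends IsHopfProjection i π where
  theta_rho : ∀ a, θ (ρ a) = coinvProj i π a
  rho_theta : ∀ b, ρ (θ b) = b
  theta_act : ∀ x b, θ (E.act (x ⊗ₜ b)) =
    adjointAction (hopfData k A) (hopfData k H) i (x ⊗ₜ θ b)
  theta_coact : ∀ b, θ.lTensor H (E.coact b) = π.rTensor A (Coalgebra.comul (R := k) (θ b))
  theta_mul : ∀ b b', θ (R.mul (b ⊗ₜ b')) = θ b * θ b'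
  theta_one : θ R.one = 1
  comul_rho : ∀ a, R.comul (ρ a) = TensorProduct.map ρ ρ (Coalgebra.comul (R := k) a)
  counit_theta : ∀ b, R.counit b = Coalgebra.counit (R := k) (θ b)
  theta_antipode : ∀ b, θ (R.antipode b) = coinvAntipode i π (θ b)

namespace IsCoinvariantModel

variable {ι κ : Type} [Fintype ι] [DecidableEq ι] [Fintype κ] [DecidableEq κ]
  {i : H →ₗ[k] A} {π : A →ₗ[k] H} {θ : B →ₗ[k] A} {ρ : A →ₗ[k] B} {E : YDData k H B}
  {R : HopfData k B} {c : ι → ι → A} {d : κ → κ → H} {W : Type*} [AddCommGroup W] [Module k W]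

theorem theta_injective (h : IsCoinvariantModel i π θ ρ E R) : Function.Injective θ :=
  Function.LeftInverse.injective h.rho_theta

theorem lTensor_theta_injective (h : IsCoinvariantModel i π θ ρ E R) (W : Type*)
    [AddCommGroup W] [Module k W] : Function.Injective (θ.lTensor W) := by
  refine Function.LeftInverse.injective (g := ρ.lTensor W) fun x => ?_
  rw [← LinearMap.comp_apply, ← LinearMap.lTensor_comp,
    show ρ ∘ₗ θ = LinearMap.id from LinearMap.ext h.rho_theta, LinearMap.lTensor_id,
    LinearMap.id_apply]

/-- `ρ` is onto, so an identity on `B` may be tested on images of comatrix entries of `A`. The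
structure maps have short formulas there, although the image of a comatrix in `B` is not handled
through a coalgebra instance. -/
theorem ext_rho (h : IsCoinvariantModel i π θ ρ E R) {F G : B →ₗ[k] W}
    (hFG : ∀ (n : ℕ) (c : Fin n → Fin n → A), IsComatrix k c →
      ∀ p q, F (ρ (c p q)) = G (ρ (c p q))) : F = G := by
  have : F ∘ₗ ρ = G ∘ₗ ρ := ext_comatrix hFG
  ext b
  rw [← h.rho_theta b]
  exact LinearMap.congr_fun this (θ b)

theorem rho_coinvProj (h : IsCoinvariantModel i π θ ρ E R) (a : A) :
    ρ (coinvProj i π a) = ρ a := by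
  rw [← h.theta_rho, h.rho_theta]

theorem theta_mem (h : IsCoinvariantModel i π θ ρ E R) (b : B) :
    θ b ∈ coinvariants (hopfData k A) (hopfData k H) π := by
  rw [← h.rho_theta b, h.theta_rho]
  exact h.coinvProj_mem _

theorem rho_mul_incl (h : IsCoinvariantModel i π θ ρ E R) (a : A) (x : H) :
    ρ (a * i x) = Coalgebra.counit (R := k) x • ρ a := by
  rw [← h.rho_coinvProj, h.coinvProj_mul_incl, map_smul, h.rho_coinvProj]

theorem rho_incl (h : IsCoinvariantModel i π θ ρ E R) (x : H) :
    ρ (i x) = Coalgebra.counit (R := k) x • ρ 1 := by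
  rw [← one_mul (i x), h.rho_mul_incl]

theorem act_rho (h : IsCoinvariantModel i π θ ρ E R) (x : H) (a : A) :
    E.act (x ⊗ₜ ρ a) = ρ (i x * a) := by
  apply h.theta_injective
  rw [h.theta_act, h.theta_rho, h.theta_rho, h.coinvProj_incl_mul]

theorem act_eq (h : IsCoinvariantModel i π θ ρ E R) (x : H) (b : B) :
    E.act (x ⊗ₜ b) = ρ (i x * θ b) := by
  rw [← h.act_rho, h.rho_theta]

theorem mul_rho (h : IsCoinvariantModel i π θ ρ E R) (b : B) (a : A) :
    R.mul (b ⊗ₜ ρ a) = ρ (θ b * a) := by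
  apply h.theta_injective
  rw [h.theta_mul, h.theta_rho, h.theta_rho, h.coinvProj_mul_of_mem (h.theta_mem b)]

theorem one_eq (h : IsCoinvariantModel i π θ ρ E R) : R.one = ρ 1 := by
  rw [← h.rho_theta R.one, h.theta_one]

theorem counit_rho (h : IsCoinvariantModel i π θ ρ E R) (a : A) :
    R.counit (ρ a) = Coalgebra.counit (R := k) a := by
  rw [h.counit_theta, h.theta_rho, h.counit_coinvProj]

theorem antipode_rho (h : IsCoinvariantModel i π θ ρ E R) (a : A) :
    R.antipode (ρ a) = ρ (coinvAntipode i π a) := by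
  apply h.theta_injective
  rw [h.theta_antipode, h.theta_rho, h.theta_rho, h.coinvAntipode_coinvProj,
    h.coinvProj_of_mem (h.coinvAntipode_mem a)]

/-- The coadjoint form `π(a₁) S(π(a₃)) ⊗ ρ(a₂)` of the coaction, obtained by applying `π` to the
left factor in `comul_coinvProj`. -/
theorem coact_rho (h : IsCoinvariantModel i π θ ρ E R) (hc : IsComatrix k c) (p q : ι) :
    E.coact (ρ (c p q)) =
      ∑ a, ∑ b, (π (c p a) * antipode k (π (c b q))) ⊗ₜ[k] ρ (c a b) := by
  apply h.lTensor_theta_injective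
  rw [h.theta_coact, h.theta_rho, h.comul_coinvProj hc]
  simp [h.theta_rho, h.proj_mul, h.proj_incl]

theorem comul_rho_apply (h : IsCoinvariantModel i π θ ρ E R) (hc : IsComatrix k c) (p q : ι) :
    R.comul (ρ (c p q)) = ∑ a, ρ (c p a) ⊗ₜ[k] ρ (c a q) := by
  simp [h.comul_rho, hc.comul]

theorem isYetterDrinfeld (h : IsCoinvariantModel i π θ ρ E R) :
    E.IsYetterDrinfeld (hopfData k H) where
  one_act b := by
    rw [show (hopfData k H).one = 1 from rfl, h.act_eq, h.incl_one, one_mul, h.rho_theta]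
  mul_act x y b := by
    rw [← h.rho_theta b, h.act_rho, h.act_rho, h.act_rho]
    simp [hopfData, h.incl_mul, mul_assoc]
  counit_coact b := by
    suffices (hopfData k H).counit.rTensor B ∘ₗ E.coact = TensorProduct.mk k k B 1 from
      LinearMap.congr_fun this b
    refine h.ext_rho fun n c hc p q => ?_
    simp [h.coact_rho hc, hopfData, h.proj_counit, hc.counit, TensorProduct.ite_tmul]
  comul_coact b := by
    suffices (TensorProduct.assoc k H H B).toLinearMap ∘ₗ
        (hopfData k H).comul.rTensor B ∘ₗ E.coact = E.coact.lTensor H ∘ₗ E.coact from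
      LinearMap.congr_fun this b
    refine h.ext_rho fun n c hc p q => ?_
    simp only [LinearMap.comp_apply, h.coact_rho hc, map_sum, LinearMap.rTensor_tmul, hopfData,
      Bialgebra.comul_mul, (h.comatrix_proj hc).comul, (h.comatrix_proj hc).comul_antipode,
      Finset.sum_mul_sum, Algebra.TensorProduct.tmul_mul_tmul, TensorProduct.sum_tmul,
      LinearEquiv.coe_coe, TensorProduct.assoc_tmul, LinearMap.lTensor_tmul,
      TensorProduct.tmul_sum]
    rw [sum_rotate₄, sum_rotate₄]
  compat x b := by
    suffices ((TensorProduct.mk k (H ⊗[k] H) (H ⊗[k] B)).compl₁₂ (hopfData k H).comul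
          E.coact).compr₂ (TensorProduct.map (hopfData k H).mul E.act ∘ₗ
            (TensorProduct.tensorTensorTensorComm k H H H B).toLinearMap) =
        ((TensorProduct.mk k (H ⊗[k] H) B).comp (hopfData k H).comul).compr₂
          ((hopfData k H).mul.rTensor B ∘ₗ (TensorProduct.rightComm k H B H).toLinearMap ∘ₗ
            (E.coact ∘ₗ E.act).rTensor H ∘ₗ (TensorProduct.rightComm k H H B).toLinearMap) by
      refine (LinearMap.congr_fun₂ this x b).trans ?_
      simp only [LinearMap.compr₂_apply, LinearMap.comp_apply, TensorProduct.mk_apply,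
        LinearEquiv.coe_coe]
      congr 2
      induction (hopfData k H).comul x with
      | zero => simp
      | add s t hs ht => simp only [TensorProduct.add_tmul, map_add, hs, ht]
      | tmul s t => simp
    refine ext_comatrix fun m d hd r s => h.ext_rho fun n c hc p q => ?_
    have e (u v : Fin m) := h.coact_rho ((h.comatrix_incl hd).mul hc) (u, p) (v, q)
    simp only [Fintype.sum_prod_type] at e
    simp only [LinearMap.compr₂_apply, LinearMap.compl₁₂_apply, LinearMap.comp_apply, hopfData,
      hd.comul, TensorProduct.mk_apply, h.coact_rho hc, TensorProduct.sum_tmul,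
      map_sum, LinearMap.sum_apply, LinearEquiv.coe_coe,
      LinearMap.rTensor_tmul, TensorProduct.tensorTensorTensorComm_tmul, TensorProduct.map_tmul, LinearMap.mul'_apply,
      h.act_rho, TensorProduct.rightComm_tmul, e, h.proj_mul, h.proj_incl,
      HopfAlgebra.antipode_mul_antidistrib]
    -- The coaction of `ρ(i(d₁) c)` ends in `S(d)` on its `H`-factor, and the axiom multiplies by
    -- the next `d` on the right. Their common index is moved innermost so that the pair collapses
    -- to a delta.
    rw [sum_rotate₅, sum_rotate₃, sum_rotate₃]
    simp only [mul_assoc, ← TensorProduct.sum_tmul, ← Finset.mul_sum, hd.sum_antipode_mul,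
      mul_ite, mul_one, mul_zero, TensorProduct.ite_tmul]
    refine Finset.sum_congr rfl fun _ _ => Finset.sum_congr rfl fun _ _ => ?_
    rw [Finset.sum_comm]
    simp

theorem theta_act_comatrix (h : IsCoinvariantModel i π θ ρ E R) (hd : IsComatrix k d) (r s : κ)
    (b : B) : θ (E.act (d r s ⊗ₜ b)) = ∑ u, i (d r u) * θ b * i (antipode k (d u s)) := by
  rw [h.theta_act, hd.adjointAction]

/-- `(h₁ ▹ b) i(h₂) = i(h) b`. -/
theorem sum_theta_act_mul_incl (h : IsCoinvariantModel i π θ ρ E R) (hd : IsComatrix k d)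
    (r s : κ) (b : B) : ∑ u, θ (E.act (d r u ⊗ₜ b)) * i (d u s) = i (d r s) * θ b := by
  simp only [h.theta_act_comatrix hd, Finset.sum_mul]
  rw [Finset.sum_comm]
  simp [mul_assoc, ← Finset.mul_sum, h.sum_incl_antipode_mul hd]

theorem mul_hom (h : IsCoinvariantModel i π θ ρ E R) :
    IsYDHom (E.tensor (hopfData k H) E) E R.mul where
  map_act x t := by
    induction t with
    | zero => simp
    | add t t' ht ht' => simp only [TensorProduct.tmul_add, map_add, ht, ht']
    | tmul b b' =>
      suffices E.act ∘ₗ (TensorProduct.mk k H B).flip (R.mul (b ⊗ₜ b')) =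
          R.mul ∘ₗ (E.tensor (hopfData k H) E).act ∘ₗ
            (TensorProduct.mk k H (B ⊗[k] B)).flip (b ⊗ₜ b') from
        (LinearMap.congr_fun this x).symm
      refine ext_comatrix fun m d hd r s => ?_
      simp only [LinearMap.comp_apply, LinearMap.flip_apply, TensorProduct.mk_apply,
        YDData.tensor, LinearMap.rTensor_tmul, hopfData, hd.comul, TensorProduct.sum_tmul,
        map_sum, LinearEquiv.coe_coe, TensorProduct.tensorTensorTensorComm_tmul,
        TensorProduct.map_tmul, h.act_eq _ b', h.mul_rho, ← mul_assoc]
      -- With the second factor written as `ρ(i(h₂) θ(b'))`, the product contains `θ(h₁ ▹ b) i(h₂)`,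
      -- which is `i(h) θ(b)`.
      rw [← map_sum, ← Finset.sum_mul, h.sum_theta_act_mul_incl hd, h.act_eq, h.theta_mul,
        mul_assoc]
  map_coact t := by
    induction t with
    | zero => simp
    | add t t' ht ht' => simp only [map_add, ht, ht']
    | tmul b b' =>
      apply h.lTensor_theta_injective
      rw [h.theta_coact, h.theta_mul, Bialgebra.comul_mul]
      have e (s t : A ⊗[k] A) : π.rTensor A (s * t) = π.rTensor A s * π.rTensor A t := by
        induction s with
        | zero => simp
        | add x y hx hy => simp only [add_mul, map_add, hx, hy]
        | tmul x y =>
          induction t with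
          | zero => simp
          | add x y hx hy => simp only [mul_add, map_add, hx, hy]
          | tmul z w => simp [h.proj_mul]
      rw [e, ← h.theta_coact, ← h.theta_coact]
      simp only [YDData.tensor, LinearMap.comp_apply, TensorProduct.map_tmul]
      generalize E.coact b = s
      generalize E.coact b' = t
      induction s with
      | zero => simp
      | add x y hx hy => simp only [add_mul, map_add, TensorProduct.add_tmul, hx, hy]
      | tmul x y =>
        induction t with
        | zero => simp
        | add x y hx hy => simp only [mul_add, map_add, TensorProduct.tmul_add, hx, hy]
        | tmul z w => simp [hopfData, h.theta_mul]

theorem one_hom (h : IsCoinvariantModel i π θ ρ E R) :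
    IsYDHom (YDData.unit (hopfData k H)) E (LinearMap.toSpanSingleton k B R.one) where
  map_act x r := by
    simp [YDData.unit, hopfData, h.act_eq, h.theta_one, h.rho_incl, smul_smul, mul_comm]
    rw [h.one_eq]
  map_coact r := by
    apply h.lTensor_theta_injective
    rw [h.theta_coact]
    simp [YDData.unit, hopfData, h.theta_one, Algebra.TensorProduct.one_def, h.proj_one]

theorem comul_hom (h : IsCoinvariantModel i π θ ρ E R) :
    IsYDHom E (E.tensor (hopfData k H) E) R.comul where
  map_act x b := by
    suffices (TensorProduct.mk k H B).compr₂ (R.comul ∘ₗ E.act) =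
        ((TensorProduct.mk k H (B ⊗[k] B)).compl₂ R.comul).compr₂
          (E.tensor (hopfData k H) E).act from LinearMap.congr_fun₂ this x b
    refine ext_comatrix fun m d hd r s => h.ext_rho fun n c hc p q => ?_
    have e := h.comul_rho_apply ((h.comatrix_incl hd).mul hc) (r, p) (s, q)
    simp only [Fintype.sum_prod_type] at e
    simp only [LinearMap.compr₂_apply, LinearMap.compl₂_apply, LinearMap.comp_apply,
      TensorProduct.mk_apply, YDData.tensor, h.comul_rho_apply hc, map_sum,
      LinearMap.rTensor_tmul, hopfData, hd.comul, TensorProduct.sum_tmul, LinearEquiv.coe_coe,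
      TensorProduct.tensorTensorTensorComm_tmul, TensorProduct.map_tmul, h.act_rho, e]
    rw [Finset.sum_comm]
  map_coact b := by
    suffices (E.tensor (hopfData k H) E).coact ∘ₗ R.comul = R.comul.lTensor H ∘ₗ E.coact from
      LinearMap.congr_fun this b
    refine h.ext_rho fun n c hc p q => ?_
    simp only [LinearMap.comp_apply, YDData.tensor, h.comul_rho_apply hc, h.coact_rho hc,
      TensorProduct.tmul_sum, map_sum, LinearMap.rTensor_tmul, LinearMap.lTensor_tmul, hopfData,
      TensorProduct.sum_tmul, LinearEquiv.coe_coe, LinearMap.mul'_apply,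
      TensorProduct.tensorTensorTensorComm_tmul, TensorProduct.map_tmul]
    -- The tensor product coaction carries `π(c₁) S(π(c₃)) π(c₄) S(π(c₆))`; the index joining the
    -- two middle factors is summed first and cancels them.
    rw [sum_rotate₅]
    simp only [mul_assoc, ← Finset.mul_sum, ← TensorProduct.sum_tmul,
      (h.comatrix_proj hc).sum_antipode_mul_assoc]
    simp only [mul_ite, mul_zero, TensorProduct.ite_tmul,
      Finset.sum_ite_eq', Finset.mem_univ, if_true]
    rw [sum_rotate₃, Finset.sum_comm]

theorem counit_hom (h : IsCoinvariantModel i π θ ρ E R) :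
    IsYDHom E (YDData.unit (hopfData k H)) R.counit where
  map_act x b := by
    rw [h.act_eq, h.counit_rho]
    simp [YDData.unit, hopfData, h.incl_counit, h.counit_theta]
  map_coact b := by
    suffices (YDData.unit (hopfData k H)).coact ∘ₗ R.counit = R.counit.lTensor H ∘ₗ E.coact from
      LinearMap.congr_fun this b
    refine h.ext_rho fun n c hc p q => ?_
    simp [YDData.unit, hopfData, h.coact_rho hc, h.counit_rho, hc.counit, TensorProduct.tmul_ite,
      ← TensorProduct.sum_tmul, (h.comatrix_proj hc).sum_mul_antipode]
    split_ifs <;> simp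

theorem antipode_hom (h : IsCoinvariantModel i π θ ρ E R) : IsYDHom E E R.antipode where
  map_act x b := by
    rw [h.act_eq, h.antipode_rho, h.coinvAntipode_incl_mul, ← h.theta_antipode, ← h.theta_act,
      h.rho_theta]
  map_coact b := by
    suffices E.coact ∘ₗ R.antipode = R.antipode.lTensor H ∘ₗ E.coact from
      LinearMap.congr_fun this b
    refine h.ext_rho fun n c hc p q => ?_
    apply h.lTensor_theta_injective
    simp only [LinearMap.comp_apply, h.theta_coact, h.theta_antipode, h.theta_rho,
      h.coinvAntipode_coinvProj, h.comul_coinvAntipode hc, h.coact_rho hc, map_sum,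
      LinearMap.rTensor_tmul, LinearMap.lTensor_tmul, h.proj_mul, h.proj_incl, h.proj_antipode]

theorem hopfAxioms (h : IsCoinvariantModel i π θ ρ E R) : R.HopfAxioms (E.braiding E) where
  mul_assoc x y z := h.theta_injective (by simp only [h.theta_mul, mul_assoc])
  one_mul x := h.theta_injective (by simp only [h.theta_mul, h.theta_one, one_mul])
  mul_one x := h.theta_injective (by simp only [h.theta_mul, h.theta_one, mul_one])
  coassoc b := by
    suffices (TensorProduct.assoc k B B B).toLinearMap ∘ₗ R.comul.rTensor B ∘ₗ R.comul =
      R.comul.lTensor B ∘ₗ R.comul from LinearMap.congr_fun this b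
    refine h.ext_rho fun n c hc p q => ?_
    simp only [LinearMap.comp_apply, h.comul_rho_apply hc, map_sum, LinearMap.rTensor_tmul,
      LinearMap.lTensor_tmul, TensorProduct.sum_tmul, TensorProduct.tmul_sum, LinearEquiv.coe_coe,
      TensorProduct.assoc_tmul]
    rw [Finset.sum_comm]
  counit_left b := by
    suffices R.counit.rTensor B ∘ₗ R.comul = TensorProduct.mk k k B 1 from
      LinearMap.congr_fun this b
    refine h.ext_rho fun n c hc p q => ?_
    simp [h.comul_rho_apply hc, h.counit_rho, hc.counit, TensorProduct.ite_tmul]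
  counit_right b := by
    suffices R.counit.lTensor B ∘ₗ R.comul = (TensorProduct.mk k B k).flip 1 from
      LinearMap.congr_fun this b
    refine h.ext_rho fun n c hc p q => ?_
    simp [h.comul_rho_apply hc, h.counit_rho, hc.counit, TensorProduct.tmul_ite]
  comul_mul x y := by
    suffices (TensorProduct.mk k B B).compr₂ (R.comul ∘ₗ R.mul) =
        ((TensorProduct.mk k (B ⊗[k] B) (B ⊗[k] B)).compl₁₂ R.comul R.comul).compr₂
          (TensorProduct.map R.mul R.mul ∘ₗ middle (E.braiding E)) from
      LinearMap.congr_fun₂ this x y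
    refine h.ext_rho fun n c hc p q => h.ext_rho fun m d hd r s => ?_
    simp only [LinearMap.compr₂_apply, LinearMap.compl₁₂_apply, LinearMap.comp_apply,
      TensorProduct.mk_apply, h.mul_rho, h.comul_rho, Bialgebra.comul_mul, h.theta_rho,
      h.comul_coinvProj hc, hc.comul, hd.comul, Finset.sum_mul, Finset.mul_sum, LinearMap.sum_apply,
      Algebra.TensorProduct.tmul_mul_tmul, map_sum, TensorProduct.map_tmul,
      TensorProduct.sum_tmul, TensorProduct.tmul_sum, middle_tmul, YDData.braiding,
      LinearMap.rTensor_tmul, h.coact_rho hc, LinearEquiv.coe_coe, TensorProduct.rightComm_tmul,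
      TensorProduct.assoc_tmul, TensorProduct.assoc_symm_tmul, h.act_rho]
    -- The two sides have left factors `c₁ i(S(π(c₃))) d₁` and `Π(c₁) i(π(c₂)) i(S(π(c₄))) d₁`,
    -- under `ρ`. They agree because `Π(c₁) i(π(c₂)) = c₁`.
    refine Finset.sum_congr rfl fun u _ => ?_
    rw [sum_rotate₃]
    refine Finset.sum_congr rfl fun a _ => Finset.sum_congr rfl fun b _ => ?_
    simp only [← TensorProduct.sum_tmul, ← map_sum, h.incl_mul, ← mul_assoc, ← Finset.sum_mul,
      h.sum_coinvProj_mul hc]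
  comul_one := by
    rw [h.one_eq, h.comul_rho]
    simp [Algebra.TensorProduct.one_def]
  counit_mul x y := by
    rw [h.counit_theta, h.counit_theta, h.counit_theta, h.theta_mul, Bialgebra.counit_mul]
  counit_one := by simp [h.counit_theta, h.theta_one]
  antipode_left b := by
    suffices R.mul ∘ₗ R.antipode.rTensor B ∘ₗ R.comul =
        LinearMap.toSpanSingleton k B R.one ∘ₗ R.counit from LinearMap.congr_fun this b
    refine h.ext_rho fun n c hc p q => ?_
    simp only [LinearMap.comp_apply, h.comul_rho_apply hc, map_sum, LinearMap.rTensor_tmul,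
      h.mul_rho, h.theta_antipode, h.theta_rho, h.coinvAntipode_coinvProj]
    -- In `A` the convolution is `i(π(a))` and not `ε(a)`; only `ρ` reduces it to a multiple of the
    -- unit.
    rw [← map_sum, hc.sum_coinvAntipode_mul]
    simp [h.rho_incl, h.proj_counit, h.counit_rho, h.one_eq]
  antipode_right b := by
    suffices R.mul ∘ₗ R.antipode.lTensor B ∘ₗ R.comul =
        LinearMap.toSpanSingleton k B R.one ∘ₗ R.counit from LinearMap.congr_fun this b
    refine h.ext_rho fun n c hc p q => ?_
    simp only [LinearMap.comp_apply, h.comul_rho_apply hc, map_sum, LinearMap.lTensor_tmul,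
      h.mul_rho, h.antipode_rho, h.theta_rho]
    rw [← map_sum, h.sum_coinvProj_mul_coinvAntipode hc]
    simp [hc.counit, h.counit_rho, h.one_eq, apply_ite ρ]

theorem isHopfAlgebraInYD (h : IsCoinvariantModel i π θ ρ E R) :
    IsHopfAlgebraInYD (hopfData k H) E R where
  isYetterDrinfeld := h.isYetterDrinfeld
  mul_hom := h.mul_hom
  one_hom := h.one_hom
  comul_hom := h.comul_hom
  counit_hom := h.counit_hom
  antipode_hom := h.antipode_hom
  hopfAxioms := h.hopfAxioms

end IsCoinvariantModel

end Model

/-! ### Radford's theorem for `HopfData` -/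

section Transport

variable {k A B : Type*} [CommSemiring k] [AddCommMonoid A] [Module k A]
  [AddCommMonoid B] [Module k B]

theorem map_map_middle_comm {f : B →ₗ[k] A} {m : B ⊗[k] B →ₗ[k] B} {m' : A ⊗[k] A →ₗ[k] A}
    (hm : ∀ x y, f (m (x ⊗ₜ y)) = m' (f x ⊗ₜ f y)) (s t : B ⊗[k] B) :
    TensorProduct.map f f (TensorProduct.map m m
      (middle (TensorProduct.comm k B B).toLinearMap (s ⊗ₜ t))) =
    TensorProduct.map m' m' (middle (TensorProduct.comm k A A).toLinearMap
      (TensorProduct.map f f s ⊗ₜ TensorProduct.map f f t)) := by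
  induction s with
  | zero => simp
  | add x y hx hy => simp only [map_add, TensorProduct.add_tmul, hx, hy]
  | tmul x y =>
    induction t with
    | zero => simp
    | add x y hx hy => simp only [map_add, TensorProduct.tmul_add, hx, hy]
    | tmul z w => simp [middle_tmul, hm]

/-- The Hopf algebra axioms can be pulled back along a bijection compatible with the structure. -/
theorem IsHopfAlgebraHom.isHopfAlgebra {E : HopfData k B} {D : HopfData k A} {f : B →ₗ[k] A}
    {g : A →ₗ[k] B} (hf : IsHopfAlgebraHom E D f) (hgf : g ∘ₗ f = LinearMap.id)
    (hD : D.IsHopfAlgebra) : E.IsHopfAlgebra := by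
  -- A linear left inverse of `f` makes the tensor powers of `f` injective too, so each axiom may be
  -- checked after mapping to `A`.
  have inj : Function.Injective f := Function.LeftInverse.injective (LinearMap.congr_fun hgf)
  have inj₂ : Function.Injective (TensorProduct.map f f) := by
    refine Function.LeftInverse.injective (g := TensorProduct.map g g) fun x => ?_
    rw [← LinearMap.comp_apply, ← TensorProduct.map_comp, hgf, TensorProduct.map_id,
      LinearMap.id_apply]
  have inj₃ : Function.Injective (TensorProduct.map f (TensorProduct.map f f)) := by
    refine Function.LeftInverse.injective
      (g := TensorProduct.map g (TensorProduct.map g g)) fun x => ?_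
    rw [← LinearMap.comp_apply, ← TensorProduct.map_comp, ← TensorProduct.map_comp, hgf,
      TensorProduct.map_id, TensorProduct.map_id, LinearMap.id_apply]
  have injl : Function.Injective (f.lTensor k) := by
    refine Function.LeftInverse.injective (g := g.lTensor k) fun x => ?_
    rw [← LinearMap.comp_apply, ← LinearMap.lTensor_comp, hgf, LinearMap.lTensor_id,
      LinearMap.id_apply]
  have injr : Function.Injective (f.rTensor k) := by
    refine Function.LeftInverse.injective (g := g.rTensor k) fun x => ?_
    rw [← LinearMap.comp_apply, ← LinearMap.rTensor_comp, hgf, LinearMap.rTensor_id,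
      LinearMap.id_apply]
  constructor
  · intro x y z
    exact inj (by simp only [hf.map_mul, hD.mul_assoc])
  · intro x
    exact inj (by simp only [hf.map_mul, hf.map_one, hD.one_mul])
  · intro x
    exact inj (by simp only [hf.map_mul, hf.map_one, hD.mul_one])
  · intro x
    apply inj₃
    have h := hD.coassoc (f x)
    rw [hf.map_comul] at h
    have e₁ (t : B ⊗[k] B) : TensorProduct.map f (TensorProduct.map f f)
        (TensorProduct.assoc k B B B (E.comul.rTensor B t)) =
        TensorProduct.assoc k A A A (D.comul.rTensor A (TensorProduct.map f f t)) := by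
      induction t with
      | zero => simp
      | add x y hx hy => simp only [map_add, hx, hy]
      | tmul x y =>
        simp only [LinearMap.rTensor_tmul, TensorProduct.map_tmul, hf.map_comul]
        induction E.comul x with
        | zero => simp
        | add x y hx hy => simp only [map_add, TensorProduct.add_tmul, hx, hy]
        | tmul x y => simp
    have e₂ (t : B ⊗[k] B) : TensorProduct.map f (TensorProduct.map f f)
        (E.comul.lTensor B t) = D.comul.lTensor A (TensorProduct.map f f t) := by
      induction t with
      | zero => simp
      | add x y hx hy => simp only [map_add, hx, hy]
      | tmul x y => simp [hf.map_comul]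
    rw [e₁, e₂, h]
  · intro x
    apply injl
    have h := hD.counit_left (f x)
    rw [hf.map_comul] at h
    have e (t : B ⊗[k] B) : f.lTensor k (E.counit.rTensor B t) =
        D.counit.rTensor A (TensorProduct.map f f t) := by
      induction t with
      | zero => simp
      | add x y hx hy => simp only [map_add, hx, hy]
      | tmul x y => simp [hf.map_counit]
    rw [e, h, LinearMap.lTensor_tmul]
  · intro x
    apply injr
    have h := hD.counit_right (f x)
    rw [hf.map_comul] at h
    have e (t : B ⊗[k] B) : f.rTensor k (E.counit.lTensor B t) =
        D.counit.lTensor A (TensorProduct.map f f t) := by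
      induction t with
      | zero => simp
      | add x y hx hy => simp only [map_add, hx, hy]
      | tmul x y => simp [hf.map_counit]
    rw [e, h, LinearMap.rTensor_tmul]
  · intro x y
    apply inj₂
    rw [← hf.map_comul, map_map_middle_comm hf.map_mul, hf.map_mul, hD.comul_mul, hf.map_comul,
      hf.map_comul]
  · apply inj₂
    rw [← hf.map_comul, hf.map_one, hD.comul_one, TensorProduct.map_tmul, hf.map_one]
  · intro x y
    rw [← hf.map_counit, hf.map_mul, hD.counit_mul, hf.map_counit, hf.map_counit]
  · rw [← hf.map_counit, hf.map_one, hD.counit_one]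
  · intro x
    apply inj
    have h := hD.antipode_left (f x)
    rw [hf.map_comul] at h
    have e (t : B ⊗[k] B) : f (E.mul (E.antipode.rTensor B t)) =
        D.mul (D.antipode.rTensor A (TensorProduct.map f f t)) := by
      induction t with
      | zero => simp
      | add x y hx hy => simp only [map_add, hx, hy]
      | tmul x y => simp [hf.map_mul, hf.map_antipode]
    rw [e, h, map_smul, hf.map_one, hf.map_counit]
  · intro x
    apply inj
    have h := hD.antipode_right (f x)
    rw [hf.map_comul] at h
    have e (t : B ⊗[k] B) : f (E.mul (E.antipode.lTensor B t)) =
        D.mul (D.antipode.lTensor A (TensorProduct.map f f t)) := by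
      induction t with
      | zero => simp
      | add x y hx hy => simp only [map_add, hx, hy]
      | tmul x y => simp [hf.map_mul, hf.map_antipode]
    rw [e, h, map_smul, hf.map_one, hf.map_counit]

theorem hopfData_isHopfAlgebra (k A : Type*) [Field k] [Ring A] [HopfAlgebra k A] :
    (hopfData k A).IsHopfAlgebra where
  mul_assoc x y z := by simp [hopfData, mul_assoc]
  one_mul x := by simp [hopfData]
  mul_one x := by simp [hopfData]
  coassoc x := by simp [hopfData]
  counit_left x := by simp [hopfData]
  counit_right x := by simp [hopfData]
  comul_mul x y := by
    simp only [hopfData, LinearMap.mul'_apply, Bialgebra.comul_mul]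
    generalize Coalgebra.comul (R := k) x = s
    generalize Coalgebra.comul (R := k) y = t
    induction s with
    | zero => simp
    | add x y hx hy => simp only [map_add, TensorProduct.add_tmul, add_mul, hx, hy]
    | tmul x y =>
      induction t with
      | zero => simp
      | add x y hx hy => simp only [map_add, TensorProduct.tmul_add, mul_add, hx, hy]
      | tmul z w => simp [middle_tmul]
  comul_one := by simp [hopfData, Algebra.TensorProduct.one_def]
  counit_mul x y := by simp [hopfData]
  counit_one := by simp [hopfData]
  antipode_left x := by simp [hopfData, Algebra.algebraMap_eq_smul_one]
  antipode_right x := by simp [hopfData, Algebra.algebraMap_eq_smul_one]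

end Transport

/-! ### Radford biproduct and the isomorphism `b × h ↦ θ(b) i(h)` -/

section Biproduct

variable {k A H B : Type*} [Field k] [Ring A] [HopfAlgebra k A] [Ring H] [HopfAlgebra k H]
  [AddCommGroup B] [Module k B]
  {i : H →ₗ[k] A} {π : A →ₗ[k] H} {θ : B →ₗ[k] A} {ρ : A →ₗ[k] B} {E : YDData k H B}
  {R : HopfData k B}

open HopfAlgebra (antipode)

/-- The map `b × h ↦ θ(b) i(h)`. -/
def biproductMap (θ : B →ₗ[k] A) (i : H →ₗ[k] A) : B ⊗[k] H →ₗ[k] A :=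
  LinearMap.mul' k A ∘ₗ TensorProduct.map θ i

@[simp]
theorem biproductMap_tmul (θ : B →ₗ[k] A) (i : H →ₗ[k] A) (b : B) (x : H) :
    biproductMap θ i (b ⊗ₜ x) = θ b * i x := rfl

namespace IsCoinvariantModel

/-- The smash product encodes the commutation rule `i(h) θ(b) = θ(h₁ ▹ b) i(h₂)`, which holds in `A`
by `sum_theta_act_mul_incl`. -/
theorem biproductMap_mul (h : IsCoinvariantModel i π θ ρ E R) (s t : B ⊗[k] H) :
    biproductMap θ i (biproductMul (hopfData k H) E R (s ⊗ₜ t)) =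
      biproductMap θ i s * biproductMap θ i t := by
  induction s with
  | zero => simp
  | add x y hx hy => simp only [map_add, TensorProduct.add_tmul, add_mul, hx, hy]
  | tmul b x =>
    induction t with
    | zero => simp
    | add x y hx hy => simp only [map_add, TensorProduct.tmul_add, mul_add, hx, hy]
    | tmul b' x' =>
      suffices biproductMap θ i ∘ₗ biproductMul (hopfData k H) E R ∘ₗ
          (TensorProduct.mk k _ _).flip (b' ⊗ₜ x') ∘ₗ TensorProduct.mk k B H b =
          LinearMap.mulLeft k (θ b) ∘ₗ LinearMap.mulRight k (θ b' * i x') ∘ₗ i by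
        simpa [mul_assoc] using LinearMap.congr_fun this x
      refine ext_comatrix fun m d hd r s => ?_
      simp only [LinearMap.comp_apply, TensorProduct.mk_apply, LinearMap.flip_apply,
        biproductMul, middle_tmul, smashSwap, hopfData, LinearMap.rTensor_tmul, hd.comul,
        TensorProduct.sum_tmul, TensorProduct.tmul_sum, map_sum, LinearEquiv.coe_coe,
        TensorProduct.rightComm_tmul, TensorProduct.assoc_tmul, TensorProduct.assoc_symm_tmul,
        TensorProduct.map_tmul, LinearMap.mul'_apply, biproductMap_tmul, h.theta_mul, h.incl_mul,
        LinearMap.mulLeft_apply, LinearMap.mulRight_apply]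
      simp only [mul_assoc, ← Finset.mul_sum]
      simp only [← mul_assoc, ← Finset.sum_mul, h.sum_theta_act_mul_incl hd]

theorem isHopfAlgebraHom_biproductMap (h : IsCoinvariantModel i π θ ρ E R) :
    IsHopfAlgebraHom (biproduct (hopfData k H) E R) (hopfData k A) (biproductMap θ i) where
  map_mul := h.biproductMap_mul
  map_one := by simp [biproduct, hopfData, h.theta_one, h.incl_one]
  map_comul t := by
    induction t with
    | zero => simp
    | add x y hx hy => simp only [map_add, hx, hy]
    | tmul b x =>
      suffices (TensorProduct.mk k B H).compr₂ (Coalgebra.comul ∘ₗ biproductMap θ i) =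
          (TensorProduct.mk k B H).compr₂ (TensorProduct.map (biproductMap θ i)
            (biproductMap θ i) ∘ₗ (biproduct (hopfData k H) E R).comul) from
        LinearMap.congr_fun₂ this b x
      refine h.ext_rho fun n c hc p q => ext_comatrix fun m d hd r s => ?_
      simp only [LinearMap.compr₂_apply, LinearMap.comp_apply, TensorProduct.mk_apply,
        biproductMap_tmul, h.theta_rho, Bialgebra.comul_mul, h.comul_coinvProj hc, h.incl_comul,
        hd.comul, map_sum, TensorProduct.map_tmul, Finset.sum_mul, Finset.mul_sum,
        Algebra.TensorProduct.tmul_mul_tmul, biproduct, h.comul_rho_apply hc, hopfData,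
        TensorProduct.sum_tmul, TensorProduct.tmul_sum, middle_tmul, cosmashSwap,
        LinearMap.rTensor_tmul, h.coact_rho hc, LinearEquiv.coe_coe, TensorProduct.rightComm_tmul,
        LinearMap.mul'_apply, TensorProduct.assoc_tmul, TensorProduct.assoc_symm_tmul]
      refine Finset.sum_congr rfl fun u _ => ?_
      rw [sum_rotate₃]
      refine Finset.sum_congr rfl fun a _ => Finset.sum_congr rfl fun b _ => ?_
      simp only [← TensorProduct.sum_tmul, h.incl_mul, ← mul_assoc, ← Finset.sum_mul,
        h.sum_coinvProj_mul hc]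
  map_counit t := by
    induction t with
    | zero => simp
    | add x y hx hy => simp only [map_add, hx, hy]
    | tmul b x => simp [biproduct, hopfData, h.counit_theta, h.incl_counit]
  map_antipode t := by
    induction t with
    | zero => simp
    | add x y hx hy => simp only [map_add, hx, hy]
    | tmul b x =>
      suffices biproductMap θ i ∘ₗ (biproduct (hopfData k H) E R).antipode ∘ₗ
            (TensorProduct.mk k B H).flip x =
          antipode k ∘ₗ biproductMap θ i ∘ₗ (TensorProduct.mk k B H).flip x from
        LinearMap.congr_fun this b
      refine h.ext_rho fun n c hc p q => ?_
      have hm : (hopfData k H).mul = LinearMap.mul' k H := rfl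
      have ho : (hopfData k H).one = 1 := rfl
      have hs : (hopfData k H).antipode = antipode k := rfl
      simp only [biproduct, LinearMap.comp_apply, TensorProduct.mk_apply, LinearMap.flip_apply,
        cosmashSwap, LinearMap.rTensor_tmul, h.coact_rho hc, map_sum, TensorProduct.sum_tmul,
        LinearEquiv.coe_coe, TensorProduct.rightComm_tmul, TensorProduct.map_tmul,
        h.biproductMap_mul, biproductMap_tmul, h.theta_one, hm, ho, hs, h.incl_one, mul_one, one_mul,
        LinearMap.mul'_apply, HopfAlgebra.antipode_mul_antidistrib, h.theta_antipode,
        h.theta_rho, h.coinvAntipode_coinvProj]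
      -- For `b = ρ(c)` the left side is `i(S(x)) i(S²(π(c₃))) i(S(π(c₁))) S̲(c₂)`, where `S̲` is
      -- `coinvAntipode`. The last two factors combine to the antipode of `A`, leaving `S(Π(c)
      -- i(x))`.
      rw [Finset.sum_comm]
      simp only [h.incl_mul, mul_assoc, ← Finset.mul_sum,
        h.sum_incl_antipode_mul_coinvAntipode hc]
      simp only [hc.coinvProj, map_sum, HopfAlgebra.antipode_mul_antidistrib, h.incl_antipode]

/-- The inverse `a ↦ ρ(a₁) × π(a₂)` of `biproductMap`. -/
theorem biproductMap_comp_inverse (h : IsCoinvariantModel i π θ ρ E R) :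
    biproductMap θ i ∘ₗ TensorProduct.map ρ π ∘ₗ Coalgebra.comul = LinearMap.id := by
  refine ext_comatrix fun n c hc p q => ?_
  simp [hc.comul, h.theta_rho, h.sum_coinvProj_mul hc]

theorem inverse_comp_biproductMap (h : IsCoinvariantModel i π θ ρ E R) :
    (TensorProduct.map ρ π ∘ₗ Coalgebra.comul) ∘ₗ biproductMap θ i = LinearMap.id := by
  apply TensorProduct.ext
  refine h.ext_rho fun n c hc p q => ext_comatrix fun m d hd r s => ?_
  simp [h.theta_rho, h.comul_coinvProj hc, h.incl_comul, hd.comul, Finset.sum_mul, Finset.mul_sum,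
    h.proj_mul, h.proj_coinvProj hc, h.proj_incl, h.rho_mul_incl,
    h.proj_counit, hc.counit, hd.counit, TensorProduct.tmul_ite, ite_smul,
    TensorProduct.ite_tmul]

theorem biproductMap_bijective (h : IsCoinvariantModel i π θ ρ E R) :
    Function.Bijective (biproductMap θ i) :=
  Function.bijective_iff_has_inverse.mpr
    ⟨TensorProduct.map ρ π ∘ₗ Coalgebra.comul, LinearMap.congr_fun h.inverse_comp_biproductMap,
      LinearMap.congr_fun h.biproductMap_comp_inverse⟩

theorem isHopfAlgebra_biproduct (h : IsCoinvariantModel i π θ ρ E R) :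
    (biproduct (hopfData k H) E R).IsHopfAlgebra :=
  h.isHopfAlgebraHom_biproductMap.isHopfAlgebra h.inverse_comp_biproductMap
    (hopfData_isHopfAlgebra k A)

end IsCoinvariantModel

end Biproduct

/-! ### Radford's theorem for structure maps given through a retraction -/

section Retract

/-- `θ` identifies `B` with the coinvariants of a Hopf algebra with projection, `e` is a retraction
of `θ`, and the structure maps `E` and `R` are obtained from those of the coinvariants by means of
`e`. -/
structure IsRetractModel {k A H B : Type*} [Field k] [AddCommGroup A] [Module k A]
    [AddCommGroup H] [Module k H] [AddCommGroup B] [Module k B]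
    (D : HopfData k A) (K : HopfData k H) (i : H →ₗ[k] A) (π : A →ₗ[k] H)
    (θ : B →ₗ[k] A) (e : A →ₗ[k] B) (E : YDData k H B) (R : HopfData k B) : Prop where
  retract : ∀ b, e (θ b) = b
  range_theta : LinearMap.range θ = coinvariants D K π
  act_eq : ∀ x b, E.act (x ⊗ₜ b) = e (adjointAction D K i (x ⊗ₜ θ b))
  coact_eq : ∀ b, E.coact b = TensorProduct.map π e (D.comul (θ b))
  mul_eq : ∀ b b', R.mul (b ⊗ₜ b') = e (D.mul (θ b ⊗ₜ θ b'))
  one_eq : R.one = e D.one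
  comul_eq : ∀ b, R.comul b =
    TensorProduct.map (e ∘ₗ coinvariantProj D K i π) e (D.comul (θ b))
  counit_eq : ∀ b, R.counit b = D.counit (θ b)
  antipode_eq : ∀ b, R.antipode b =
    e (D.mul (TensorProduct.map (i ∘ₗ π) D.antipode (D.comul (θ b))))

section Typeclass

variable {k A H B : Type*} [Field k] [Ring A] [HopfAlgebra k A] [Ring H] [HopfAlgebra k H]
  [AddCommGroup B] [Module k B] {i : H →ₗ[k] A} {π : A →ₗ[k] H} {θ : B →ₗ[k] A} {e : A →ₗ[k] B}
  {E : YDData k H B} {R : HopfData k B}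

theorem IsHopfProjection.of_isHopfAlgebraHom
    (hi : IsHopfAlgebraHom (hopfData k H) (hopfData k A) i)
    (hπ : IsHopfAlgebraHom (hopfData k A) (hopfData k H) π) (hπi : π ∘ₗ i = LinearMap.id) :
    IsHopfProjection i π where
  incl_mul := hi.map_mul
  incl_one := hi.map_one
  incl_comul := hi.map_comul
  incl_counit := hi.map_counit
  incl_antipode x := (hi.map_antipode x).symm
  proj_mul := hπ.map_mul
  proj_one := hπ.map_one
  proj_comul := hπ.map_comul
  proj_counit := hπ.map_counit
  proj_antipode := hπ.map_antipode
  proj_incl := LinearMap.congr_fun hπi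

theorem IsRetractModel.theta_of_mem
    (h : IsRetractModel (hopfData k A) (hopfData k H) i π θ e E R)
    {a : A} (ha : a ∈ coinvariants (hopfData k A) (hopfData k H) π) : θ (e a) = a := by
  rw [← h.range_theta] at ha
  obtain ⟨b, rfl⟩ := ha
  rw [h.retract]

/-- Each operation of `A` preserves the coinvariants, where `θ ∘ e` is the identity; hence a formula
defined by `e` becomes an identity for `θ`. The retraction `e` need not vanish on any complement, so
the projection to `B` is `e ∘ Π` rather than `e`. -/
theorem IsHopfProjection.isCoinvariantModel (hp : IsHopfProjection i π)
    (h : IsRetractModel (hopfData k A) (hopfData k H) i π θ e E R) :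
    IsCoinvariantModel i π θ (e ∘ₗ coinvProj i π) E R := by
  have mem (b : B) : θ b ∈ coinvariants (hopfData k A) (hopfData k H) π :=
    h.range_theta ▸ LinearMap.mem_range_self θ b
  have theta_rho (a : A) : θ (e (coinvProj i π a)) = coinvProj i π a :=
    h.theta_of_mem (hp.coinvProj_mem a)
  refine { hp with
    theta_rho := theta_rho
    rho_theta := fun b => ?_
    theta_act := fun x b => ?_
    theta_coact := fun b => ?_
    theta_mul := fun b b' => ?_
    theta_one := ?_
    comul_rho := fun a => ?_
    counit_theta := h.counit_eq
    theta_antipode := fun b => ?_ }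
  · rw [LinearMap.comp_apply, hp.coinvProj_of_mem (mem b), h.retract]
  · rw [h.act_eq]
    apply h.theta_of_mem
    rw [← hp.coinvProj_of_mem (mem b), ← hp.coinvProj_incl_mul]
    exact hp.coinvProj_mem _
  · suffices θ.lTensor H ∘ₗ TensorProduct.map π e ∘ₗ Coalgebra.comul ∘ₗ coinvProj i π =
        π.rTensor A ∘ₗ Coalgebra.comul ∘ₗ coinvProj i π by
      have := LinearMap.congr_fun this (θ b)
      simp only [LinearMap.comp_apply, hp.coinvProj_of_mem (mem b)] at this
      rw [h.coact_eq]
      exact this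
    refine ext_comatrix fun n c hc p q => ?_
    simp only [LinearMap.comp_apply, hp.comul_coinvProj hc, map_sum, TensorProduct.map_tmul,
      LinearMap.lTensor_tmul, LinearMap.rTensor_tmul, theta_rho]
  · rw [h.mul_eq]
    refine h.theta_of_mem ?_
    change θ b * θ b' ∈ _
    rw [← hp.coinvProj_of_mem (mem b'), ← hp.coinvProj_mul_of_mem (mem b)]
    exact hp.coinvProj_mem _
  · rw [h.one_eq]
    refine h.theta_of_mem ?_
    change π.lTensor A (Coalgebra.comul (R := k) (1 : A)) = (1 : A) ⊗ₜ 1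
    simp [Algebra.TensorProduct.one_def, hp.proj_one]
  · suffices R.comul ∘ₗ e ∘ₗ coinvProj i π = TensorProduct.map (e ∘ₗ coinvProj i π)
        (e ∘ₗ coinvProj i π) ∘ₗ Coalgebra.comul from LinearMap.congr_fun this a
    refine ext_comatrix fun n c hc p q => ?_
    -- `Δ(Π(a)) = a₁ i(S(π(a₃))) ⊗ Π(a₂)`; the additional `Π` on the left factor turns `i(S(π(a₃)))`
    -- into a counit.
    rw [LinearMap.comp_apply, LinearMap.comp_apply, h.comul_eq, theta_rho]
    change TensorProduct.map (e ∘ₗ coinvProj i π) e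
      (Coalgebra.comul (R := k) (coinvProj i π (c p q))) = _
    simp only [hp.comul_coinvProj hc, map_sum, TensorProduct.map_tmul, LinearMap.comp_apply,
      hp.coinvProj_mul_incl, hc.comul, HopfAlgebra.counit_antipode, hp.proj_counit, hc.counit]
    simp [ite_smul, TensorProduct.ite_tmul, apply_ite e]
  · rw [h.antipode_eq]
    exact h.theta_of_mem (hp.coinvAntipode_mem (θ b))

theorem IsHopfProjection.radford (hp : IsHopfProjection i π)
    (h : IsRetractModel (hopfData k A) (hopfData k H) i π θ e E R) :
    LinearMap.range (coinvariantProj (hopfData k A) (hopfData k H) i π) = coinvariants (hopfData k A) (hopfData k H) π ∧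
    ((∀ x b, θ (E.act (x ⊗ₜ b)) = adjointAction (hopfData k A) (hopfData k H) i (x ⊗ₜ θ b)) ∧
      (∀ b, θ.lTensor H (E.coact b) = π.rTensor A ((hopfData k A).comul (θ b))) ∧
      (∀ b b', θ (R.mul (b ⊗ₜ b')) = (hopfData k A).mul (θ b ⊗ₜ θ b')) ∧
      θ R.one = (hopfData k A).one ∧
      (∀ b a, θ b = coinvariantProj (hopfData k A) (hopfData k H) i π a →
        TensorProduct.map θ θ (R.comul b) =
          TensorProduct.map (coinvariantProj (hopfData k A) (hopfData k H) i π)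
            (coinvariantProj (hopfData k A) (hopfData k H) i π)
            ((hopfData k A).comul a)) ∧
      (∀ b, R.counit b = (hopfData k A).counit (θ b)) ∧
      (∀ b, θ (R.antipode b) =
        (hopfData k A).mul (TensorProduct.map (i ∘ₗ π) (hopfData k A).antipode ((hopfData k A).comul (θ b))))) ∧
    IsHopfAlgebraInYD (hopfData k H) E R ∧
    (biproduct (hopfData k H) E R).IsHopfAlgebra ∧
    IsHopfAlgebraHom (biproduct (hopfData k H) E R) (hopfData k A) ((hopfData k A).mul ∘ₗ TensorProduct.map θ i) ∧
    Function.Bijective ((hopfData k A).mul ∘ₗ TensorProduct.map θ i) := by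
  have hm := hp.isCoinvariantModel h
  refine ⟨le_antisymm ?_ fun a ha => ⟨a, hp.coinvProj_of_mem ha⟩,
    ⟨hm.theta_act, hm.theta_coact, hm.theta_mul, hm.theta_one, fun b a hb => ?_, hm.counit_theta,
      hm.theta_antipode⟩, hm.isHopfAlgebraInYD, hm.isHopfAlgebra_biproduct,
    hm.isHopfAlgebraHom_biproductMap, hm.biproductMap_bijective⟩
  · rintro _ ⟨a, rfl⟩
    exact hp.coinvProj_mem a
  · have hb' : b = (e ∘ₗ coinvProj i π) a := hm.theta_injective (by rw [hm.theta_rho]; exact hb)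
    have hc : θ ∘ₗ e ∘ₗ coinvProj i π = coinvProj i π := LinearMap.ext hm.theta_rho
    rw [hb', hm.comul_rho, ← LinearMap.comp_apply (TensorProduct.map θ θ),
      ← TensorProduct.map_comp, hc]
    rfl

end Typeclass

variable {k A H B : Type*} [Field k] [AddCommGroup A] [Module k A]
  [AddCommGroup H] [Module k H] [AddCommGroup B] [Module k B]

/-- The ring structure of a Hopf algebra given by its structure maps. -/
abbrev HopfData.IsHopfAlgebra.ring {D : HopfData k A} (hD : D.IsHopfAlgebra) : Ring A :=
  { (inferInstance : AddCommGroup A) with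
    mul := fun x y => D.mul (x ⊗ₜ y)
    one := D.one
    mul_assoc := hD.mul_assoc
    one_mul := hD.one_mul
    mul_one := hD.mul_one
    left_distrib := fun x y z => by
      change D.mul _ = D.mul _ + D.mul _
      rw [TensorProduct.tmul_add, map_add]
    right_distrib := fun x y z => by
      change D.mul _ = D.mul _ + D.mul _
      rw [TensorProduct.add_tmul, map_add]
    zero_mul := fun x => by
      change D.mul _ = 0
      rw [TensorProduct.zero_tmul, map_zero]
    mul_zero := fun x => by
      change D.mul _ = 0
      rw [TensorProduct.tmul_zero, map_zero] }

/-- The algebra structure of a Hopf algebra given by its structure maps. -/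
abbrev HopfData.IsHopfAlgebra.algebra {D : HopfData k A} (hD : D.IsHopfAlgebra) :
    letI := hD.ring; Algebra k A :=
  letI := hD.ring
  Algebra.ofModule (fun r x y => by
      change D.mul _ = r • D.mul _
      rw [← TensorProduct.smul_tmul', map_smul])
    (fun r x y => by
      change D.mul _ = r • D.mul _
      rw [TensorProduct.tmul_smul, map_smul])

/-- The bialgebra structure of a Hopf algebra given by its structure maps. -/
abbrev HopfData.IsHopfAlgebra.hopfAlgebra {D : HopfData k A} (hD : D.IsHopfAlgebra) :
    letI := hD.ring; HopfAlgebra k A :=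
  letI := hD.ring
  letI := hD.algebra
  have hm : LinearMap.mul' k A = D.mul := TensorProduct.ext' fun _ _ => rfl
  letI : Coalgebra k A :=
    { comul := D.comul
      counit := D.counit
      coassoc := LinearMap.ext hD.coassoc
      rTensor_counit_comp_comul := LinearMap.ext hD.counit_left
      lTensor_counit_comp_comul := LinearMap.ext hD.counit_right }
  letI : Bialgebra k A := Bialgebra.mk' k A hD.counit_one (fun {x y} => hD.counit_mul x y)
    hD.comul_one (fun {x y} => by
      refine (hD.comul_mul x y).trans ?_
      change TensorProduct.map D.mul D.mul _ = D.comul x * D.comul y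
      generalize D.comul x = s
      generalize D.comul y = t
      induction s with
      | zero => simp
      | add x y hx hy => simp only [map_add, TensorProduct.add_tmul, add_mul, hx, hy]
      | tmul x y =>
        induction t with
        | zero => simp
        | add x y hx hy => simp only [map_add, TensorProduct.tmul_add, mul_add, hx, hy]
        | tmul z w => simp [middle_tmul]; rfl)
  { antipode := D.antipode
    mul_antipode_rTensor_comul := by
      rw [hm]
      exact LinearMap.ext fun x => (hD.antipode_left x).trans (Algebra.algebraMap_eq_smul_one _).symm
    mul_antipode_lTensor_comul := by
      rw [hm]
      exact LinearMap.ext fun x => (hD.antipode_right x).trans (Algebra.algebraMap_eq_smul_one _).symm }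

/-- This transfers statements about instance-based Hopf algebras back to `D`. The detour is needed
because `U ⊗ V` and `U` already carry other structures than those of the double and of `U^cop`. -/
theorem HopfData.IsHopfAlgebra.hopfData_eq {D : HopfData k A} (hD : D.IsHopfAlgebra) :
    @hopfData k A _ hD.ring hD.hopfAlgebra = D := by
  let _ := hD.ring
  let _ := hD.hopfAlgebra
  have hm : LinearMap.mul' k A = D.mul := TensorProduct.ext' fun _ _ => rfl
  cases D
  simp only [hopfData, HopfData.mk.injEq]
  exact ⟨hm, rfl, rfl, rfl, rfl⟩

/-- Radford's theorem: the coinvariants of a Hopf algebra with projection form a Hopf algebra in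
the category of Yetter-Drinfeld modules, whose biproduct is the given Hopf algebra. -/
theorem IsRetractModel.radford {D : HopfData k A} {K : HopfData k H} {i : H →ₗ[k] A}
    {π : A →ₗ[k] H} {θ : B →ₗ[k] A} {e : A →ₗ[k] B} {E : YDData k H B} {R : HopfData k B}
    (h : IsRetractModel D K i π θ e E R) (hD : D.IsHopfAlgebra) (hK : K.IsHopfAlgebra)
    (hi : IsHopfAlgebraHom K D i) (hπ : IsHopfAlgebraHom D K π) (hπi : π ∘ₗ i = LinearMap.id) :
    LinearMap.range (coinvariantProj D K i π) = coinvariants D K π ∧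
    ((∀ x b, θ (E.act (x ⊗ₜ b)) = adjointAction D K i (x ⊗ₜ θ b)) ∧
      (∀ b, θ.lTensor H (E.coact b) = π.rTensor A (D.comul (θ b))) ∧
      (∀ b b', θ (R.mul (b ⊗ₜ b')) = D.mul (θ b ⊗ₜ θ b')) ∧
      θ R.one = D.one ∧
      (∀ b a, θ b = coinvariantProj D K i π a →
        TensorProduct.map θ θ (R.comul b) =
          TensorProduct.map (coinvariantProj D K i π) (coinvariantProj D K i π)
            (D.comul a)) ∧
      (∀ b, R.counit b = D.counit (θ b)) ∧
      (∀ b, θ (R.antipode b) =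
        D.mul (TensorProduct.map (i ∘ₗ π) D.antipode (D.comul (θ b))))) ∧
    IsHopfAlgebraInYD K E R ∧
    (biproduct K E R).IsHopfAlgebra ∧
    IsHopfAlgebraHom (biproduct K E R) D (D.mul ∘ₗ TensorProduct.map θ i) ∧
    Function.Bijective (D.mul ∘ₗ TensorProduct.map θ i) := by
  -- The instances come from `D` and `K` and are passed by hand; `hopfData_eq` then removes them
  -- from the statements.
  have hp := @IsHopfProjection.of_isHopfAlgebraHom k A H _ hD.ring hD.hopfAlgebra hK.ring
    hK.hopfAlgebra i π
  have hr := @IsHopfProjection.radford k A H B _ hD.ring hD.hopfAlgebra hK.ring hK.hopfAlgebra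
    _ _ i π θ e E R
  rw [hD.hopfData_eq, hK.hopfData_eq] at hp hr
  exact hr (hp hi hπ hπi) h

end Retract

/-! ### The inverse of the antipode -/

section AntipodeInv

open HopfAlgebra (antipode)

variable {k A : Type*} [Field k] [Ring A] [HopfAlgebra k A]
  (hA : Function.Bijective (antipode k : A →ₗ[k] A))

@[simp]
theorem antipode_antipodeInv (x : A) : antipode k (antipodeInv hA x) = x :=
  (LinearEquiv.ofBijective (antipode k : A →ₗ[k] A) hA).apply_symm_apply x

@[simp]
theorem antipodeInv_antipode (x : A) : antipodeInv hA (antipode k x) = x :=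
  (LinearEquiv.ofBijective (antipode k : A →ₗ[k] A) hA).symm_apply_apply x

@[simp]
theorem antipodeInv_one : antipodeInv hA 1 = 1 :=
  hA.1 (by simp)

theorem antipodeInv_mul (x y : A) :
    antipodeInv hA (x * y) = antipodeInv hA y * antipodeInv hA x :=
  hA.1 (by simp [HopfAlgebra.antipode_mul_antidistrib])

@[simp]
theorem counit_antipodeInv (x : A) :
    Coalgebra.counit (R := k) (antipodeInv hA x) = Coalgebra.counit (R := k) x := by
  rw [← HopfAlgebra.counit_antipode (R := k) (antipodeInv hA x), antipode_antipodeInv]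

theorem comul_antipode (x : A) : Coalgebra.comul (R := k) (antipode k x) =
    TensorProduct.map (antipode k) (antipode k)
      (TensorProduct.comm k A A (Coalgebra.comul (R := k) x)) := by
  suffices Coalgebra.comul (R := k) ∘ₗ antipode k = TensorProduct.map (antipode k) (antipode k) ∘ₗ
      (TensorProduct.comm k A A).toLinearMap ∘ₗ Coalgebra.comul from LinearMap.congr_fun this x
  refine ext_comatrix fun n c hc i j => ?_
  simp [hc.comul, hc.comul_antipode]

theorem comul_antipodeInv (x : A) : Coalgebra.comul (R := k) (antipodeInv hA x) =
    TensorProduct.map (antipodeInv hA) (antipodeInv hA)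
      (TensorProduct.comm k A A (Coalgebra.comul (R := k) x)) := by
  obtain ⟨y, rfl⟩ := hA.2 x
  rw [antipodeInv_antipode, comul_antipode]
  induction Coalgebra.comul (R := k) y with
  | zero => simp
  | add s t hs ht => rw [map_add, map_add, map_add, map_add, ← hs, ← ht]
  | tmul s t => simp

variable {ι : Type} [Fintype ι] [DecidableEq ι] {c : ι → ι → A}

theorem IsComatrix.comatrix_antipode (hc : IsComatrix k c) :
    IsComatrix k (fun i j => antipode k (c j i)) where
  comul i j := hc.comul_antipode j i
  counit i j := by simp [hc.counit, eq_comm]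

theorem IsComatrix.comatrix_antipodeInv (hc : IsComatrix k c) :
    IsComatrix k (fun i j => antipodeInv hA (c j i)) where
  comul i j := by simp [comul_antipodeInv, hc.comul]
  counit i j := by simp [hc.counit, eq_comm]

/-- `S⁻¹` applied to the antipode axiom reverses the product: `S⁻¹(x₂) x₁ = ε(x)`. The summed index
joins the factors in the order of the opposite comultiplication. -/
theorem IsComatrix.sum_antipodeInv_mul (hc : IsComatrix k c) (i j : ι) :
    ∑ a, antipodeInv hA (c a j) * c i a = if i = j then 1 else 0 := by
  have := congr_arg (antipodeInv hA) (hc.sum_antipode_mul i j)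
  simp only [map_sum, antipodeInv_mul, antipodeInv_antipode] at this
  rw [this, apply_ite (antipodeInv hA), antipodeInv_one, map_zero]

theorem IsComatrix.sum_mul_antipodeInv (hc : IsComatrix k c) (i j : ι) :
    ∑ a, c a j * antipodeInv hA (c i a) = if i = j then 1 else 0 := by
  have := congr_arg (antipodeInv hA) (hc.sum_mul_antipode i j)
  simp only [map_sum, antipodeInv_mul, antipodeInv_antipode] at this
  rw [this, apply_ite (antipodeInv hA), antipodeInv_one, map_zero]

/-- Lets the comatrix formulas be specialized to the unit element. -/
theorem isComatrix_one : IsComatrix k (fun _ _ : Fin 1 => (1 : A)) where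
  comul i j := by simp [Algebra.TensorProduct.one_def]
  counit i j := by simp [Subsingleton.elim i j]

theorem copData_isHopfAlgebra : (copData hA).IsHopfAlgebra where
  mul_assoc x y z := by simp [copData, mul_assoc]
  one_mul x := by simp [copData]
  mul_one x := by simp [copData]
  coassoc x := by
    suffices (TensorProduct.assoc k A A A).toLinearMap ∘ₗ (copData hA).comul.rTensor A ∘ₗ
        (copData hA).comul = (copData hA).comul.lTensor A ∘ₗ (copData hA).comul from
      LinearMap.congr_fun this x
    refine ext_comatrix fun n c hc i j => ?_
    simp only [copData, LinearMap.comp_apply, hc.comul, map_sum, LinearEquiv.coe_coe,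
      TensorProduct.comm_tmul, LinearMap.rTensor_tmul, LinearMap.lTensor_tmul,
      TensorProduct.sum_tmul, TensorProduct.tmul_sum, TensorProduct.assoc_tmul]
    rw [Finset.sum_comm]
  counit_left x := by
    have := congr_arg (TensorProduct.comm k A k) (Coalgebra.lTensor_counit_comul (R := k) x)
    simp only [copData, LinearMap.comp_apply, LinearEquiv.coe_coe]
    rw [TensorProduct.comm_tmul] at this
    rw [← this]
    induction Coalgebra.comul (R := k) x with
    | zero => simp
    | add s t hs ht => simp only [map_add, hs, ht]
    | tmul s t => simp
  counit_right x := by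
    have := congr_arg (TensorProduct.comm k k A) (Coalgebra.rTensor_counit_comul (R := k) x)
    simp only [copData, LinearMap.comp_apply, LinearEquiv.coe_coe]
    rw [TensorProduct.comm_tmul] at this
    rw [← this]
    induction Coalgebra.comul (R := k) x with
    | zero => simp
    | add s t hs ht => simp only [map_add, hs, ht]
    | tmul s t => simp
  comul_mul x y := by
    simp only [copData, LinearMap.comp_apply, LinearMap.mul'_apply, Bialgebra.comul_mul,
      LinearEquiv.coe_coe]
    generalize Coalgebra.comul (R := k) x = s
    generalize Coalgebra.comul (R := k) y = t
    induction s with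
    | zero => simp
    | add x y hx hy => simp only [map_add, TensorProduct.add_tmul, add_mul, hx, hy]
    | tmul x y =>
      induction t with
      | zero => simp
      | add x y hx hy => simp only [map_add, TensorProduct.tmul_add, mul_add, hx, hy]
      | tmul z w => simp [middle_tmul]
  comul_one := by simp [copData, Algebra.TensorProduct.one_def]
  counit_mul x y := by simp [copData]
  counit_one := by simp [copData]
  antipode_left x := by
    suffices (copData hA).mul ∘ₗ (copData hA).antipode.rTensor A ∘ₗ (copData hA).comul =
        LinearMap.toSpanSingleton k A 1 ∘ₗ Coalgebra.counit from LinearMap.congr_fun this x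
    refine ext_comatrix fun n c hc i j => ?_
    simp [copData, hc.comul, hc.sum_antipodeInv_mul hA, hc.counit]
  antipode_right x := by
    suffices (copData hA).mul ∘ₗ (copData hA).antipode.lTensor A ∘ₗ (copData hA).comul =
        LinearMap.toSpanSingleton k A 1 ∘ₗ Coalgebra.counit from LinearMap.congr_fun this x
    refine ext_comatrix fun n c hc i j => ?_
    simp [copData, hc.comul, hc.sum_mul_antipodeInv hA, hc.counit]

end AntipodeInv

/-! ### Pairings -/

section Pairing

open HopfAlgebra (antipode)

variable {k U V : Type*} [Field k] [Ring U] [HopfAlgebra k U] [Ring V] [HopfAlgebra k V]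
  {p : U →ₗ[k] V →ₗ[k] k}
  (hU : Function.Bijective (antipode k : U →ₗ[k] U))
  (hV : Function.Bijective (antipode k : V →ₗ[k] V))
  {ι κ : Type} [Fintype ι] [DecidableEq ι] [Fintype κ] [DecidableEq κ]
  {x : ι → ι → V} {n : κ → κ → U}

theorem IsPairing.mul_left_comatrix (hp : IsPairing p) (hx : IsComatrix k x) (m m' : U) (i j : ι) :
    p (m * m') (x i j) = ∑ a, p m (x i a) * p m' (x a j) := by
  simp [hp.mul_left, hx.comul]

theorem IsPairing.mul_right_comatrix (hp : IsPairing p) (hn : IsComatrix k n) (y y' : V) (i j : κ) :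
    p (n i j) (y * y') = ∑ a, p (n i a) y * p (n a j) y' := by
  simp [hp.mul_right, hn.comul]

/-- Both sides are convolution inverses of the pairing. On comatrices, they are a left and a right
inverse of the matrix of scalars `p (n i j) (x a b)` indexed by pairs. -/
theorem IsPairing.antipode_left (hp : IsPairing p) (m : U) (y : V) :
    p (antipode k m) y = p m (antipode k y) := by
  suffices p.comp (antipode k) = p.compl₂ (antipode k) from LinearMap.congr_fun₂ this m y
  refine ext_comatrix₂ fun r n hn s x hx i j a b => ?_
  let M : Matrix (Fin r × Fin s) (Fin r × Fin s) k := .of fun u v => p (n u.1 v.1) (x u.2 v.2)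
  let L : Matrix (Fin r × Fin s) (Fin r × Fin s) k := .of fun u v =>
    p (antipode k (n u.1 v.1)) (x u.2 v.2)
  let N : Matrix (Fin r × Fin s) (Fin r × Fin s) k := .of fun u v =>
    p (n u.1 v.1) (antipode k (x u.2 v.2))
  have hL : L * M = 1 := by
    ext u v
    simp only [L, M, Matrix.mul_apply, Matrix.of_apply, Fintype.sum_prod_type,
      ← hp.mul_left_comatrix hx]
    rw [← LinearMap.sum_apply, ← map_sum, hn.sum_antipode_mul, Matrix.one_apply]
    by_cases h : u.1 = v.1 <;> simp [h, hp.one_left, hx.counit, Prod.ext_iff]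
  have hN : M * N = 1 := by
    ext u v
    simp only [N, M, Matrix.mul_apply, Matrix.of_apply, Fintype.sum_prod_type_right,
      ← hp.mul_right_comatrix hn]
    rw [← map_sum, hx.sum_mul_antipode, Matrix.one_apply]
    by_cases h : u.2 = v.2 <;> simp [h, hp.one_right, hn.counit, Prod.ext_iff]
  have h : L = N := left_inv_eq_right_inv hL hN
  exact congr_fun₂ h (i, a) (j, b)

theorem IsPairing.antipodeInv_left (hp : IsPairing p) (m : U) (y : V) :
    p (antipodeInv hU m) y = p m (antipodeInv hV y) := by
  conv_lhs => rw [← antipode_antipodeInv hV y]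
  rw [← hp.antipode_left, antipode_antipodeInv]

/-- `⟨S⁻¹(n₂), x₁⟩ ⟨n₁, x₂⟩ = ⟨S⁻¹(n₂) n₁, x⟩ = ε(n) ε(x)`: the cancellation between neighbouring
exchange factors. -/
theorem IsPairing.sum_antipodeInv_mul (hp : IsPairing p) (hx : IsComatrix k x)
    (hn : IsComatrix k n) (i j : ι) (a b : κ) :
    ∑ u, ∑ v, p (antipodeInv hU (n v b)) (x i u) * p (n a v) (x u j) =
      if a = b then if i = j then 1 else 0 else 0 := by
  rw [Finset.sum_comm]
  simp only [← hp.mul_left_comatrix hx]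
  rw [← LinearMap.sum_apply, ← map_sum, hn.sum_antipodeInv_mul]
  split_ifs with h <;> simp_all [hp.one_left, hx.counit]

theorem IsPairing.sum_mul_antipodeInv (hp : IsPairing p) (hx : IsComatrix k x)
    (hn : IsComatrix k n) (i j : ι) (a b : κ) :
    ∑ u, ∑ v, p (n v b) (x i u) * p (antipodeInv hU (n a v)) (x u j) =
      if a = b then if i = j then 1 else 0 else 0 := by
  rw [Finset.sum_comm]
  simp only [← hp.mul_left_comatrix hx]
  rw [← LinearMap.sum_apply, ← map_sum, hn.sum_mul_antipodeInv]
  split_ifs with h <;> simp_all [hp.one_left, hx.counit]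

variable (p) in
theorem exchange_comatrix (hx : IsComatrix k x) (hn : IsComatrix k n) (i j : ι) (a b : κ) :
    exchange p hU (x i j ⊗ₜ n a b) = ∑ i', ∑ j', ∑ a', ∑ b',
      (p (n b' b) (x i i') * p (antipodeInv hU (n a a')) (x j' j)) • (n a' b' ⊗ₜ[k] x i' j') := by
  simp only [exchange, TensorProduct.lift.tmul, sweedler₂, LinearMap.comp_apply, hx.sweedler_succ,
    sweedler_zero, map_sum, LinearMap.sum_apply, hn.sweedler_succ]
  rfl

end Pairing

/-! ### The generalized quantum double -/

section DoubleHopf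

open HopfAlgebra (antipode)

variable {k U V : Type*} [Field k] [Ring U] [HopfAlgebra k U] [Ring V] [HopfAlgebra k V]
  {p : U →ₗ[k] V →ₗ[k] k}
  {hU : Function.Bijective (antipode k : U →ₗ[k] U)}
  {hV : Function.Bijective (antipode k : V →ₗ[k] V)}

theorem exchange_one_left (hp : IsPairing p) (n : U) :
    exchange p hU (1 ⊗ₜ n) = n ⊗ₜ 1 := by
  suffices exchange p hU ∘ₗ TensorProduct.mk k V U 1 = (TensorProduct.mk k U V).flip 1 from
    LinearMap.congr_fun this n
  refine ext_comatrix fun m n hn a b => ?_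
  have := exchange_comatrix p hU (isComatrix_one (k := k) (A := V)) hn 0 0 a b
  simpa [hp.one_right, hn.counit] using this

theorem exchange_one_right (hp : IsPairing p) (x : V) :
    exchange p hU (x ⊗ₜ 1) = 1 ⊗ₜ x := by
  suffices exchange p hU ∘ₗ (TensorProduct.mk k V U).flip 1 = TensorProduct.mk k U V 1 from
    LinearMap.congr_fun this x
  refine ext_comatrix fun m x hx i j => ?_
  have := exchange_comatrix p hU hx (isComatrix_one (k := k) (A := U)) i j 0 0
  simpa [hp.one_left, hx.counit] using this

/-- Multiplication by `m` on the left factor and by `y` on the right factor. -/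
def sandwich (m : U) (y : V) : U ⊗[k] V →ₗ[k] U ⊗[k] V :=
  TensorProduct.map (LinearMap.mulLeft k m) (LinearMap.mulRight k y)

@[simp]
theorem sandwich_tmul (m n : U) (x y : V) :
    sandwich (k := k) m y (n ⊗ₜ x) = (m * n) ⊗ₜ (x * y) := rfl

theorem sandwich_sandwich (m m' : U) (y y' : V) (t : U ⊗[k] V) :
    sandwich m y (sandwich m' y' t) = sandwich (m * m') (y' * y) t := by
  induction t with
  | zero => simp
  | add s t hs ht => simp only [map_add, hs, ht]
  | tmul n x => simp [mul_assoc]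

theorem sandwich_one (t : U ⊗[k] V) : sandwich 1 1 t = t := by
  induction t with
  | zero => simp
  | add s t hs ht => simp only [map_add, hs, ht]
  | tmul n x => simp

theorem double_mul_tmul (m n : U) (x y : V) :
    (double p hU hV).mul ((m ⊗ₜ x) ⊗ₜ (n ⊗ₜ y)) = sandwich m y (exchange p hU (x ⊗ₜ n)) := by
  simp only [double, LinearMap.comp_apply, middle_tmul]
  induction exchange p hU (x ⊗ₜ n) with
  | zero => simp
  | add s t hs ht =>
    simp only [map_add, TensorProduct.add_tmul, TensorProduct.tmul_add, hs, ht]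
  | tmul s t => simp

/-- The product of the double is left `U`-linear and right `V`-linear, so it is controlled by
`exchange` alone. -/
theorem double_mul_sandwich (m : U) (y : V) (s t : U ⊗[k] V) :
    (double p hU hV).mul (sandwich m 1 s ⊗ₜ sandwich 1 y t) =
      sandwich m y ((double p hU hV).mul (s ⊗ₜ t)) := by
  induction s with
  | zero => simp
  | add s s' hs hs' => simp only [map_add, TensorProduct.add_tmul, hs, hs']
  | tmul n x =>
    induction t with
    | zero => simp
    | add s s' hs hs' => simp only [map_add, TensorProduct.tmul_add, hs, hs']
    | tmul n' x' => simp [double_mul_tmul, sandwich_sandwich]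

/-- Moving `x y` past `n` amounts to moving `y` and then `x`. Pairing with a product in `V`
comultiplies the argument in `U`, so both sides are the same sum over eight indices, up to renaming.
-/
theorem exchange_mul_left (hp : IsPairing p) (x y : V) (n : U) :
    exchange p hU ((x * y) ⊗ₜ n) =
      (double p hU hV).mul ((1 ⊗ₜ x) ⊗ₜ exchange p hU (y ⊗ₜ n)) := by
  suffices ∀ n, ((LinearMap.mul k V).compr₂ (exchange p hU ∘ₗ (TensorProduct.mk k V U).flip n)) =
      ((TensorProduct.mk k (U ⊗[k] V) (U ⊗[k] V)).compl₁₂ (TensorProduct.mk k U V 1)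
        (exchange p hU ∘ₗ (TensorProduct.mk k V U).flip n)).compr₂ (double p hU hV).mul from
    LinearMap.congr_fun₂ (this n) x y
  intro n
  refine ext_comatrix₂ fun r x hx s y hy i j k' l => ?_
  suffices exchange p hU ∘ₗ TensorProduct.mk k V U (x i j * y k' l) =
      (double p hU hV).mul ∘ₗ TensorProduct.mk k (U ⊗[k] V) (U ⊗[k] V) (1 ⊗ₜ x i j) ∘ₗ
        exchange p hU ∘ₗ TensorProduct.mk k V U (y k' l) from LinearMap.congr_fun this n
  refine ext_comatrix fun t n hn a b => ?_
  have e := exchange_comatrix p hU (hx.mul hy) hn (i, k') (j, l) a b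
  -- `S⁻¹` reverses the comultiplication, so `⟨S⁻¹(n), y y'⟩ = ⟨S⁻¹(n₂), y⟩ ⟨S⁻¹(n₁), y'⟩`.
  have e' (u v) (y y' : V) : p (antipodeInv hU (n u v)) (y * y') =
      ∑ w, p (antipodeInv hU (n w v)) y * p (antipodeInv hU (n u w)) y' :=
    hp.mul_right_comatrix (hn.comatrix_antipodeInv hU) y y' v u
  simp only [Fintype.sum_prod_type, hp.mul_right_comatrix hn, e', Finset.sum_mul_sum,
    Finset.sum_smul] at e
  simp only [LinearMap.comp_apply, TensorProduct.mk_apply, e, exchange_comatrix p hU hy hn,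
    map_sum, map_smul, double_mul_tmul,
    exchange_comatrix p hU hx hn, sandwich_tmul, one_mul, Finset.smul_sum, smul_smul]
  simp only [← Fintype.sum_prod_type']
  refine Fintype.sum_equiv ⟨fun ⟨l₁, l₂, l₃, l₄, l₅, l₆, l₇, l₈⟩ => ⟨l₂, l₄, l₈, l₇, l₁, l₃, l₅, l₆⟩,
    fun ⟨l₂, l₄, l₈, l₇, l₁, l₃, l₅, l₆⟩ => ⟨l₁, l₂, l₃, l₄, l₅, l₆, l₇, l₈⟩,
    fun _ => rfl, fun _ => rfl⟩ _ _ fun _ => ?_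
  simp only [Equiv.coe_fn_mk]
  congr 1
  ring

theorem exchange_mul_right (hp : IsPairing p) (x : V) (m n : U) :
    exchange p hU (x ⊗ₜ (m * n)) =
      (double p hU hV).mul (exchange p hU (x ⊗ₜ m) ⊗ₜ (n ⊗ₜ 1)) := by
  suffices ∀ x, ((LinearMap.mul k U).compr₂ (exchange p hU ∘ₗ TensorProduct.mk k V U x)) =
      ((TensorProduct.mk k (U ⊗[k] V) (U ⊗[k] V)).compl₁₂ (exchange p hU ∘ₗ
        TensorProduct.mk k V U x) ((TensorProduct.mk k U V).flip 1)).compr₂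
          (double p hU hV).mul from
    LinearMap.congr_fun₂ (this x) m n
  intro x
  refine ext_comatrix₂ fun r m hm s n hn a b c d => ?_
  suffices exchange p hU ∘ₗ (TensorProduct.mk k V U).flip (m a b * n c d) =
      (double p hU hV).mul ∘ₗ (TensorProduct.mk k (U ⊗[k] V) (U ⊗[k] V)).flip (n c d ⊗ₜ 1) ∘ₗ
        exchange p hU ∘ₗ (TensorProduct.mk k V U).flip (m a b) from LinearMap.congr_fun this x
  refine ext_comatrix fun t x hx i j => ?_
  have e := exchange_comatrix p hU hx (hm.mul hn) i j (a, c) (b, d)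
  simp only [Fintype.sum_prod_type, antipodeInv_mul, hp.mul_left_comatrix hx, Finset.sum_mul_sum,
    Finset.sum_smul] at e
  simp only [LinearMap.comp_apply, LinearMap.flip_apply, TensorProduct.mk_apply, e,
    exchange_comatrix p hU hx hm, map_sum,
    map_smul, double_mul_tmul, exchange_comatrix p hU hx hn, sandwich_tmul, mul_one,
    Finset.smul_sum, smul_smul]
  simp only [← Fintype.sum_prod_type']
  refine Fintype.sum_equiv ⟨fun ⟨l₁, l₂, l₃, l₄, l₅, l₆, l₇, l₈⟩ => ⟨l₇, l₈, l₃, l₅, l₁, l₂, l₄, l₆⟩,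
    fun ⟨l₇, l₈, l₃, l₅, l₁, l₂, l₄, l₆⟩ => ⟨l₁, l₂, l₃, l₄, l₅, l₆, l₇, l₈⟩,
    fun _ => rfl, fun _ => rfl⟩ _ _ fun _ => ?_
  simp only [Equiv.coe_fn_mk]
  congr 1
  ring

theorem double_mul_assoc (hp : IsPairing p) (s t w : U ⊗[k] V) :
    (double p hU hV).mul ((double p hU hV).mul (s ⊗ₜ t) ⊗ₜ w) =
      (double p hU hV).mul (s ⊗ₜ (double p hU hV).mul (t ⊗ₜ w)) := by
  induction s with
  | zero => simp
  | add s s' hs hs' => simp only [map_add, TensorProduct.add_tmul, hs, hs']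
  | tmul m x =>
  induction t with
  | zero => simp
  | add s s' hs hs' => simp only [map_add, TensorProduct.tmul_add, TensorProduct.add_tmul, hs, hs']
  | tmul n y =>
  induction w with
  | zero => simp
  | add s s' hs hs' => simp only [map_add, TensorProduct.tmul_add, hs, hs']
  | tmul l z =>
  -- `hA` reads `(s y) l = s (y l)` and `hB` reads `x (n t) = (x n) t`. Both bracketings of the
  -- triple product thereby reduce to `m ((x n)(y l)) z`.
  have hA (s : U ⊗[k] V) : (double p hU hV).mul (sandwich 1 y s ⊗ₜ (l ⊗ₜ 1)) =
      (double p hU hV).mul (s ⊗ₜ exchange p hU (y ⊗ₜ l)) := by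
    induction s with
    | zero => simp
    | add s s' hs hs' => simp only [map_add, TensorProduct.add_tmul, hs, hs']
    | tmul n' x' =>
      have := double_mul_sandwich (p := p) (hU := hU) (hV := hV) n' 1 (1 ⊗ₜ x')
        (exchange p hU (y ⊗ₜ l))
      rw [sandwich_one, sandwich_tmul, mul_one, mul_one, ← exchange_mul_left hp] at this
      rw [this, sandwich_tmul, one_mul, double_mul_tmul]
  have hB (t : U ⊗[k] V) : (double p hU hV).mul ((1 ⊗ₜ x) ⊗ₜ sandwich n 1 t) =
      (double p hU hV).mul (exchange p hU (x ⊗ₜ n) ⊗ₜ t) := by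
    induction t with
    | zero => simp
    | add s s' hs hs' => simp only [map_add, TensorProduct.tmul_add, hs, hs']
    | tmul l' y' =>
      have := double_mul_sandwich (p := p) (hU := hU) (hV := hV) 1 y'
        (exchange p hU (x ⊗ₜ n)) (l' ⊗ₜ 1)
      rw [sandwich_one, sandwich_tmul, one_mul, one_mul, ← exchange_mul_right hp] at this
      rw [this, sandwich_tmul, mul_one, double_mul_tmul]
  have h₁ := double_mul_sandwich (p := p) (hU := hU) (hV := hV) m z
    (sandwich 1 y (exchange p hU (x ⊗ₜ n))) (l ⊗ₜ 1)
  have h₂ := double_mul_sandwich (p := p) (hU := hU) (hV := hV) m z (1 ⊗ₜ x)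
    (sandwich n 1 (exchange p hU (y ⊗ₜ l)))
  rw [hA, sandwich_sandwich, sandwich_tmul, mul_one, mul_one, one_mul, one_mul] at h₁
  rw [hB, sandwich_sandwich, sandwich_tmul, mul_one, mul_one, one_mul, one_mul] at h₂
  rw [double_mul_tmul, double_mul_tmul, h₁, h₂]

end DoubleHopf

/-! ### Testing identities on tensor products of coalgebras -/

section Ext

variable {k A B C D W : Type*} [Field k] [AddCommGroup A] [Module k A] [Coalgebra k A]
  [AddCommGroup B] [Module k B] [Coalgebra k B] [AddCommGroup C] [Module k C] [Coalgebra k C]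
  [AddCommGroup D] [Module k D] [Coalgebra k D] [AddCommGroup W] [Module k W]

theorem ext_comatrix_tmul {F G : A ⊗[k] B →ₗ[k] W}
    (h : ∀ (n : ℕ) (c : Fin n → Fin n → A), IsComatrix k c →
      ∀ (m : ℕ) (d : Fin m → Fin m → B), IsComatrix k d →
      ∀ i j a b, F (c i j ⊗ₜ d a b) = G (c i j ⊗ₜ d a b)) : F = G :=
  TensorProduct.ext (ext_comatrix₂ h)

theorem ext_comatrix_tmul₄ {F G : (A ⊗[k] B) ⊗[k] (C ⊗[k] D) →ₗ[k] W}
    (h : ∀ (n : ℕ) (c : Fin n → Fin n → A), IsComatrix k c →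
      ∀ (m : ℕ) (d : Fin m → Fin m → B), IsComatrix k d →
      ∀ (n' : ℕ) (c' : Fin n' → Fin n' → C), IsComatrix k c' →
      ∀ (m' : ℕ) (d' : Fin m' → Fin m' → D), IsComatrix k d' →
      ∀ i j a b i' j' a' b', F ((c i j ⊗ₜ d a b) ⊗ₜ (c' i' j' ⊗ₜ d' a' b')) =
        G ((c i j ⊗ₜ d a b) ⊗ₜ (c' i' j' ⊗ₜ d' a' b'))) : F = G :=
  TensorProduct.ext <| ext_comatrix_tmul fun n c hc m d hd i j a b =>
    ext_comatrix_tmul fun n' c' hc' m' d' hd' i' j' a' b' =>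
      h n c hc m d hd n' c' hc' m' d' hd' i j a b i' j' a' b'

end Ext

/-! ### Comultiplication, counit and antipode of the double -/

section DoubleHopf

open HopfAlgebra (antipode)

variable {k U V : Type*} [Field k] [Ring U] [HopfAlgebra k U] [Ring V] [HopfAlgebra k V]
  {p : U →ₗ[k] V →ₗ[k] k}
  {hU : Function.Bijective (antipode k : U →ₗ[k] U)}
  {hV : Function.Bijective (antipode k : V →ₗ[k] V)}
  {ι κ : Type} [Fintype ι] [DecidableEq ι] [Fintype κ] [DecidableEq κ]
  {ι' κ' : Type} [Fintype ι'] [DecidableEq ι'] [Fintype κ'] [DecidableEq κ']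
  {x : ι → ι → V} {n : κ → κ → U}  {y : ι' → ι' → V} {m : κ' → κ' → U}

variable (p hU hV) in
theorem double_comul_comatrix (hn : IsComatrix k n) (hx : IsComatrix k x) (a b : κ) (i j : ι) :
    (double p hU hV).comul (n a b ⊗ₜ x i j) =
      ∑ u, ∑ g, (n u b ⊗ₜ[k] x i g) ⊗ₜ[k] (n a u ⊗ₜ[k] x g j) := by
  simp only [double, copData, hopfData, LinearMap.comp_apply, TensorProduct.map_tmul, hn.comul,
    hx.comul, LinearEquiv.coe_coe, map_sum, TensorProduct.comm_tmul, TensorProduct.sum_tmul,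
    TensorProduct.tmul_sum, middle_tmul, TensorProduct.assoc_tmul, TensorProduct.assoc_symm_tmul]
  rw [Finset.sum_comm]

/-- `exchange` is a coalgebra map from `V ⊗ U^cop` to `U^cop ⊗ V`. On the right side, the last
pairing of the first factor and the first pairing of the second cancel by
`IsPairing.sum_antipodeInv_mul`. -/
theorem double_comul_exchange (hp : IsPairing p) (hx : IsComatrix k x) (hn : IsComatrix k n)
    (i j : ι) (a b : κ) :
    (double p hU hV).comul (exchange p hU (x i j ⊗ₜ n a b)) =
      ∑ g, ∑ u, exchange p hU (x i g ⊗ₜ n u b) ⊗ₜ[k] exchange p hU (x g j ⊗ₜ n a u) := by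
  simp only [exchange_comatrix p hU hx hn, map_sum, map_smul,
    double_comul_comatrix p hU hV hn hx, TensorProduct.sum_tmul, TensorProduct.tmul_sum,
    ← TensorProduct.smul_tmul', TensorProduct.tmul_smul, smul_smul, Finset.smul_sum]
  -- `l₁` and `l₂` are the indices `g` and `u` that join the two exchange factors; they go
  -- innermost, where the cancelling pairings are summed.
  have perm (f : ι → κ → ι → ι → κ → κ → ι → ι → κ → κ → (U ⊗[k] V) ⊗[k] (U ⊗[k] V)) :
      ∑ l₁, ∑ l₂, ∑ l₃, ∑ l₄, ∑ l₅, ∑ l₆, ∑ l₇, ∑ l₈, ∑ l₉, ∑ l₁₀,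
        f l₁ l₂ l₃ l₄ l₅ l₆ l₇ l₈ l₉ l₁₀ =
      ∑ l₇, ∑ l₄, ∑ l₅, ∑ l₁₀, ∑ l₉, ∑ l₈, ∑ l₆, ∑ l₃, ∑ l₁, ∑ l₂,
        f l₁ l₂ l₃ l₄ l₅ l₆ l₇ l₈ l₉ l₁₀ := by
    simp only [← Fintype.sum_prod_type']
    exact Fintype.sum_equiv ⟨fun ⟨l₁, l₂, l₃, l₄, l₅, l₆, l₇, l₈, l₉, l₁₀⟩ =>
        ⟨l₇, l₄, l₅, l₁₀, l₉, l₈, l₆, l₃, l₁, l₂⟩,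
      fun ⟨l₇, l₄, l₅, l₁₀, l₉, l₈, l₆, l₃, l₁, l₂⟩ => ⟨l₁, l₂, l₃, l₄, l₅, l₆, l₇, l₈, l₉, l₁₀⟩,
      fun _ => rfl, fun _ => rfl⟩ _ _ fun _ => rfl
  rw [perm]
  have e (α β : k) (l₃ l₈ : ι) (l₆ l₉ : κ) : ∑ l₁, ∑ l₂, p (n l₆ l₂) (x l₁ l₃) * β *
      (α * p (antipodeInv hU (n l₂ l₉)) (x l₈ l₁)) =
      if l₆ = l₉ then if l₈ = l₃ then α * β else 0 else 0 := by
    have := congr_arg (α * β * ·) (hp.sum_antipodeInv_mul hU hx hn l₈ l₃ l₆ l₉)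
    simp only [Finset.mul_sum, mul_ite, mul_one, mul_zero] at this
    rw [← this]
    refine Finset.sum_congr rfl fun _ _ => Finset.sum_congr rfl fun _ _ => ?_
    ring
  simp only [← Finset.sum_smul, e]
  simp [ite_smul]

theorem double_comul_sandwich (hm : IsComatrix k m) (hy : IsComatrix k y) (a b : κ') (i j : ι')
    (t : U ⊗[k] V) :
    (double p hU hV).comul (sandwich (m a b) (y i j) t) =
      ∑ u, ∑ g, TensorProduct.map (sandwich (m u b) (y i g)) (sandwich (m a u) (y g j))
        ((double p hU hV).comul t) := by
  suffices (double p hU hV).comul ∘ₗ sandwich (m a b) (y i j) =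
      (∑ u, ∑ g, TensorProduct.map (sandwich (m u b) (y i g)) (sandwich (m a u) (y g j))) ∘ₗ
        (double p hU hV).comul by
    simpa [LinearMap.sum_apply] using LinearMap.congr_fun this t
  refine ext_comatrix_tmul fun r n hn s x hx a' b' i' j' => ?_
  have e := double_comul_comatrix p hU hV (hm.mul hn) (hx.mul hy) (a, a') (b, b') (i', i) (j', j)
  simp only [Fintype.sum_prod_type] at e
  simp only [LinearMap.comp_apply, sandwich_tmul, e, LinearMap.sum_apply,
    double_comul_comatrix p hU hV hn hx, map_sum, TensorProduct.map_tmul]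
  rw [sum_rotate₃]

theorem double_comul_mul (hp : IsPairing p) (s t : U ⊗[k] V) :
    (double p hU hV).comul ((double p hU hV).mul (s ⊗ₜ t)) =
      TensorProduct.map (double p hU hV).mul (double p hU hV).mul
        (middle (TensorProduct.comm k _ _).toLinearMap
          ((double p hU hV).comul s ⊗ₜ (double p hU hV).comul t)) := by
  suffices (double p hU hV).comul ∘ₗ (double p hU hV).mul =
      TensorProduct.map (double p hU hV).mul (double p hU hV).mul ∘ₗ
        middle (TensorProduct.comm k _ _).toLinearMap ∘ₗ
          TensorProduct.map (double p hU hV).comul (double p hU hV).comul from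
    LinearMap.congr_fun this (s ⊗ₜ t)
  refine ext_comatrix_tmul₄ fun r m hm s x hx r' n hn s' y hy a b i j a' b' i' j' => ?_
  simp only [LinearMap.comp_apply, TensorProduct.map_tmul, double_mul_tmul,
    double_comul_sandwich hm hy, double_comul_exchange hp hx hn, map_sum,
    double_comul_comatrix p hU hV hm hx, double_comul_comatrix p hU hV hn hy,
    TensorProduct.sum_tmul, TensorProduct.tmul_sum, middle_tmul, LinearEquiv.coe_coe,
    TensorProduct.comm_tmul, TensorProduct.assoc_tmul, TensorProduct.assoc_symm_tmul]
  exact sum_perm₄ _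

theorem double_counit_tmul (m : U) (x : V) : (double p hU hV).counit (m ⊗ₜ x) =
    Coalgebra.counit (R := k) m * Coalgebra.counit (R := k) x := rfl

theorem double_counit_exchange (hp : IsPairing p) (x : V) (n : U) :
    (double p hU hV).counit (exchange p hU (x ⊗ₜ n)) =
      Coalgebra.counit (R := k) x * Coalgebra.counit (R := k) n := by
  suffices (double p hU hV).counit ∘ₗ exchange p hU =
      LinearMap.mul' k k ∘ₗ TensorProduct.map Coalgebra.counit Coalgebra.counit from
    LinearMap.congr_fun this (x ⊗ₜ n)
  refine ext_comatrix_tmul fun s x hx r n hn i j a b => ?_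
  simp only [LinearMap.comp_apply, exchange_comatrix p hU hx hn, map_sum, map_smul,
    double_counit_tmul, hn.counit, hx.counit, TensorProduct.map_tmul, LinearMap.mul'_apply]
  simp only [smul_eq_mul, mul_ite, mul_one, mul_zero, Finset.sum_ite_eq,
    Finset.mem_univ, if_true, Finset.sum_ite_irrel, Finset.sum_const_zero,
    hp.sum_mul_antipodeInv hU hx hn]

/-- As an antipode reverses products, that of `m ⊗ x = m x` must be `S(x) S⁻¹(m)`. The stated
coefficients result from `⟨S⁻¹(m), S(x)⟩ = ⟨m, x⟩` and from moving `S⁻¹` across the pairing. -/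
theorem double_antipode_tmul (hp : IsPairing p) (m : U) (x : V) :
    (double p hU hV).antipode (m ⊗ₜ x) =
      exchange p hU (antipode k x ⊗ₜ antipodeInv hU m) := by
  suffices (double p hU hV).antipode = exchange p hU ∘ₗ
      TensorProduct.map (antipode k) (antipodeInv hU) ∘ₗ (TensorProduct.comm k U V).toLinearMap from
    LinearMap.congr_fun this (m ⊗ₜ x)
  refine ext_comatrix_tmul fun r m hm s x hx a b i j => ?_
  have e := exchange_comatrix p hU hx.comatrix_antipode (hm.comatrix_antipodeInv hU) j i b a
  have e' (m : U) (x : V) : p (antipodeInv hU m) (antipode k x) = p m x := by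
    rw [← hp.antipode_left, antipode_antipodeInv]
  have e'' : (double p hU hV).antipode (m a b ⊗ₜ x i j) = ∑ a', ∑ b', ∑ i', ∑ j',
      (p (m a a') (x j' j) * p (m b' b) (antipodeInv hV (x i i'))) •
        (antipodeInv hU (m a' b') ⊗ₜ[k] antipode k (x i' j')) := by
    simp only [double, TensorProduct.lift.tmul, sweedler₂, LinearMap.comp_apply, hx.sweedler_succ,
      sweedler_zero, map_sum, LinearMap.sum_apply, hm.sweedler_succ]
    rfl
  simp only [e', hp.antipodeInv_left hU hV] at e
  simp only [LinearMap.comp_apply, LinearEquiv.coe_coe, TensorProduct.comm_tmul,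
    TensorProduct.map_tmul, e, e'']
  exact sum_reverse₄ _

theorem double_isHopfAlgebra (hp : IsPairing p) : (double p hU hV).IsHopfAlgebra where
  mul_assoc := double_mul_assoc hp
  one_mul t := by
    change (double p hU hV).mul ((1 ⊗ₜ 1) ⊗ₜ t) = t
    induction t with
    | zero => simp
    | add s t hs ht => simp only [TensorProduct.tmul_add, map_add, hs, ht]
    | tmul n y => simp [double_mul_tmul, exchange_one_left hp]
  mul_one t := by
    change (double p hU hV).mul (t ⊗ₜ (1 ⊗ₜ 1)) = t
    induction t with
    | zero => simp
    | add s t hs ht => simp only [TensorProduct.add_tmul, map_add, hs, ht]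
    | tmul n y => simp [double_mul_tmul, exchange_one_right hp]
  coassoc t := by
    suffices (TensorProduct.assoc k _ _ _).toLinearMap ∘ₗ (double p hU hV).comul.rTensor _ ∘ₗ
        (double p hU hV).comul = (double p hU hV).comul.lTensor _ ∘ₗ (double p hU hV).comul from
      LinearMap.congr_fun this t
    refine ext_comatrix_tmul fun r n hn s x hx a b i j => ?_
    simp only [LinearMap.comp_apply, double_comul_comatrix p hU hV hn hx, map_sum,
      LinearMap.rTensor_tmul, LinearMap.lTensor_tmul, TensorProduct.sum_tmul,
      TensorProduct.tmul_sum, LinearEquiv.coe_coe, TensorProduct.assoc_tmul]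
    rw [sum_rotate₄, sum_rotate₄]
  counit_left t := by
    suffices (double p hU hV).counit.rTensor _ ∘ₗ (double p hU hV).comul =
        TensorProduct.mk k k _ 1 from LinearMap.congr_fun this t
    refine ext_comatrix_tmul fun r n hn s x hx a b i j => ?_
    simp [double_comul_comatrix p hU hV hn hx, double_counit_tmul, hn.counit, hx.counit,
      TensorProduct.ite_tmul]
  counit_right t := by
    suffices (double p hU hV).counit.lTensor _ ∘ₗ (double p hU hV).comul =
        (TensorProduct.mk k _ k).flip 1 from LinearMap.congr_fun this t
    refine ext_comatrix_tmul fun r n hn s x hx a b i j => ?_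
    simp [double_comul_comatrix p hU hV hn hx, double_counit_tmul, hn.counit, hx.counit,
      TensorProduct.tmul_ite]
  comul_mul := double_comul_mul hp
  comul_one := by
    simp [double, copData, hopfData, Algebra.TensorProduct.one_def, middle_tmul]
  counit_mul s t := by
    induction s with
    | zero => simp
    | add s s' hs hs' => simp only [map_add, TensorProduct.add_tmul, add_mul, hs, hs']
    | tmul m x =>
      induction t with
      | zero => simp
      | add s s' hs hs' => simp only [map_add, TensorProduct.tmul_add, mul_add, hs, hs']
      | tmul n y =>
        have e (t : U ⊗[k] V) : (double p hU hV).counit (sandwich m y t) =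
            Coalgebra.counit (R := k) m * Coalgebra.counit (R := k) y *
              (double p hU hV).counit t := by
          induction t with
          | zero => simp
          | add s s' hs hs' => simp only [map_add, mul_add, hs, hs']
          | tmul n' x' =>
            simp only [sandwich_tmul, double_counit_tmul, Bialgebra.counit_mul]
            ring
        rw [double_mul_tmul, e, double_counit_exchange hp, double_counit_tmul, double_counit_tmul]
        ring
  counit_one := by simp [double]
  antipode_left t := by
    suffices (double p hU hV).mul ∘ₗ (double p hU hV).antipode.rTensor _ ∘ₗ
        (double p hU hV).comul = LinearMap.toSpanSingleton k _ (1 ⊗ₜ 1) ∘ₗ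
          (double p hU hV).counit from LinearMap.congr_fun this t
    refine ext_comatrix_tmul fun r n hn s x hx a b i j => ?_
    -- `(y m)(m' z) = (y (m m')) z`: the factors `S⁻¹(m₂) m₁` become adjacent and cancel first,
    -- after which `S(x₁) x₂` cancels.
    have e (y z : V) (m m' : U) : (double p hU hV).mul (exchange p hU (y ⊗ₜ m) ⊗ₜ (m' ⊗ₜ z)) =
        sandwich 1 z (exchange p hU (y ⊗ₜ (m * m'))) := by
      have := double_mul_sandwich (p := p) (hU := hU) (hV := hV) 1 z
        (exchange p hU (y ⊗ₜ m)) (m' ⊗ₜ 1)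
      rw [exchange_mul_right (hV := hV) hp, ← this, sandwich_one, sandwich_tmul, one_mul, one_mul]
    simp only [LinearMap.comp_apply, double_comul_comatrix p hU hV hn hx, map_sum,
      LinearMap.rTensor_tmul, double_antipode_tmul hp, e, double_counit_tmul, hn.counit, hx.counit]
    rw [Finset.sum_comm]
    simp only [← map_sum, ← TensorProduct.tmul_sum, hn.sum_antipodeInv_mul]
    by_cases h : a = b
    · simp only [h, if_true, exchange_one_right hp, sandwich_tmul, mul_one,
        ← TensorProduct.tmul_sum, hx.sum_antipode_mul]
      split_ifs <;> simp
    · simp [h]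
  antipode_right t := by
    suffices (double p hU hV).mul ∘ₗ (double p hU hV).antipode.lTensor _ ∘ₗ
        (double p hU hV).comul = LinearMap.toSpanSingleton k _ (1 ⊗ₜ 1) ∘ₗ
          (double p hU hV).counit from LinearMap.congr_fun this t
    refine ext_comatrix_tmul fun r n hn s x hx a b i j => ?_
    have e (y z : V) (m m' : U) : (double p hU hV).mul ((m ⊗ₜ y) ⊗ₜ exchange p hU (z ⊗ₜ m')) =
        sandwich m 1 (exchange p hU ((y * z) ⊗ₜ m')) := by
      have := double_mul_sandwich (p := p) (hU := hU) (hV := hV) m 1 (1 ⊗ₜ y)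
        (exchange p hU (z ⊗ₜ m'))
      rw [exchange_mul_left (hV := hV) hp, ← this, sandwich_one, sandwich_tmul, mul_one, mul_one]
    simp only [LinearMap.comp_apply, double_comul_comatrix p hU hV hn hx, map_sum,
      LinearMap.lTensor_tmul, double_antipode_tmul hp, e, double_counit_tmul, hn.counit, hx.counit]
    simp only [← map_sum, ← TensorProduct.sum_tmul, hx.sum_mul_antipode]
    by_cases h : i = j
    · simp only [h, if_true, exchange_one_left hp, sandwich_tmul, mul_one,
        ← TensorProduct.sum_tmul, hn.sum_mul_antipodeInv]
      split_ifs <;> simp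
    · simp [h]

end DoubleHopf

/-! ### The projection of the double onto `U^cop` -/

section DoubleProjection

open HopfAlgebra (antipode)

variable {k U V : Type*} [Field k] [Ring U] [HopfAlgebra k U] [Ring V] [HopfAlgebra k V]
  {p : U →ₗ[k] V →ₗ[k] k} {γ : V →ₗ[k] U}
  {hU : Function.Bijective (antipode k : U →ₗ[k] U)}
  {hV : Function.Bijective (antipode k : V →ₗ[k] V)}
  {ι : Type} [Fintype ι] [DecidableEq ι] {x : ι → ι → V}

theorem IsProjectionDatum.map_mul (hγ : IsProjectionDatum p γ hU) (x y : V) :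
    γ (x * y) = γ x * γ y :=
  hγ.isBialgebraHom.map_mul x y

theorem IsProjectionDatum.map_one (hγ : IsProjectionDatum p γ hU) : γ 1 = 1 :=
  hγ.isBialgebraHom.map_one

theorem IsProjectionDatum.counit_map (hγ : IsProjectionDatum p γ hU) (x : V) :
    Coalgebra.counit (R := k) (γ x) = Coalgebra.counit (R := k) x :=
  hγ.isBialgebraHom.map_counit x

/-- As `γ` reverses the comultiplication, it maps comatrices to transposed comatrices. -/
theorem IsProjectionDatum.comatrix (hγ : IsProjectionDatum p γ hU) (hx : IsComatrix k x) :
    IsComatrix k (fun i j => γ (x j i)) where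
  comul i j := by
    have := congr_arg (TensorProduct.comm k U U) (hγ.isBialgebraHom.map_comul (x j i))
    simpa [copData, hopfData, hx.comul] using this
  counit i j := by simp [hγ.counit_map, hx.counit, eq_comm]

/-- A bialgebra map respects antipodes, and that of `U^cop` is `S⁻¹`: both sides invert the matrix
`γ (x i j)`. -/
theorem IsProjectionDatum.map_antipode (hγ : IsProjectionDatum p γ hU) (y : V) :
    γ (antipode k y) = antipodeInv hU (γ y) := by
  suffices γ ∘ₗ antipode k = antipodeInv hU ∘ₗ γ from LinearMap.congr_fun this y
  refine ext_comatrix fun r x hx i j => ?_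
  let M : Matrix (Fin r) (Fin r) U := .of fun i j => γ (x i j)
  let L : Matrix (Fin r) (Fin r) U := .of fun i j => γ (antipode k (x i j))
  let N : Matrix (Fin r) (Fin r) U := .of fun i j => antipodeInv hU (γ (x i j))
  have hL : L * M = 1 := by
    ext i j
    simp only [L, M, Matrix.mul_apply, Matrix.of_apply, ← hγ.map_mul, ← map_sum,
      hx.sum_antipode_mul, Matrix.one_apply]
    split_ifs <;> simp [hγ.map_one]
  have hN : M * N = 1 := by
    ext i j
    simp only [N, M, Matrix.mul_apply, Matrix.of_apply, (hγ.comatrix hx).sum_mul_antipodeInv hU,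
      Matrix.one_apply, eq_comm]
  have h : L = N := left_inv_eq_right_inv hL hN
  exact congr_fun₂ h i j

theorem IsProjectionDatum.map_antipodeInv (hγ : IsProjectionDatum p γ hU) (y : V) :
    γ (antipodeInv hV y) = antipode k (γ y) := by
  conv_rhs => rw [← antipode_antipodeInv hV y, hγ.map_antipode, antipode_antipodeInv]

theorem doubleProj_tmul (m : U) (x : V) : doubleProj γ (m ⊗ₜ x) = m * γ x := rfl

theorem doubleProj_sandwich (hγ : IsProjectionDatum p γ hU) (m : U) (y : V) (t : U ⊗[k] V) :
    doubleProj γ (sandwich m y t) = m * doubleProj γ t * γ y := by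
  induction t with
  | zero => simp
  | add s t hs ht => simp only [map_add, hs, ht, mul_add, add_mul]
  | tmul n x => simp [doubleProj_tmul, hγ.map_mul, mul_assoc]

theorem doubleProj_exchange (hγ : IsProjectionDatum p γ hU) (x : V) (n : U) :
    doubleProj γ (exchange p hU (x ⊗ₜ n)) = γ x * n :=
  (hγ.exchange_eq x n).symm

theorem doubleIncl_apply (m : U) : doubleIncl m = m ⊗ₜ[k] (1 : V) := rfl

theorem doubleIncl_isHopfAlgebraHom (hp : IsPairing p) :
    IsHopfAlgebraHom (copData hU) (double p hU hV) doubleIncl where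
  map_mul m n := by
    simp [doubleIncl_apply, double_mul_tmul, exchange_one_left hp, copData]
  map_one := rfl
  map_comul m := by
    suffices (double p hU hV).comul ∘ₗ doubleIncl =
        TensorProduct.map doubleIncl doubleIncl ∘ₗ (copData hU).comul from
      LinearMap.congr_fun this m
    refine ext_comatrix fun r n hn i j => ?_
    have := double_comul_comatrix p hU hV hn (isComatrix_one (k := k) (A := V)) i j 0 0
    simpa [doubleIncl_apply, copData, hn.comul] using this
  map_counit m := by simp [doubleIncl_apply, double_counit_tmul, copData]
  map_antipode m := by
    simp [doubleIncl_apply, double_antipode_tmul hp, exchange_one_left hp, copData]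

theorem doubleProj_isHopfAlgebraHom (hp : IsPairing p) (hγ : IsProjectionDatum p γ hU) :
    IsHopfAlgebraHom (double p hU hV) (copData hU) (doubleProj γ) where
  map_mul s t := by
    induction s with
    | zero => simp
    | add s s' hs hs' => simp only [map_add, TensorProduct.add_tmul, hs, hs']
    | tmul m x =>
      induction t with
      | zero => simp
      | add s s' hs hs' => simp only [map_add, TensorProduct.tmul_add, hs, hs']
      | tmul n y =>
        simp [double_mul_tmul, doubleProj_sandwich hγ, doubleProj_exchange hγ, doubleProj_tmul,
          copData, mul_assoc]
  map_one := by simp [double, copData, doubleProj_tmul, hγ.map_one]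
  map_comul t := by
    suffices (copData hU).comul ∘ₗ doubleProj γ =
        TensorProduct.map (doubleProj γ) (doubleProj γ) ∘ₗ (double p hU hV).comul from
      LinearMap.congr_fun this t
    refine ext_comatrix_tmul fun r n hn s x hx a b i j => ?_
    have := (hn.mul (hγ.comatrix hx)).comul (a, j) (b, i)
    simp only [Fintype.sum_prod_type] at this
    simp [double_comul_comatrix p hU hV hn hx, doubleProj_tmul, copData, this]
  map_counit t := by
    induction t with
    | zero => simp
    | add s s' hs hs' => simp only [map_add, hs, hs']
    | tmul m x => simp [doubleProj_tmul, double_counit_tmul, copData, hγ.counit_map]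
  map_antipode t := by
    induction t with
    | zero => simp
    | add s s' hs hs' => simp only [map_add, hs, hs']
    | tmul m x =>
      simp [doubleProj_tmul, double_antipode_tmul hp, doubleProj_exchange hγ, copData,
        antipodeInv_mul, hγ.map_antipode]

theorem doubleProj_comp_doubleIncl (hγ : IsProjectionDatum p γ hU) :
    doubleProj γ ∘ₗ doubleIncl = LinearMap.id := by
  ext m
  simp [doubleProj_tmul, doubleIncl_apply, hγ.map_one]

end DoubleProjection

/-! ### The coinvariants of the projection -/

section Coinvariants

open HopfAlgebra (antipode)

variable {k U V : Type*} [Field k] [Ring U] [HopfAlgebra k U] [Ring V] [HopfAlgebra k V]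
  {p : U →ₗ[k] V →ₗ[k] k} {γ : V →ₗ[k] U}
  {hU : Function.Bijective (antipode k : U →ₗ[k] U)}
  {hV : Function.Bijective (antipode k : V →ₗ[k] V)}
  {ι κ : Type} [Fintype ι] [DecidableEq ι] {x : ι → ι → V}
  [Fintype κ] [DecidableEq κ] {n : κ → κ → U}

variable (k U V) in
/-- The map `m ⊗ x ↦ ε(m) x`, a retraction of `theta`. -/
noncomputable def doubleRetract : U ⊗[k] V →ₗ[k] V :=
  (TensorProduct.lid k V).toLinearMap ∘ₗ Coalgebra.counit.rTensor V

theorem doubleRetract_tmul (m : U) (x : V) :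
    doubleRetract k U V (m ⊗ₜ x) = Coalgebra.counit (R := k) m • x := rfl

theorem doubleRetract_sandwich (m : U) (y : V) (t : U ⊗[k] V) :
    doubleRetract k U V (sandwich m y t) =
      Coalgebra.counit (R := k) m • (doubleRetract k U V t * y) := by
  induction t with
  | zero => simp
  | add s t hs ht => simp only [map_add, hs, ht, add_mul, smul_add]
  | tmul n x => simp [doubleRetract_tmul, smul_smul]

/-- `x ⊗ n ↦ ⟨n, S⁻¹(x₃) x₁⟩ x₂`. -/
theorem doubleRetract_exchange (hV : Function.Bijective (antipode k : V →ₗ[k] V))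
    (hp : IsPairing p) (hx : IsComatrix k x) (i j : ι) (n : U) :
    doubleRetract k U V (exchange p hU (x i j ⊗ₜ n)) =
      ∑ a, ∑ b, p n (antipodeInv hV (x b j) * x i a) • x a b := by
  suffices doubleRetract k U V ∘ₗ exchange p hU ∘ₗ TensorProduct.mk k V U (x i j) =
      ∑ a, ∑ b, (p.flip (antipodeInv hV (x b j) * x i a)).smulRight (x a b) by
    simpa [LinearMap.sum_apply] using LinearMap.congr_fun this n
  refine ext_comatrix fun r n hn a b => ?_
  simp only [LinearMap.comp_apply, TensorProduct.mk_apply, exchange_comatrix p hU hx hn, map_sum,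
    map_smul, doubleRetract_tmul, hn.counit, LinearMap.sum_apply, LinearMap.smulRight_apply,
    LinearMap.flip_apply, hp.mul_right_comatrix hn, hp.antipodeInv_left hU hV, Finset.sum_smul]
  simp [ite_smul, mul_comm]

/-- The retraction replaces left factors from `U` by their counits, so the image of a product
depends on its first factor only through the retraction. A first factor `θ(x)` may thus be replaced
by `x`. -/
theorem doubleRetract_mul (t : U ⊗[k] V) (n : U) (z : V) :
    doubleRetract k U V ((double p hU hV).mul (t ⊗ₜ (n ⊗ₜ z))) =
      doubleRetract k U V (exchange p hU (doubleRetract k U V t ⊗ₜ n)) * z := by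
  induction t with
  | zero => simp
  | add s t hs ht => simp only [map_add, TensorProduct.add_tmul, hs, ht, add_mul]
  | tmul m x =>
    simp [double_mul_tmul, doubleRetract_sandwich, doubleRetract_tmul, ← TensorProduct.smul_tmul']

theorem doubleRetract_incl_mul (hp : IsPairing p) (m : U) (t : U ⊗[k] V) :
    doubleRetract k U V ((double p hU hV).mul (doubleIncl m ⊗ₜ t)) =
      Coalgebra.counit (R := k) m • doubleRetract k U V t := by
  induction t with
  | zero => simp
  | add s t hs ht => simp only [map_add, TensorProduct.tmul_add, hs, ht, smul_add]
  | tmul n x =>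
    simp [doubleIncl_apply, double_mul_tmul, doubleRetract_tmul, exchange_one_left hp, smul_smul]

theorem theta_comatrix (hx : IsComatrix k x) (i j : ι) :
    theta γ (x i j) = ∑ a, antipode k (γ (x a j)) ⊗ₜ[k] x i a := by
  simp only [theta, hx.sweedler_succ, sweedler_zero]
  rfl

theorem theta'_comatrix (hx : IsComatrix k x) (i j : ι) :
    theta' γ hV (x i j) = ∑ a, γ (antipodeInv hV (x a j)) ⊗ₜ[k] x i a := by
  simp only [theta', hx.sweedler_succ, sweedler_zero]
  rfl

theorem theta_eq_theta' (hγ : IsProjectionDatum p γ hU) : theta γ = theta' γ hV := by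
  refine ext_comatrix fun r x hx i j => ?_
  simp only [theta_comatrix hx, theta'_comatrix hx, hγ.map_antipodeInv]

theorem doubleRetract_theta (hγ : IsProjectionDatum p γ hU) (y : V) :
    doubleRetract k U V (theta γ y) = y := by
  suffices doubleRetract k U V ∘ₗ theta γ = LinearMap.id from LinearMap.congr_fun this y
  refine ext_comatrix fun r x hx i j => ?_
  simp [theta_comatrix hx, doubleRetract_tmul, hγ.counit_map, hx.counit, ite_smul]

theorem IsProjectionDatum.comatrix_antipode_map (hγ : IsProjectionDatum p γ hU)
    (hx : IsComatrix k x) : IsComatrix k (fun i j => antipode k (γ (x i j))) :=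
  (hγ.comatrix hx).comatrix_antipode

theorem double_comul_theta (hγ : IsProjectionDatum p γ hU) (hx : IsComatrix k x) (i j : ι) :
    (double p hU hV).comul (theta γ (x i j)) =
      ∑ a, ∑ u, ∑ g, (antipode k (γ (x u j)) ⊗ₜ[k] x i g) ⊗ₜ[k]
        (antipode k (γ (x a u)) ⊗ₜ[k] x g a) := by
  simp only [theta_comatrix hx, map_sum,
    double_comul_comatrix p hU hV (hγ.comatrix_antipode_map hx) hx]

theorem theta_mem_coinvariants (hV : Function.Bijective (antipode k : V →ₗ[k] V))
    (hγ : IsProjectionDatum p γ hU) (y : V) :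
    theta γ y ∈ coinvariants (double p hU hV) (copData hU) (doubleProj γ) := by
  suffices (doubleProj γ).lTensor _ ∘ₗ (double p hU hV).comul ∘ₗ theta γ =
      (TensorProduct.mk k _ U).flip 1 ∘ₗ theta γ from LinearMap.congr_fun this y
  refine ext_comatrix fun r x hx i j => ?_
  simp only [LinearMap.comp_apply, double_comul_theta hγ hx, map_sum, LinearMap.lTensor_tmul,
    doubleProj_tmul, LinearMap.flip_apply, TensorProduct.mk_apply]
  rw [sum_rotate₃]
  -- With `S(γ(y)) = γ(S⁻¹(y))`, this is `γ` applied to `S⁻¹(y₂) y₁ = ε(y)`.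
  have e (u g : Fin r) : ∑ a, antipode k (γ (x a u)) * γ (x g a) = if g = u then 1 else 0 := by
    simp only [← hγ.map_antipodeInv (hV := hV), ← hγ.map_mul, ← map_sum, hx.sum_antipodeInv_mul]
    split_ifs <;> simp [hγ.map_one]
  simp [← TensorProduct.tmul_sum, e, TensorProduct.tmul_ite, theta_comatrix hx,
    TensorProduct.sum_tmul]

/-- Every `a` in the double equals `π(a₂) θ(e(a₁))`, with `e` the retraction: for `m ⊗ x` this is `m
γ(x₃ S⁻¹(x₂)) ⊗ x₁`. For a coinvariant, `a₁ ⊗ π(a₂) = a ⊗ 1` reduces it to `θ(e(a))`. -/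
theorem eq_theta_of_mem_coinvariants (hV : Function.Bijective (antipode k : V →ₗ[k] V))
    (hγ : IsProjectionDatum p γ hU) {t : U ⊗[k] V}
    (ht : t ∈ coinvariants (double p hU hV) (copData hU) (doubleProj γ)) :
    theta γ (doubleRetract k U V t) = t := by
  let F : (U ⊗[k] V) ⊗[k] U →ₗ[k] U ⊗[k] V := (LinearMap.mul' k U).rTensor V ∘ₗ
    (TensorProduct.assoc k U U V).symm.toLinearMap ∘ₗ (TensorProduct.comm k _ U).toLinearMap ∘ₗ
      (theta γ ∘ₗ doubleRetract k U V).rTensor U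
  have F_tmul (s : U ⊗[k] V) (m : U) :
      F (s ⊗ₜ m) = sandwich m 1 (theta γ (doubleRetract k U V s)) := by
    simp only [F, LinearMap.comp_apply, LinearMap.rTensor_tmul, LinearEquiv.coe_coe,
      TensorProduct.comm_tmul]
    induction theta γ (doubleRetract k U V s) with
    | zero => simp
    | add s t hs ht => simp only [TensorProduct.tmul_add, map_add, hs, ht]
    | tmul m x => simp
  have key : F ∘ₗ (doubleProj γ).lTensor _ ∘ₗ (double p hU hV).comul = LinearMap.id := by
    refine ext_comatrix_tmul fun r n hn s x hx a b i j => ?_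
    simp only [LinearMap.comp_apply, double_comul_comatrix p hU hV hn hx, map_sum,
      LinearMap.lTensor_tmul, doubleProj_tmul, F_tmul, doubleRetract_tmul, map_smul, hn.counit,
      theta_comatrix hx, sandwich_tmul, mul_one, ← hγ.map_antipodeInv (hV := hV), mul_assoc,
      ← hγ.map_mul]
    rw [Finset.sum_comm]
    simp only [ite_smul, one_smul, zero_smul, Finset.sum_ite_eq', Finset.mem_univ, if_true]
    rw [Finset.sum_comm]
    simp only [← TensorProduct.sum_tmul, ← Finset.mul_sum, ← map_sum, hx.sum_mul_antipodeInv]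
    simp [apply_ite γ, hγ.map_one, TensorProduct.ite_tmul]
  have ht' : (doubleProj γ).lTensor _ ((double p hU hV).comul t) = t ⊗ₜ 1 := ht
  have h : F ((doubleProj γ).lTensor _ ((double p hU hV).comul t)) = t :=
    LinearMap.congr_fun key t
  rwa [ht', F_tmul, sandwich_one] at h

theorem range_theta (hγ : IsProjectionDatum p γ hU) :
    LinearMap.range (theta γ) = coinvariants (double p hU hV) (copData hU) (doubleProj γ) := by
  ext t
  refine ⟨?_, fun ht => ⟨_, eq_theta_of_mem_coinvariants hV hγ ht⟩⟩
  rintro ⟨y, rfl⟩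
  exact theta_mem_coinvariants hV hγ y

/-! ### The explicit structure maps on `V` -/

theorem underlineYD_act (hx : IsComatrix k x) (m : U) (i j : ι) :
    (underlineYD p γ hV).act (m ⊗ₜ x i j) =
      ∑ a, ∑ b, p m (antipodeInv hV (antipodeInv hV (x b j) * x i a)) • x a b := by
  simp only [underlineYD, TensorProduct.lift.tmul, LinearMap.flip_apply, hx.sweedler_succ,
    sweedler_zero, LinearMap.sum_apply]
  rfl

theorem action'_comatrix (hn : IsComatrix k n) (hx : IsComatrix k x) (u v : κ) (i j : ι) :
    action' p hV (n u v ⊗ₜ x i j) =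
      ∑ w, ∑ a, ∑ b, (p (n u w) (antipodeInv hV (x i a)) *
        p (n w v) (antipodeInv hV (antipodeInv hV (x b j)))) • x a b := by
  simp only [action', TensorProduct.lift.tmul, sweedler₂, LinearMap.comp_apply, hx.sweedler_succ,
    sweedler_zero, map_sum, LinearMap.sum_apply, hn.sweedler_succ]
  rfl

theorem underlineYD_act_eq_action' (hp : IsPairing p) :
    (underlineYD p γ hV).act = action' p hV := by
  refine ext_comatrix_tmul fun r n hn s x hx u v i j => ?_
  simp only [underlineYD_act hx, action'_comatrix hn hx, antipodeInv_mul,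
    hp.mul_right_comatrix hn, Finset.sum_smul]
  rw [sum_rotate₃ fun w a b => (p (n u w) (antipodeInv hV (x i a)) *
        p (n w v) (antipodeInv hV (antipodeInv hV (x b j)))) • x a b]

theorem underlineYD_coact (hx : IsComatrix k x) (i j : ι) :
    (underlineYD p γ hV).coact (x i j) =
      ∑ a, ∑ b, γ (antipodeInv hV (x b j) * x i a) ⊗ₜ[k] x a b := by
  simp only [underlineYD, hx.sweedler_succ, sweedler_zero]
  rfl

theorem underlineHopf_mul {y : κ → κ → V} (hx : IsComatrix k x) (hy : IsComatrix k y)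
    (i j : ι) (u v : κ) :
    (underlineHopf p γ hV).mul (x i j ⊗ₜ y u v) =
      ∑ a, ∑ b, ∑ w, p (γ (y w v)) (antipode k (x i a) * x b j) • (x a b * y u w) := by
  simp only [underlineHopf, TensorProduct.lift.tmul, sweedler₂, LinearMap.comp_apply,
    hx.sweedler_succ, sweedler_zero, map_sum, LinearMap.sum_apply, hy.sweedler_succ]
  rfl

theorem underlineHopf_comul (hx : IsComatrix k x) (i j : ι) :
    (underlineHopf p γ hV).comul (x i j) = ∑ a, ∑ b, ∑ c, ∑ d, ∑ e,
      p (γ (antipode k (x c d) * x e j)) (antipodeInv hV (x b c) * x i a) •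
        (x a b ⊗ₜ[k] x d e) := by
  simp only [underlineHopf, hx.sweedler_succ, sweedler_zero]
  rfl

theorem underlineHopf_antipode (hx : IsComatrix k x) (i j : ι) :
    (underlineHopf p γ hV).antipode (x i j) = ∑ a, ∑ b, ∑ c,
      p (γ (x c j)) (x i a * antipode k (x b c)) • antipode k (x a b) := by
  simp only [underlineHopf, hx.sweedler_succ, sweedler_zero]
  rfl

/-- `n ⊗ x ↦ ⟨n γ(x₄), S⁻¹(S⁻¹(x₃) x₁)⟩ x₂`. -/
theorem doubleRetract_coinvariantProj (hp : IsPairing p) (hx : IsComatrix k x) (m : U) (i j : ι) :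
    doubleRetract k U V (coinvariantProj (double p hU hV) (copData hU) doubleIncl (doubleProj γ)
      (m ⊗ₜ x i j)) = ∑ g, ∑ a, ∑ b,
        p (m * γ (x g j)) (antipodeInv hV (antipodeInv hV (x b g) * x i a)) • x a b := by
  suffices doubleRetract k U V ∘ₗ coinvariantProj (double p hU hV) (copData hU) doubleIncl
      (doubleProj γ) ∘ₗ (TensorProduct.mk k U V).flip (x i j) =
      ∑ g, ∑ a, ∑ b, (p.flip (antipodeInv hV (antipodeInv hV (x b g) * x i a)) ∘ₗ
        LinearMap.mulRight k (γ (x g j))).smulRight (x a b) by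
    simpa [LinearMap.sum_apply] using LinearMap.congr_fun this m
  refine ext_comatrix fun r n hn u v => ?_
  simp only [coinvariantProj, LinearMap.comp_apply, LinearMap.flip_apply, TensorProduct.mk_apply,
    double_comul_comatrix p hU hV hn hx, map_sum, LinearMap.lTensor_tmul, doubleProj_tmul,
    doubleIncl_apply, doubleRetract_mul, doubleRetract_tmul, hn.counit, mul_one,
    ← TensorProduct.smul_tmul', map_smul]
  rw [Finset.sum_comm]
  simp only [ite_smul, one_smul, zero_smul, Finset.sum_ite_eq', Finset.mem_univ, if_true,
    doubleRetract_exchange hV hp hx, copData, hp.antipodeInv_left hU hV, LinearMap.sum_apply,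
    LinearMap.smulRight_apply, LinearMap.comp_apply, LinearMap.flip_apply,
    LinearMap.mulRight_apply]

theorem underline_isRetractModel (hp : IsPairing p) (hγ : IsProjectionDatum p γ hU) :
    IsRetractModel (double p hU hV) (copData hU) doubleIncl (doubleProj γ) (theta γ)
      (doubleRetract k U V) (underlineYD p γ hV) (underlineHopf p γ hV) where
  retract := doubleRetract_theta hγ
  range_theta := range_theta hγ
  act_eq m y := by
    suffices (underlineYD p γ hV).act = doubleRetract k U V ∘ₗ
        adjointAction (double p hU hV) (copData hU) doubleIncl ∘ₗ (theta γ).lTensor U from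
      LinearMap.congr_fun this (m ⊗ₜ y)
    refine ext_comatrix_tmul fun r n hn s x hx u v i j => ?_
    have e (m m' : U) : doubleRetract k U V ((double p hU hV).mul
        ((double p hU hV).mul (doubleIncl m ⊗ₜ theta γ (x i j)) ⊗ₜ doubleIncl m')) =
        Coalgebra.counit (R := k) m • doubleRetract k U V (exchange p hU (x i j ⊗ₜ m')) := by
      rw [doubleIncl_apply (V := V) m', doubleRetract_mul, doubleRetract_incl_mul hp, mul_one,
        doubleRetract_theta hγ, ← TensorProduct.smul_tmul', map_smul, map_smul]
    simp only [adjointAction, LinearMap.comp_apply, LinearMap.lTensor_tmul, LinearMap.rTensor_tmul,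
      copData, hn.comul, map_sum, TensorProduct.sum_tmul, LinearEquiv.coe_coe,
      TensorProduct.comm_tmul, TensorProduct.rightComm_tmul, TensorProduct.map_tmul, e, hn.counit,
      underlineYD_act hx, doubleRetract_exchange hV hp hx, hp.antipodeInv_left hU hV]
    simp [ite_smul]
  coact_eq y := by
    suffices (underlineYD p γ hV).coact = TensorProduct.map (doubleProj γ) (doubleRetract k U V) ∘ₗ
        (double p hU hV).comul ∘ₗ theta γ from LinearMap.congr_fun this y
    refine ext_comatrix fun r x hx i j => ?_
    simp only [LinearMap.comp_apply, double_comul_theta hγ hx, map_sum, TensorProduct.map_tmul,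
      doubleProj_tmul, doubleRetract_tmul, (hγ.comatrix_antipode_map hx).counit,
      underlineYD_coact hx, hγ.map_mul, hγ.map_antipodeInv]
    rw [Finset.sum_comm]
    simp [ite_smul, TensorProduct.tmul_ite]
  mul_eq x y := by
    suffices (underlineHopf p γ hV).mul = doubleRetract k U V ∘ₗ (double p hU hV).mul ∘ₗ
        TensorProduct.map (theta γ) (theta γ) from LinearMap.congr_fun this (x ⊗ₜ y)
    refine ext_comatrix_tmul fun r x hx s y hy i j u v => ?_
    simp only [LinearMap.comp_apply, TensorProduct.map_tmul, theta_comatrix hy,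
      TensorProduct.tmul_sum, map_sum, doubleRetract_mul, doubleRetract_theta hγ,
      doubleRetract_exchange hV hp hx, underlineHopf_mul hx hy, hp.antipode_left,
      HopfAlgebra.antipode_mul_antidistrib, antipode_antipodeInv, Finset.sum_mul, smul_mul_assoc]
    rw [sum_rotate₃ fun w a b => p (γ (y w v)) (antipode k (x i a) * x b j) • (x a b * y u w)]
  one_eq := by simp [underlineHopf, double, doubleRetract_tmul]
  comul_eq y := by
    suffices (underlineHopf p γ hV).comul = TensorProduct.map (doubleRetract k U V ∘ₗ
        coinvariantProj (double p hU hV) (copData hU) doubleIncl (doubleProj γ))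
          (doubleRetract k U V) ∘ₗ (double p hU hV).comul ∘ₗ theta γ from
      LinearMap.congr_fun this y
    refine ext_comatrix fun r x hx i j => ?_
    -- The outer `S⁻¹` of the action is moved to the `U` side, where it turns `S(γ(x₆)) γ(x₄)` into
    -- `S⁻¹(γ(x₄)) γ(x₆) = γ(S(x₄) x₆)`.
    have e (a b c d e : Fin r) : p (antipode k (γ (x e j)) * γ (x c d))
        (antipodeInv hV (antipodeInv hV (x b c) * x i a)) =
        p (γ (antipode k (x c d) * x e j)) (antipodeInv hV (x b c) * x i a) := by
      rw [← hp.antipodeInv_left hU, ← hγ.map_antipodeInv (hV := hV), ← hγ.map_mul,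
        ← hγ.map_antipode, HopfAlgebra.antipode_mul_antidistrib, antipode_antipodeInv]
    simp only [LinearMap.comp_apply, double_comul_theta hγ hx, map_sum, TensorProduct.map_tmul,
      doubleRetract_coinvariantProj hp hx, doubleRetract_tmul,
      (hγ.comatrix_antipode_map hx).counit, underlineHopf_comul hx, e, TensorProduct.sum_tmul,
      ite_smul, one_smul, zero_smul, TensorProduct.tmul_ite,
      Finset.sum_ite_irrel, Finset.sum_const_zero, Finset.sum_ite_eq,
      Finset.mem_univ, if_true, TensorProduct.smul_tmul']
    exact sum_perm₅ _
  counit_eq y := by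
    suffices (underlineHopf p γ hV).counit = (double p hU hV).counit ∘ₗ theta γ from
      LinearMap.congr_fun this y
    refine ext_comatrix fun r x hx i j => ?_
    simp [underlineHopf, theta_comatrix hx, double_counit_tmul, hγ.counit_map, hx.counit]
  antipode_eq y := by
    suffices (underlineHopf p γ hV).antipode = doubleRetract k U V ∘ₗ (double p hU hV).mul ∘ₗ
        TensorProduct.map (doubleIncl ∘ₗ doubleProj γ) (double p hU hV).antipode ∘ₗ
          (double p hU hV).comul ∘ₗ theta γ from LinearMap.congr_fun this y
    refine ext_comatrix fun r x hx i j => ?_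
    -- The left factor `i(π(b₁))` contributes only counits. The rest is the retraction of `S(x)
    -- γ(x')`, computed with the transposed comatrix of `S(x)`; there `S⁻¹(S(x₁)) = x₁` gives the
    -- coefficient `⟨γ(x₄), x₁ S(x₃)⟩`.
    simp only [LinearMap.comp_apply, double_comul_theta hγ hx, map_sum, TensorProduct.map_tmul,
      doubleRetract_incl_mul hp, doubleProj_tmul, Bialgebra.counit_mul, hγ.counit_map,
      HopfAlgebra.counit_antipode, hx.counit, double_antipode_tmul hp, antipodeInv_antipode,
      doubleRetract_exchange hV hp hx.comatrix_antipode, underlineHopf_antipode hx,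
      mul_ite, mul_one, mul_zero, ite_smul, one_smul, zero_smul,
      Finset.sum_ite_eq, Finset.sum_ite_eq',
      Finset.mem_univ, if_true]
    exact (sum_rotate₃ _).trans Finset.sum_comm

end Coinvariants

end DoubleBiproduct

open DoubleBiproduct in
theorem mainTheorem2 {k U V : Type*} [Field k] [Ring U] [HopfAlgebra k U]
    [Ring V] [HopfAlgebra k V]
    (hU : Function.Bijective (HopfAlgebra.antipode k : U →ₗ[k] U))
    (hV : Function.Bijective (HopfAlgebra.antipode k : V →ₗ[k] V))
    (p : U →ₗ[k] V →ₗ[k] k) (hp : IsPairing p)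
    (γ : V →ₗ[k] U) (hγ : IsProjectionDatum p γ hU) :
    -- the double is a Hopf algebra with projection
    ((double p hU hV).IsHopfAlgebra ∧
      (copData hU).IsHopfAlgebra ∧
      IsHopfAlgebraHom (copData hU) (double p hU hV) doubleIncl ∧
      IsHopfAlgebraHom (double p hU hV) (copData hU) (doubleProj γ) ∧
      doubleProj γ ∘ₗ doubleIncl = LinearMap.id) ∧
    -- `θ` is a bijection of `V` onto the coinvariants
    (theta γ = theta' γ hV ∧
      Function.Injective (theta γ) ∧
      LinearMap.range (theta γ) =
        coinvariants (double p hU hV) (copData hU) (doubleProj γ) ∧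
      LinearMap.range (coinvariantProj (double p hU hV) (copData hU) doubleIncl (doubleProj γ)) =
        coinvariants (double p hU hV) (copData hU) (doubleProj γ)) ∧
    -- the explicit structure on `V` is the one carried over from the coinvariants by `θ`
    ((underlineYD p γ hV).act = action' p hV ∧
      (∀ m y, theta γ ((underlineYD p γ hV).act (m ⊗ₜ y)) =
        adjointAction (double p hU hV) (copData hU) doubleIncl (m ⊗ₜ theta γ y)) ∧
      (∀ y, (theta γ).lTensor U ((underlineYD p γ hV).coact y) =
        (doubleProj γ).rTensor (U ⊗[k] V) ((double p hU hV).comul (theta γ y))) ∧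
      (∀ x y, theta γ ((underlineHopf p γ hV).mul (x ⊗ₜ y)) =
        (double p hU hV).mul (theta γ x ⊗ₜ theta γ y)) ∧
      theta γ (underlineHopf p γ hV).one = (double p hU hV).one ∧
      (∀ x a,
        theta γ x =
          coinvariantProj (double p hU hV) (copData hU) doubleIncl (doubleProj γ) a →
        TensorProduct.map (theta γ) (theta γ) ((underlineHopf p γ hV).comul x) =
          TensorProduct.map
            (coinvariantProj (double p hU hV) (copData hU) doubleIncl (doubleProj γ))
            (coinvariantProj (double p hU hV) (copData hU) doubleIncl (doubleProj γ))
            ((double p hU hV).comul a)) ∧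
      (∀ x, (underlineHopf p γ hV).counit x = (double p hU hV).counit (theta γ x)) ∧
      (∀ x, theta γ ((underlineHopf p γ hV).antipode x) =
        (double p hU hV).mul
          (TensorProduct.map (doubleIncl ∘ₗ doubleProj γ) (double p hU hV).antipode
            ((double p hU hV).comul (theta γ x))))) ∧
    -- it makes `V` a Hopf algebra in the category of left Yetter-Drinfeld modules over `U^cop`
    IsHopfAlgebraInYD (copData hU) (underlineYD p γ hV) (underlineHopf p γ hV) ∧
    -- the double is isomorphic to the Radford biproduct
    ((biproduct (copData hU) (underlineYD p γ hV) (underlineHopf p γ hV)).IsHopfAlgebra ∧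
      IsHopfAlgebraHom (biproduct (copData hU) (underlineYD p γ hV) (underlineHopf p γ hV))
        (double p hU hV) (chi p γ hU hV) ∧
      Function.Bijective (chi p γ hU hV)) := by
  have hD := double_isHopfAlgebra (hU := hU) (hV := hV) hp
  have hK := copData_isHopfAlgebra hU
  have hi := doubleIncl_isHopfAlgebraHom (hU := hU) (hV := hV) hp
  have hπ := doubleProj_isHopfAlgebraHom (hV := hV) hp hγ
  have hπi := doubleProj_comp_doubleIncl hγ
  have hθ := underline_isRetractModel (hV := hV) hp hγ
  obtain ⟨range_proj, transport, yd, biproduct_hopf, hom, bij⟩ := hθ.radford hD hK hi hπ hπi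
  exact ⟨⟨hD, hK, hi, hπ, hπi⟩,
    ⟨theta_eq_theta' hγ, Function.LeftInverse.injective hθ.retract, hθ.range_theta, range_proj⟩,
    ⟨underlineYD_act_eq_action' hp, transport⟩, yd, biproduct_hopf, hom, bij⟩
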